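/- Setting. Let $\Lambda(1,6)_+=\mathbb C[t]\otimes\Lambda(6)$, where $\Lambda(6)$ is the Grassmann algebra in odd variables $\xi_1,\dots,\xi_6$; for $I=\{i_1<\dots<i_k\}\subseteq\{1,\dots,6\}$ put $\xi_I=\xi_{i_1}\cdots\xi_{i_k}$, $|I|=k$, and $\xi_*=\xi_1\xi_2\cdots\xi_6$. With the bracket $$[f,g]=\Big(2f-\sum_i\xi_i\partial_if\Big)\partial_tg-\partial_tf\Big(2g-\sum_i\xi_i\partial_ig\Big)+(-1)^{p(f)}\sum_i\partial_if\,\partial_ig$$ and the grading $\deg(t^m\xi_I)=2m+|I|-2$ this is the graded Lie superalgebra $K(1,6)_+$. Let $\xi_I^*$ be the signed monomial with $\xi_I\xi_I^*=\xi_*$, and let $A$ be the linear operator $$A(t^k\xi_L)=(-1)^{|L|(|L|+1)/2}\Big(\frac{d}{dt}\Big)^{3-|L|}\big(t^k\xi_L^*\big),$$ where $(d/dt)^{-1}$ sends $t^k$ to $t^{k+1}/(k+1)$. Let $\mathfrak g$ be the image of $\mathrm{Id}-iA$ with the induced bracket and grading; this is the annihilation superalgebra of the conformal superalgebra $CK_6$,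 isomorphic to $E(1,6)$. Let $F$ be a finite-dimensional irreducible $\mathfrak g_{\ge0}$-module and $\mathrm{Ind}(F)=U(\mathfrak g)\otimes_{U(\mathfrak g_{\ge0})}F$ the corresponding finite Verma module. A vector $m\in\mathrm{Ind}(F)$ is called singular if $\mathfrak g_{>0}\,m=0$. Let $\Theta=-\tfrac12\cdot 1\in\mathfrak g_{-2}$, let $\eta_i$ be the image of $\xi_i\in\mathfrak g_{-1}$ in $U(\mathfrak g)$, and let $\eta_I=\eta_{i_1}\cdots\eta_{i_k}$ for $I=\{i_1<\dots<i_k\}$. Statement. The map $\mathbb C[\Theta]\otimes\Lambda(6)\otimes F\to\mathrm{Ind}(F)$, $\Theta^k\otimes\xi_I\otimes v\mapsto\Theta^k\eta_I\otimes v$, is bijective, so that every $m\in \mathrm{Ind}(F)$ is uniquely a finite sum $m=\sum_{k\ge0}\sum_I\Theta^k\eta_I\otimes w_{I,k}$ with $w_{I,k}\in F$. Let $T$ be the linear automorphism of $\mathrm{Ind}(F)$ with $T(\Theta^k\eta_I\otimes v)=\Theta^k\,\overline{\eta_I}\otimes v$, where $\overline{\eta_I}=\pm\eta_{\{1,\dots,6\}\setminus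 I}$ with the sign for which $\overline{\eta_I}\,\eta_I=\eta_1\eta_2\cdots\eta_6$. If $m\in\mathrm{Ind}(F)$ is a singular vector, then $m$ has degree at most $2$ in $\Theta$ (that is, $w_{I,k}=0$ for all $I$ and all $k>2$), and $T(m)$ has the form $$T(m)=\Theta^2\sum_{|I|\ge5}\eta_I\otimes v_{I,2}+\Theta\sum_{|I|\ge3}\eta_I\otimes v_{I,1}+\sum_{|I|\ge1}\eta_I\otimes v_{I,0}$$ for some vectors $v_{I,k}\in F$. -/

import Mathlib

open scoped TensorProduct

noncomputable section

namespace CK6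

/-! ### The Grassmann superalgebra `ℂ[t] ⊗ Λ(6)` -/

/-- The sign with `ξ_I ξ_J = sgn I J • ξ_{I ∪ J}`, where `ξ_I` is the product of the `ξ_i`, `i ∈ I`,
in increasing order; it is `0` if `I` and `J` meet. -/
def sgn (I J : Finset (Fin 6)) : ℤ :=
  if Disjoint I J then (-1) ^ ((I ×ˢ J).filter fun x => x.2 < x.1).card else 0

/-- `Λ(1,6)₊ = ℂ[t] ⊗ Λ(6)`, in the basis of the monomials `t^k ξ_I`, indexed by `(k, I)`. -/
abbrev K : Type := (ℕ × Finset (Fin 6)) →₀ ℂ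

/-- The monomial `t^k ξ_I`. -/
def mono (k : ℕ) (I : Finset (Fin 6)) : K := Finsupp.single (k, I) 1

/-- The (super)commutative product of `ℂ[t] ⊗ Λ(6)`. -/
def mul : K →ₗ[ℂ] K →ₗ[ℂ] K :=
  Finsupp.linearCombination ℂ fun x =>
    Finsupp.linearCombination ℂ fun y => (sgn x.2 y.2 : ℂ) • mono (x.1 + y.1) (x.2 ∪ y.2)

/-- `∂/∂t`. -/
def dt : K →ₗ[ℂ] K :=
  Finsupp.linearCombination ℂ fun x => (x.1 : ℂ) • mono (x.1 - 1) x.2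

/-- Integration in `t`: `t^k ↦ t^(k+1) / (k+1)`. -/
def integ : K →ₗ[ℂ] K :=
  Finsupp.linearCombination ℂ fun x => ((x.1 : ℂ) + 1)⁻¹ • mono (x.1 + 1) x.2

/-- The odd (left) derivation `∂_i = ∂/∂ξ_i`. -/
def dxi (i : Fin 6) : K →ₗ[ℂ] K :=
  Finsupp.linearCombination ℂ fun x =>
    if i ∈ x.2 then ((-1 : ℂ) ^ (x.2.filter fun j => j < i).card) • mono x.1 (x.2.erase i) else 0

/-- `f ↦ (-1)^{p(f)} f`. -/
def parityAut : K →ₗ[ℂ] K :=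
  Finsupp.linearCombination ℂ fun x => ((-1 : ℂ) ^ x.2.card) • mono x.1 x.2

/-- `∑ i, ξ_i ∂_i`. -/
def euler : K →ₗ[ℂ] K := ∑ i : Fin 6, (mul (mono 0 {i})) ∘ₗ dxi i

/-- The contact bracket of `K(1,6)₊ ≅ Λ(1,6)₊`:
`[f,g] = (2f - ∑ ξ_i ∂_i f) ∂_t g - ∂_t f (2g - ∑ ξ_i ∂_i g) + (-1)^{p(f)} ∑ ∂_i f ∂_i g`. -/
def bracket (f g : K) : K :=
  mul ((2 : ℂ) • f - euler f) (dt g) - mul (dt f) ((2 : ℂ) • g - euler g)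
    + ∑ i : Fin 6, mul (dxi i (parityAut f)) (dxi i g)

/-- Elements of parity `p` (only `p` modulo `2` matters). -/
def ofParity (p : ℕ) : Submodule ℂ K := Finsupp.supported ℂ ℂ {x | x.2.card % 2 = p % 2}

/-- The degree `2k + |I| - 2` of `t^k ξ_I`. -/
def deg (x : ℕ × Finset (Fin 6)) : ℤ := 2 * (x.1 : ℤ) + (x.2.card : ℤ) - 2

/-! ### The annihilation superalgebra `E(1,6)` of `CK₆` -/

/-- The modified Hodge dual `t^k ξ_I ↦ t^k ξ_I^*`, where `ξ_I ξ_I^* = ξ_1 ξ_2 ξ_3 ξ_4 ξ_5 ξ_6`. -/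
def star : K →ₗ[ℂ] K :=
  Finsupp.linearCombination ℂ fun x => (sgn x.2 x.2ᶜ : ℂ) • mono x.1 x.2ᶜ

/-- `(d/dt)^(3 - l)`; for `l > 3` this is the `(l - 3)`-fold integration. -/
def dtPow (l : ℕ) : K →ₗ[ℂ] K := if l ≤ 3 then dt ^ (3 - l) else integ ^ (l - 3)

/-- `A (t^k ξ_L) = (-1)^{|L|(|L|+1)/2} (d/dt)^{3-|L|} (t^k ξ_L)^*`. -/
def opA : K →ₗ[ℂ] K :=
  Finsupp.linearCombination ℂ fun x =>
    ((-1 : ℂ) ^ (x.2.card * (x.2.card + 1) / 2)) • dtPow x.2.card (star (mono x.1 x.2))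

/-- The annihilation superalgebra of `CK₆`, i.e. the image of `Id - iA` in `K(1,6)₊`; it is closed
under `bracket` and graded by `deg`. -/
def g : Submodule ℂ K := LinearMap.range (LinearMap.id - Complex.I • opA)

/-- `g_{≥ 0}`. -/
def gNonneg : Submodule ℂ K := g ⊓ Finsupp.supported ℂ ℂ {x | 0 ≤ deg x}

/-- `g_{> 0}`. -/
def gPos : Submodule ℂ K := g ⊓ Finsupp.supported ℂ ℂ {x | 0 < deg x}

theorem dt_mono_zero (I : Finset (Fin 6)) : dt (mono 0 I) = 0 := by
  simp [dt, mono]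

theorem mono_zero_mem (I : Finset (Fin 6)) (hI : I.card ≤ 2) : mono 0 I ∈ g := by
  refine ⟨mono 0 I, ?_⟩
  have h : opA (mono 0 I) = 0 := by
    have e : dtPow I.card (star (mono 0 I)) = 0 := by
      have e1 : star (mono 0 I) = (sgn I Iᶜ : ℂ) • mono 0 Iᶜ := by
        simp [star, mono]
      obtain ⟨n, hn⟩ : ∃ n, 3 - I.card = n + 1 := ⟨2 - I.card, by omega⟩
      rw [e1, dtPow, if_pos (by omega), hn, pow_succ, Module.End.mul_apply, map_smul,
        dt_mono_zero, smul_zero, map_zero]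
    have : opA (mono 0 I) =
        ((-1 : ℂ) ^ (I.card * (I.card + 1) / 2)) • dtPow I.card (star (mono 0 I)) := by
      simp [opA, mono]
    rw [this, e, smul_zero]
  simp [h]

/-! ### The universal enveloping superalgebra -/

/-- The defining relations `x y - (-1)^{p(x)p(y)} y x = [x, y]`, for homogeneous `x, y ∈ g`. -/
inductive URel : TensorAlgebra ℂ g → TensorAlgebra ℂ g → Prop
  | rel (p q : ℕ) (x y z : g) (hx : (x : K) ∈ ofParity p) (hy : (y : K) ∈ ofParity q)
      (hz : (z : K) = bracket x y) :
      URel (TensorAlgebra.ι ℂ x * TensorAlgebra.ι ℂ y)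
        (((-1 : ℂ) ^ (p * q)) • (TensorAlgebra.ι ℂ y * TensorAlgebra.ι ℂ x) + TensorAlgebra.ι ℂ z)

/-- The universal enveloping algebra `U(g)`. -/
def U : Type := (ringConGen URel).Quotient

instance instRingU : Ring U := inferInstanceAs (Ring (ringConGen URel).Quotient)

instance instAlgebraU : Algebra ℂ U := inferInstanceAs (Algebra ℂ (ringConGen URel).Quotient)

/-- The quotient map from the tensor algebra of `g`. -/
def mkU : TensorAlgebra ℂ g →ₐ[ℂ] U := RingCon.mkₐ ℂ (ringConGen URel)

/-- The canonical map `g → U(g)`. -/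
def ι : g →ₗ[ℂ] U := mkU.toLinearMap ∘ₗ TensorAlgebra.ι ℂ

/-- `Θ = -1/2 ∈ g_{-2}`, in `U(g)`. -/
def Θ : U := (-1 / 2 : ℂ) • ι ⟨mono 0 ∅, mono_zero_mem _ (by simp)⟩

/-- `η_i`, the image of `ξ_i` in `U(g)`. -/
def η (i : Fin 6) : U := ι ⟨mono 0 {i}, mono_zero_mem _ (by simp)⟩

/-- `η_I = η_{i_1} ⋯ η_{i_k}` for `I = {i_1 < ⋯ < i_k}`. -/
def ηs (I : Finset (Fin 6)) : U := ((I.sort (· ≤ ·)).map η).prod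

/-! ### Finite Verma modules -/

section Verma

variable {F : Type*} [AddCommGroup F] [Module ℂ F]

/-- `ρ` is a representation of the Lie superalgebra `g_{≥ 0}` on `F`. -/
def IsRep (ρ : gNonneg →ₗ[ℂ] Module.End ℂ F) : Prop :=
  ∀ (p q : ℕ) (x y z : gNonneg), (x : K) ∈ ofParity p → (y : K) ∈ ofParity q →
    (z : K) = bracket x y → ρ z = ρ x * ρ y - ((-1 : ℂ) ^ (p * q)) • (ρ y * ρ x)

/-- `F` is nonzero and has no invariant subspaces besides `0` and `F`. -/
def IsIrred (ρ : gNonneg →ₗ[ℂ] Module.End ℂ F) : Prop :=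
  Nontrivial F ∧ ∀ W : Submodule ℂ F, (∀ x, ∀ v ∈ W, ρ x v ∈ W) → W = ⊥ ∨ W = ⊤

/-- The `U(g)`-submodule of `U(g) ⊗_ℂ F` generated by the `x ⊗ v - 1 ⊗ x.v`, `x ∈ g_{≥ 0}`. As
`g_{≥ 0}` generates `U(g_{≥ 0})`, it is the span of all `u x ⊗ v - u ⊗ x.v`, `x ∈ U(g_{≥ 0})`. -/
def indRel (ρ : gNonneg →ₗ[ℂ] Module.End ℂ F) : Submodule U (U ⊗[ℂ] F) :=
  Submodule.span U
    {m | ∃ (x : gNonneg) (v : F), m = ι ⟨x, x.2.1⟩ ⊗ₜ[ℂ] v - (1 : U) ⊗ₜ[ℂ] (ρ x v)}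

/-- `Ind(F) = U(g) ⊗_{U(g_{≥ 0})} F`. -/
abbrev Ind (ρ : gNonneg →ₗ[ℂ] Module.End ℂ F) := (U ⊗[ℂ] F) ⧸ indRel ρ

/-- `m` is a singular vector: `g_{> 0}.m = 0`. -/
def IsSingular (ρ : gNonneg →ₗ[ℂ] Module.End ℂ F) (m : Ind ρ) : Prop :=
  ∀ x : gPos, ι ⟨x, x.2.1⟩ • m = 0

/-- `ℂ[Θ] ⊗ Λ(6) ⊗ F`: the family `w` stands for `∑ k, ∑ I, Θ^k η_I ⊗ w (k, I)`. -/
abbrev Coord (F : Type*) [AddCommGroup F] := (ℕ × Finset (Fin 6)) →₀ F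

/-- The identification `ℂ[Θ] ⊗ Λ(6) ⊗ F → Ind(F)`,
`w ↦ ∑ k, ∑ I, Θ^k η_I ⊗ w (k, I)`. -/
def pbw (ρ : gNonneg →ₗ[ℂ] Module.End ℂ F) : Coord F →ₗ[ℂ] Ind ρ :=
  Finsupp.lsum ℂ fun x =>
    ((indRel ρ).mkQ.restrictScalars ℂ) ∘ₗ (TensorProduct.mk ℂ U F (Θ ^ x.1 * ηs x.2))

/-- The Hodge dual `T (Θ^k η_I ⊗ v) = Θ^k η̄_I ⊗ v`, where `η̄_I` is the monomial
`± η_{Iᶜ}` with `η̄_I η_I = η_1 η_2 η_3 η_4 η_5 η_6`. -/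
def T : Coord F →ₗ[ℂ] Coord F :=
  Finsupp.lsum ℂ fun x =>
    (sgn x.2ᶜ x.2 : ℂ) • (Finsupp.lsingle (x.1, x.2ᶜ) : F →ₗ[ℂ] Coord F)

end Verma

end CK6

end

/-! The action of `g` on Ind(F) is written out by explicit operators, and the singular vector
equations are then read off coefficient by coefficient.

In degree zero `g` agrees with K(1,6)₊, and positive degrees act by zero on a finite-dimensional
irreducible F. So F is also a module over the nonnegative part of K(1,6)₊, and the module it induces
is a tensor module on ℂ[Θ] ⊗ Λ(6) ⊗ F. There f acts by a first order operator with symbol f, built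
from `m f`, ∂_t and the covariant derivatives D_i, plus terms in which t and ξ_i ξ_j act on F
(`act`, `indAct`). The bracket relations hold for ξ_i with no condition on F. By the Jacobi identity
they propagate from the vacuum to the whole module (`indAct_bracket`). The resulting action of U(g)
gives a left inverse of `pbw`. Surjectivity holds because `pbw` is U(g)-equivariant and its image
contains 1 ⊗ F.

For the bound, `act (t^k f)` is quadratic in the number of factors t. For a self-dual three-form f
in `g`, all of f, tf, t²f lie in `g`, so the quadratic coefficient f · ∑ ξ_r ξ_s R_rs kills a
singular w. The equations of the tξ_i evaluate the double sum on w as −tE, where E = ∑ ξ_i b_i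
counts missing indices. Hence f · tE w = 0, which kills the coefficients of Θ^k η_J with k ≥ 1 and
|J| = 4, 5 (`coeff_eq_zero_of_card_four_five`). The equations of tξ_i carry this down to smaller J,
one Θ against two η's (`coeff_eq_zero_of_card_le_three`), and the equation of f itself removes J =
{1,…,6} (`coeff_univ_eq_zero`). Together no Θ^k η_I with 2k + |I| ≥ 6 survives. After the Hodge dual
this says |I| ≥ 2k + 1, which is the claim. -/

noncomputable section

namespace CK6

/-! ### Signs -/

/-- The sign of `ξ_i ξ_j` relative to the increasing order. -/
def sg (i j : Fin 6) : ℤ := if i = j then 0 else if j < i then -1 else 1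

theorem sg_self (i : Fin 6) : sg i i = 0 := by simp [sg]

theorem sg_swap (i j : Fin 6) : sg i j = -sg j i := by
  unfold sg
  rcases lt_trichotomy i j with h | h | h
  · simp [h, h.ne, h.ne', h.not_gt]
  · simp [h]
  · simp [h, h.ne, h.ne', h.not_gt]

theorem sg_of_lt {i j : Fin 6} (h : i < j) : sg i j = 1 := by
  simp [sg, h.ne, h.not_gt]

theorem sg_mul_self {i j : Fin 6} (h : i ≠ j) : sg i j * sg i j = 1 := by
  unfold sg
  rw [if_neg h]
  split_ifs <;> norm_num

/-- As `sg i i = 0`, the product also vanishes when the sets meet. One formula thus covers both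
branches of `sgn` and makes it multiplicative in each argument. -/
theorem sgn_eq_prod (I J : Finset (Fin 6)) : sgn I J = ∏ i ∈ I, ∏ j ∈ J, sg i j := by
  rw [← Finset.prod_product', sgn]
  split_ifs with h
  · rw [← Finset.prod_const, Finset.prod_filter]
    refine Finset.prod_congr rfl fun x hx => ?_
    rw [Finset.mem_product] at hx
    have : x.1 ≠ x.2 := fun e => Finset.disjoint_left.mp h hx.1 (e ▸ hx.2)
    simp [sg, this]
  · rw [Finset.not_disjoint_iff] at h
    obtain ⟨a, ha, hb⟩ := h
    exact (Finset.prod_eq_zero (i := (a, a)) (by simp [ha, hb]) (sg_self a)).symm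

theorem sgn_union_right (I : Finset (Fin 6)) {J J' : Finset (Fin 6)} (h : Disjoint J J') :
    sgn I (J ∪ J') = sgn I J * sgn I J' := by
  simp only [sgn_eq_prod, Finset.prod_union h, Finset.prod_mul_distrib]

theorem sgn_insert_left {i : Fin 6} {I : Finset (Fin 6)} (h : i ∉ I) (J : Finset (Fin 6)) :
    sgn (insert i I) J = sgn {i} J * sgn I J := by
  simp only [sgn_eq_prod, Finset.prod_insert h, Finset.prod_singleton]

theorem sgn_insert_right (I : Finset (Fin 6)) {j : Fin 6} {J : Finset (Fin 6)} (h : j ∉ J) :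
    sgn I (insert j J) = sgn I {j} * sgn I J := by
  simp only [sgn_eq_prod, Finset.prod_insert h, Finset.prod_singleton, Finset.prod_mul_distrib]

@[simp] theorem sgn_singleton (i j : Fin 6) : sgn {i} {j} = sg i j := by
  simp [sgn_eq_prod]

@[simp] theorem sgn_empty_left (J : Finset (Fin 6)) : sgn ∅ J = 1 := by simp [sgn_eq_prod]

@[simp] theorem sgn_empty_right (I : Finset (Fin 6)) : sgn I ∅ = 1 := by simp [sgn_eq_prod]

theorem sgn_comm (I J : Finset (Fin 6)) : sgn J I = (-1) ^ (I.card * J.card) * sgn I J := by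
  simp only [sgn_eq_prod]
  rw [Finset.prod_comm]
  have h : ∀ i ∈ I, ∏ j ∈ J, sg j i = (-1) ^ J.card * ∏ j ∈ J, sg i j := fun i _ => by
    rw [← Finset.prod_const, ← Finset.prod_mul_distrib]
    exact Finset.prod_congr rfl fun j _ => by rw [sg_swap]; ring
  rw [Finset.prod_congr rfl h, Finset.prod_mul_distrib, Finset.prod_const, ← pow_mul,
    mul_comm J.card]

theorem sgn_comm_singleton (i : Fin 6) (I : Finset (Fin 6)) :
    sgn I {i} = (-1) ^ I.card * sgn {i} I := by
  rw [sgn_comm {i} I, Finset.card_singleton, one_mul]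

theorem sgn_of_not_disjoint {I J : Finset (Fin 6)} (h : ¬Disjoint I J) : sgn I J = 0 := by
  simp [sgn, h]

theorem sgn_of_mem {i : Fin 6} {I : Finset (Fin 6)} (h : i ∈ I) : sgn {i} I = 0 :=
  sgn_of_not_disjoint (by simpa using h)

theorem sgn_mul_self {I J : Finset (Fin 6)} (h : Disjoint I J) : sgn I J * sgn I J = 1 := by
  rw [sgn, if_pos h, ← mul_pow]; simp

theorem sgn_ne_zero {I J : Finset (Fin 6)} (h : Disjoint I J) : (sgn I J : ℂ) ≠ 0 := by
  rw [sgn, if_pos h]; simp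

theorem sgn_of_lt {a : Fin 6} {I : Finset (Fin 6)} (h : ∀ b ∈ I, a < b) : sgn {a} I = 1 := by
  rw [sgn_eq_prod, Finset.prod_singleton]
  exact Finset.prod_eq_one fun b hb => sg_of_lt (h b hb)

theorem sgn_singleton_sq {i : Fin 6} {I : Finset (Fin 6)} (h : i ∉ I) :
    (sgn {i} I : ℂ) * sgn {i} I = 1 := by
  exact_mod_cast sgn_mul_self (I := {i}) (J := I) (by simpa using h)

/-! ### Creation and annihilation operators on `ℂ[t] ⊗ Λ(6) ⊗ F` -/

section Operators

variable (F : Type*) [AddCommGroup F] [Module ℂ F]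

/-- Left multiplication by `ξ_i`. -/
def wedge (i : Fin 6) : Module.End ℂ (Coord F) :=
  Finsupp.lsum ℂ fun x =>
    (sgn {i} x.2 : ℂ) • (Finsupp.lsingle (x.1, insert i x.2) : F →ₗ[ℂ] Coord F)

/-- The left derivative with respect to `ξ_i`. -/
def contr (i : Fin 6) : Module.End ℂ (Coord F) :=
  Finsupp.lsum ℂ fun x =>
    if i ∈ x.2 then
      (sgn {i} (x.2.erase i) : ℂ) • (Finsupp.lsingle (x.1, x.2.erase i) : F →ₗ[ℂ] Coord F)
    else 0

/-- Multiplication by the even variable. -/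
def up : Module.End ℂ (Coord F) :=
  Finsupp.lsum ℂ fun x => (Finsupp.lsingle (x.1 + 1, x.2) : F →ₗ[ℂ] Coord F)

/-- The derivative with respect to the even variable. -/
def down : Module.End ℂ (Coord F) :=
  Finsupp.lsum ℂ fun x => (x.1 : ℂ) • (Finsupp.lsingle (x.1 - 1, x.2) : F →ₗ[ℂ] Coord F)

variable {F}

/-- `Θ^k η_I ⊗ v`. -/
abbrev sing (k : ℕ) (I : Finset (Fin 6)) (v : F) : Coord F := Finsupp.single (k, I) v

theorem wedge_sing (i : Fin 6) (k : ℕ) (I : Finset (Fin 6)) (v : F) :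
    wedge F i (sing k I v) = (sgn {i} I : ℂ) • sing k (insert i I) v := by
  simp [wedge]

theorem wedge_sing_of_mem {i : Fin 6} {I : Finset (Fin 6)} (h : i ∈ I) (k : ℕ) (v : F) :
    wedge F i (sing k I v) = 0 := by
  simp [wedge_sing, sgn_of_mem h]

theorem contr_sing_of_notMem {i : Fin 6} {I : Finset (Fin 6)} (h : i ∉ I) (k : ℕ) (v : F) :
    contr F i (sing k I v) = 0 := by
  simp [contr, h]

theorem contr_sing_insert {i : Fin 6} {I : Finset (Fin 6)} (h : i ∉ I) (k : ℕ) (v : F) :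
    contr F i (sing k (insert i I) v) = (sgn {i} I : ℂ) • sing k I v := by
  simp [contr, h]

theorem up_sing (k : ℕ) (I : Finset (Fin 6)) (v : F) : up F (sing k I v) = sing (k + 1) I v := by
  simp [up]

theorem down_sing (k : ℕ) (I : Finset (Fin 6)) (v : F) :
    down F (sing k I v) = (k : ℂ) • sing (k - 1) I v := by
  simp [down]

theorem coord_ext {N : Type*} [AddCommGroup N] [Module ℂ N] {f g : Coord F →ₗ[ℂ] N}
    (h : ∀ k I v, f (sing k I v) = g (sing k I v)) : f = g := by
  refine Finsupp.lhom_ext' fun x => LinearMap.ext fun v => ?_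
  exact h x.1 x.2 v

theorem wedge_apply (i : Fin 6) (w : Coord F) (k : ℕ) (I : Finset (Fin 6)) :
    wedge F i w (k, I) = if i ∈ I then (sgn {i} (I.erase i) : ℂ) • w (k, I.erase i) else 0 := by
  induction w using Finsupp.induction_linear with
  | zero => simp
  | add f g hf hg => rw [map_add, Finsupp.add_apply, hf, hg]; split_ifs <;> simp
  | single x v =>
    obtain ⟨l, J⟩ := x
    by_cases hJ : i ∈ J
    · rw [wedge_sing_of_mem hJ]
      have : J ≠ I.erase i := fun e => by simp [e] at hJ
      simp [this]
    · rw [wedge_sing]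
      by_cases hI : i ∈ I
      · have : (insert i J = I) ↔ J = I.erase i := by
          constructor
          · rintro rfl; simp [hJ]
          · rintro rfl; simp [hI]
        by_cases e : J = I.erase i
        · have e' := this.mpr e
          subst e'
          simp [Finsupp.single_apply, hJ]
        · simp [this, e]
      · have : insert i J ≠ I := fun e => hI (by simp [← e])
        simp [this, hI]

theorem contr_apply (i : Fin 6) (w : Coord F) (k : ℕ) (I : Finset (Fin 6)) :
    contr F i w (k, I) = if i ∈ I then 0 else (sgn {i} I : ℂ) • w (k, insert i I) := by
  induction w using Finsupp.induction_linear with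
  | zero => simp
  | add f g hf hg => rw [map_add, Finsupp.add_apply, hf, hg]; split_ifs <;> simp
  | single x v =>
    obtain ⟨l, J⟩ := x
    by_cases hJ : i ∈ J
    · obtain ⟨J, hi, rfl⟩ : ∃ J', i ∉ J' ∧ J = insert i J' :=
        ⟨J.erase i, by simp, by simp [hJ]⟩
      rw [contr_sing_insert hi]
      by_cases hI : i ∈ I
      · have : J ≠ I := fun e => hi (e ▸ hI)
        simp [this, hI]
      · have : insert i J = insert i I ↔ J = I := by
          constructor
          · intro e
            rw [← Finset.erase_insert hi, e, Finset.erase_insert hI]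
          · rintro rfl; rfl
        by_cases e : J = I
        · subst e; simp [Finsupp.single_apply, hI]
        · simp [this, hI, e]
    · rw [contr_sing_of_notMem hJ]
      have : J ≠ insert i I := fun e => hJ (by simp [e])
      simp [this]

theorem up_apply_succ (w : Coord F) (k : ℕ) (I : Finset (Fin 6)) :
    up F w (k + 1, I) = w (k, I) := by
  induction w using Finsupp.induction_linear with
  | zero => simp
  | add f g hf hg => rw [map_add, Finsupp.add_apply, hf, hg]; simp
  | single x v => obtain ⟨l, J⟩ := x; simp [up_sing, Finsupp.single_apply]

theorem up_apply_zero (w : Coord F) (I : Finset (Fin 6)) : up F w (0, I) = 0 := by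
  induction w using Finsupp.induction_linear with
  | zero => simp
  | add f g hf hg => rw [map_add, Finsupp.add_apply, hf, hg]; simp
  | single x v => obtain ⟨l, J⟩ := x; simp [up_sing]

theorem down_apply (w : Coord F) (k : ℕ) (I : Finset (Fin 6)) :
    down F w (k, I) = ((k : ℂ) + 1) • w (k + 1, I) := by
  induction w using Finsupp.induction_linear with
  | zero => simp
  | add f g hf hg => rw [map_add, Finsupp.add_apply, hf, hg]; simp
  | single x v =>
    obtain ⟨l, J⟩ := x
    rw [down_sing]
    rcases l with _ | l
    · simp
    · by_cases h : l = k <;> simp [Finsupp.single_apply, h]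

theorem wedge_wedge (i j : Fin 6) : wedge F i * wedge F j = -(wedge F j * wedge F i) := by
  refine coord_ext fun k I v => ?_
  simp only [Module.End.mul_apply, LinearMap.neg_apply, wedge_sing, map_smul, smul_smul]
  rw [Finset.insert_comm, ← neg_smul]
  congr 1
  by_cases hi : i ∈ I
  · simp [sgn_of_mem hi, sgn_of_mem (Finset.mem_insert_of_mem hi : i ∈ insert j I)]
  by_cases hj : j ∈ I
  · simp [sgn_of_mem hj, sgn_of_mem (Finset.mem_insert_of_mem hj : j ∈ insert i I)]
  rw [sgn_insert_right _ hi, sgn_insert_right _ hj, sgn_singleton, sgn_singleton, sg_swap i j]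
  push_cast; ring

theorem contr_contr (i j : Fin 6) : contr F i * contr F j = -(contr F j * contr F i) := by
  refine LinearMap.ext fun w => Finsupp.ext fun ⟨k, I⟩ => ?_
  simp only [Module.End.mul_apply, LinearMap.neg_apply, Finsupp.neg_apply, contr_apply]
  by_cases hi : i ∈ I
  · simp [hi]
  by_cases hj : j ∈ I
  · simp [hj]
  by_cases e : i = j
  · subst e; simp
  have e' : j ≠ i := fun h => e h.symm
  simp only [hi, hj, if_false, Finset.mem_insert, e, e', or_self, smul_smul]
  rw [Finset.insert_comm, ← neg_smul]
  congr 1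
  rw [sgn_insert_right _ hi, sgn_insert_right _ hj, sgn_singleton, sgn_singleton, sg_swap i j]
  push_cast; ring

theorem contr_wedge (i j : Fin 6) :
    contr F i * wedge F j = (if i = j then 1 else 0) - wedge F j * contr F i := by
  refine coord_ext fun k I v => ?_
  by_cases e : i = j
  · subst e
    simp only [if_true, Module.End.mul_apply, LinearMap.sub_apply, Module.End.one_apply]
    by_cases hi : i ∈ I
    · obtain ⟨I, h, rfl⟩ : ∃ J', i ∉ J' ∧ I = insert i J' := ⟨I.erase i, by simp, by simp [hi]⟩
      rw [wedge_sing_of_mem hi, contr_sing_insert h, map_smul, wedge_sing, smul_smul,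
        sgn_singleton_sq h]
      simp
    · rw [wedge_sing, map_smul, contr_sing_insert hi, contr_sing_of_notMem hi, smul_smul,
        sgn_singleton_sq hi]
      simp
  · simp only [e, if_false, Module.End.mul_apply, zero_sub, LinearMap.neg_apply]
    by_cases hi : i ∈ I
    · obtain ⟨I, h, rfl⟩ : ∃ J', i ∉ J' ∧ I = insert i J' := ⟨I.erase i, by simp, by simp [hi]⟩
      by_cases hj : j ∈ I
      · rw [wedge_sing_of_mem (Finset.mem_insert_of_mem hj), contr_sing_insert h, map_smul,
          wedge_sing_of_mem hj]
        simp
      · have hij : i ∉ insert j I := by simp [e, h]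
        rw [wedge_sing, Finset.insert_comm, map_smul, contr_sing_insert hij, contr_sing_insert h,
          map_smul, wedge_sing, smul_smul, smul_smul, ← neg_smul, sgn_insert_right _ h,
          sgn_insert_right _ hj, sgn_singleton, sgn_singleton]
        congr 1
        have h1 : (sg j i : ℂ) = - sg i j := by rw [sg_swap]; push_cast; rfl
        have h2 : (sg i j : ℂ) * sg i j = 1 := by exact_mod_cast sg_mul_self e
        push_cast
        rw [h1]
        linear_combination (-(sgn {j} I : ℂ) * sgn {i} I) * h2
    · rw [wedge_sing, map_smul, contr_sing_of_notMem hi, contr_sing_of_notMem (by simp [e, hi])]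
      simp

theorem down_up : down F * up F = up F * down F + 1 := by
  refine coord_ext fun k I v => ?_
  simp only [Module.End.mul_apply, LinearMap.add_apply, Module.End.one_apply, up_sing, down_sing,
    map_smul]
  rcases k with _ | k
  · simp
  · simp only [Nat.add_sub_cancel, Nat.cast_add, Nat.cast_one]
    rw [add_smul (_ : ℂ) 1, one_smul]

theorem wedge_up (i : Fin 6) : wedge F i * up F = up F * wedge F i :=
  coord_ext fun k I v => by simp [wedge_sing, up_sing]

theorem wedge_down (i : Fin 6) : wedge F i * down F = down F * wedge F i :=
  coord_ext fun k I v => by 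
    simp only [Module.End.mul_apply, wedge_sing, down_sing, map_smul]
    rw [smul_comm]

theorem contr_up (i : Fin 6) : contr F i * up F = up F * contr F i := by
  refine LinearMap.ext fun w => Finsupp.ext fun ⟨k, I⟩ => ?_
  rcases k with _ | k <;> simp [contr_apply, up_apply_succ, up_apply_zero]

theorem contr_down (i : Fin 6) : contr F i * down F = down F * contr F i := by
  refine LinearMap.ext fun w => Finsupp.ext fun ⟨k, I⟩ => ?_
  simp only [Module.End.mul_apply, contr_apply, down_apply]
  split_ifs
  · simp
  · rw [smul_comm]

end Operators

/-! ### Representations of the Weyl–Clifford algebra -/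

/-- A representation of the Weyl–Clifford algebra with even generators `t`, `∂_t` and odd
generators `ξ_i`, `∂_i`. -/
structure WeylClifford (N : Type*) [AddCommGroup N] [Module ℂ N] where
  t : Module.End ℂ N
  P : Module.End ℂ N
  ξ : Fin 6 → Module.End ℂ N
  b : Fin 6 → Module.End ℂ N
  P_t : P * t = t * P + 1
  ξ_ξ : ∀ i j, ξ i * ξ j = -(ξ j * ξ i)
  b_b : ∀ i j, b i * b j = -(b j * b i)
  b_ξ : ∀ i j, b i * ξ j = (if i = j then 1 else 0) - ξ j * b i
  ξ_t : ∀ i, ξ i * t = t * ξ i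
  b_t : ∀ i, b i * t = t * b i
  ξ_P : ∀ i, ξ i * P = P * ξ i
  b_P : ∀ i, b i * P = P * b i

namespace WeylClifford

variable {N : Type*} [AddCommGroup N] [Module ℂ N] (W : WeylClifford N)

/-- The covariant derivative `∂_i + ξ_i ∂_t`. -/
def D (i : Fin 6) : Module.End ℂ N := W.b i + W.ξ i * W.P

/-- The operator `ξ_i ∂_t - ∂_i`, which anticommutes with the covariant derivatives. -/
def q (i : Fin 6) : Module.End ℂ N := W.ξ i * W.P - W.b i

theorem ξ_sq (i : Fin 6) : W.ξ i * W.ξ i = 0 := by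
  have := W.ξ_ξ i i
  rwa [eq_neg_iff_add_eq_zero, ← two_smul ℂ, smul_eq_zero, or_iff_right (by norm_num)] at this

theorem q_P (i : Fin 6) : W.q i * W.P = W.P * W.q i := by
  simp only [q, sub_mul, mul_sub, W.b_P, ← mul_assoc, ← W.ξ_P]

theorem D_P (i : Fin 6) : W.D i * W.P = W.P * W.D i := by
  simp only [D, add_mul, mul_add, W.b_P, ← mul_assoc, ← W.ξ_P]

/-- These are the left and right odd translations of superspace. Once P is moved to the right, the
two contributions δ_ij P from the Clifford relation cancel; in `q_q` they add up. -/
theorem q_D (i j : Fin 6) : W.q i * W.D j = -(W.D j * W.q i) := by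
  have h1 : W.ξ i * W.P * W.b j = W.ξ i * W.b j * W.P := by
    rw [mul_assoc, ← W.b_P, mul_assoc]
  have h2 : W.ξ i * W.P * W.ξ j = W.ξ i * W.ξ j * W.P := by
    rw [mul_assoc, ← W.ξ_P, mul_assoc]
  have h3 : W.ξ j * W.P * W.b i = W.ξ j * W.b i * W.P := by
    rw [mul_assoc, ← W.b_P, mul_assoc]
  have h4 : W.ξ j * W.P * W.ξ i = W.ξ j * W.ξ i * W.P := by
    rw [mul_assoc, ← W.ξ_P, mul_assoc]
  simp only [q, D, sub_mul, mul_add, add_mul, mul_sub, h1, h2, h3, h4, ← mul_assoc]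
  rw [W.b_ξ i j, W.b_ξ j i, W.b_b i j, W.ξ_ξ i j]
  simp only [eq_comm (a := j), sub_mul]
  noncomm_ring

theorem q_q (i j : Fin 6) : W.q i * W.q j = -(W.q j * W.q i) - (if i = j then 2 else 0) * W.P := by
  have h1 : ∀ i j, W.ξ i * W.P * W.b j = W.ξ i * W.b j * W.P := fun i j => by
    rw [mul_assoc, ← W.b_P, mul_assoc]
  have h2 : ∀ i j, W.ξ i * W.P * W.ξ j = W.ξ i * W.ξ j * W.P := fun i j => by
    rw [mul_assoc, ← W.ξ_P, mul_assoc]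
  simp only [q, sub_mul, mul_sub, h1, h2, ← mul_assoc]
  rw [W.b_ξ i j, W.b_ξ j i, W.b_b i j, W.ξ_ξ i j]
  simp only [eq_comm (a := j), sub_mul]
  split_ifs
  · noncomm_ring
  · noncomm_ring

/-- The product of the `ξ_i`, `i ∈ I`, in increasing order. -/
def ξs (I : Finset (Fin 6)) : Module.End ℂ N := ((I.sort (· ≤ ·)).map W.ξ).prod

/-- The action of `ℂ[t] ⊗ Λ(6)` by multiplication operators. -/
def m : K →ₗ[ℂ] Module.End ℂ N :=
  Finsupp.linearCombination ℂ fun x => W.t ^ x.1 * W.ξs x.2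

theorem m_mono (k : ℕ) (I : Finset (Fin 6)) : W.m (mono k I) = W.t ^ k * W.ξs I := by
  simp [m, mono]

theorem ξs_insert {a : Fin 6} {I : Finset (Fin 6)} (h : ∀ b ∈ I, a < b) :
    W.ξs (insert a I) = W.ξ a * W.ξs I := by
  have ha : a ∉ I := fun h' => lt_irrefl _ (h a h')
  rw [ξs, ξs, Finset.sort_insert (· ≤ ·) (fun b hb => (h b hb).le) ha, List.map_cons, List.prod_cons]

theorem ξ_t_pow (i : Fin 6) (k : ℕ) : W.ξ i * W.t ^ k = W.t ^ k * W.ξ i :=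
  ((show Commute (W.ξ i) W.t from W.ξ_t i).pow_right k).eq

theorem b_t_pow (i : Fin 6) (k : ℕ) : W.b i * W.t ^ k = W.t ^ k * W.b i :=
  ((show Commute (W.b i) W.t from W.b_t i).pow_right k).eq

end WeylClifford

/-! ### Functions in ℂ[t] ⊗ Λ(6) acting by multiplication operators -/

theorem wedge_mono_of_lt {a : Fin 6} {I : Finset (Fin 6)} (h : ∀ b ∈ I, a < b) (k : ℕ) :
    wedge ℂ a (mono k I) = mono k (insert a I) := by
  rw [mono, wedge_sing, sgn_of_lt h]; simp [mono]

theorem K_ext {N : Type*} [AddCommGroup N] [Module ℂ N] {f g : K →ₗ[ℂ] N}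
    (h : ∀ k I, f (mono k I) = g (mono k I)) : f = g := by
  refine Finsupp.lhom_ext' fun x => LinearMap.ext_ring ?_
  exact h x.1 x.2

theorem K_induction {p : K → Prop} (zero : p 0) (add : ∀ f g, p f → p g → p (f + g))
    (smul : ∀ (c : ℂ) f, p f → p (c • f)) (mono : ∀ k I, p (mono k I)) (f : K) : p f := by
  induction f using Finsupp.induction_linear with
  | zero => exact zero
  | add f g hf hg => exact add f g hf hg
  | single x c =>
    have := smul c _ (mono x.1 x.2)
    rwa [CK6.mono, Finsupp.smul_single, smul_eq_mul, mul_one] at this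

/-- `ℂ[t] ⊗ Λ(6)` is spanned by what is obtained from the `t^k` by multiplication by the `ξ_i`. -/
theorem K_ext_wedge {N : Type*} [AddCommGroup N] [Module ℂ N] {f g : K →ₗ[ℂ] N}
    (h0 : ∀ k, f (mono k ∅) = g (mono k ∅))
    (h : ∀ a x, f x = g x → f (wedge ℂ a x) = g (wedge ℂ a x)) : f = g := by
  refine K_ext fun k I => ?_
  induction I using Finset.induction_on_min with
  | empty => exact h0 k
  | insert a I ha ih => rw [← wedge_mono_of_lt ha]; exact h a _ ih

theorem down_mono (k : ℕ) (I : Finset (Fin 6)) : down ℂ (mono k I) = (k : ℂ) • mono (k - 1) I :=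
  down_sing _ _ _

theorem parityAut_mono (k : ℕ) (I : Finset (Fin 6)) :
    parityAut (mono k I) = (-1 : ℂ) ^ I.card • mono k I := by
  simp [parityAut, mono]

theorem parityAut_wedge (a : Fin 6) (f : K) :
    parityAut (wedge ℂ a f) = -wedge ℂ a (parityAut f) := by
  have : parityAut ∘ₗ wedge ℂ a = -(wedge ℂ a ∘ₗ parityAut) := K_ext fun k I => by
    by_cases h : a ∈ I
    · have : wedge ℂ a (mono k I) = 0 := wedge_sing_of_mem h _ _
      simp [parityAut_mono, this]
    · have := parityAut_mono k (insert a I)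
      rw [mono] at this
      simp only [LinearMap.comp_apply, LinearMap.neg_apply, parityAut_mono, map_smul]
      rw [mono, wedge_sing, map_smul, this, Finset.card_insert_of_notMem h, smul_comm, pow_succ,
        mul_neg_one, neg_smul]
  exact LinearMap.congr_fun this f

theorem parityAut_parityAut (f : K) : parityAut (parityAut f) = f := by
  have : parityAut ∘ₗ parityAut = LinearMap.id := K_ext fun k I => by
    simp [parityAut_mono, smul_smul, ← mul_pow]
  exact LinearMap.congr_fun this f

theorem parityAut_down (f : K) : parityAut (down ℂ f) = down ℂ (parityAut f) := by
  have : parityAut ∘ₗ down ℂ = down ℂ ∘ₗ parityAut := K_ext fun k I => by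
    simp only [LinearMap.comp_apply, parityAut_mono, down_mono, map_smul]
    rw [smul_comm]
  exact LinearMap.congr_fun this f

theorem contr_wedge_apply (i j : Fin 6) (f : K) :
    contr ℂ i (wedge ℂ j f) = (if i = j then f else 0) - wedge ℂ j (contr ℂ i f) := by
  have := LinearMap.congr_fun (contr_wedge (F := ℂ) i j) f
  rw [Module.End.mul_apply] at this
  rw [this]
  split_ifs <;> simp

theorem contr_mono_empty (i : Fin 6) (k : ℕ) : contr ℂ i (mono k ∅) = 0 :=
  contr_sing_of_notMem (by simp) _ _

theorem parityAut_contr (a : Fin 6) (f : K) :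
    parityAut (contr ℂ a f) = -contr ℂ a (parityAut f) := by
  have : parityAut ∘ₗ contr ℂ a = -(contr ℂ a ∘ₗ parityAut) := by
    refine K_ext_wedge (fun k => by simp [parityAut_mono, contr_mono_empty]) fun i x h => ?_
    simp only [LinearMap.comp_apply, LinearMap.neg_apply] at h ⊢
    rw [parityAut_wedge, contr_wedge_apply, map_neg, contr_wedge_apply, map_sub, parityAut_wedge,
      h, map_neg]
    split_ifs <;> simp
  exact LinearMap.congr_fun this f

namespace WeylClifford

variable {N : Type*} [AddCommGroup N] [Module ℂ N] (W : WeylClifford N)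

theorem m_mono_zero_empty : W.m (mono 0 ∅) = 1 := by simp [m_mono, ξs]

theorem m_mono_empty (k : ℕ) : W.m (mono k ∅) = W.t ^ k := by simp [m_mono, ξs]

/-- `m` is defined on ordered monomials, so a ξ_i that is not the smallest index has to be moved
past smaller ones by anticommutation. With `K_ext_wedge` this reduces every commutation rule for `m`
to powers of t and one ξ at a time. -/
theorem m_wedge (i : Fin 6) (f : K) : W.m (wedge ℂ i f) = W.ξ i * W.m f := by
  have : W.m ∘ₗ wedge ℂ i = (LinearMap.mulLeft ℂ (W.ξ i)) ∘ₗ W.m := by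
    refine K_ext fun k I => ?_
    simp only [LinearMap.comp_apply, LinearMap.mulLeft_apply]
    have key : ∀ {a : Fin 6} {I : Finset (Fin 6)} (_ : ∀ b ∈ I, a < b),
        W.m (mono k (insert a I)) = W.ξ a * W.m (mono k I) := fun h => by
      rw [m_mono, m_mono, W.ξs_insert h, ← mul_assoc, ← mul_assoc, ξ_t_pow]
    induction I using Finset.induction_on_min generalizing i with
    | empty => rw [← key (by simp), wedge_mono_of_lt (by simp)]
    | insert a I ha ih =>
      rcases lt_trichotomy i a with h | h | h
      · have : ∀ b ∈ insert a I, i < b := by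
          intro b hb
          rcases Finset.mem_insert.mp hb with rfl | hb
          exacts [h, h.trans (ha b hb)]
        rw [wedge_mono_of_lt this, key this]
      · subst h
        rw [key ha, mono, wedge_sing_of_mem (by simp), map_zero, ← mul_assoc, ξ_sq, zero_mul]
      · have : ∀ b ∈ insert i I, a < b := by
          intro b hb
          rcases Finset.mem_insert.mp hb with rfl | hb
          exacts [h, ha b hb]
        have e : W.m (wedge ℂ a (wedge ℂ i (mono k I))) = W.ξ a * W.m (wedge ℂ i (mono k I)) := by
          rw [mono, wedge_sing, map_smul, map_smul, map_smul, mul_smul_comm]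
          change _ • W.m (wedge ℂ a (mono k _)) = _ • (W.ξ a * W.m (mono k _))
          rw [wedge_mono_of_lt this, key this]
        have s : wedge ℂ i (wedge ℂ a (mono k I)) = -wedge ℂ a (wedge ℂ i (mono k I)) :=
          LinearMap.congr_fun (wedge_wedge i a) _
        rw [← wedge_mono_of_lt ha, s, map_neg, e, wedge_mono_of_lt ha, key ha, ih, ← mul_assoc,
          ← mul_assoc, W.ξ_ξ i a, neg_mul]
  exact LinearMap.congr_fun this f

theorem ξ_m (i : Fin 6) (f : K) : W.ξ i * W.m f = W.m (parityAut f) * W.ξ i := by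
  have : LinearMap.mulLeft ℂ (W.ξ i) ∘ₗ W.m = LinearMap.mulRight ℂ (W.ξ i) ∘ₗ W.m ∘ₗ parityAut := by
    refine K_ext_wedge (fun k => ?_) fun a x h => ?_
    · simp [parityAut_mono, m_mono_empty, ξ_t_pow]
    · simp only [LinearMap.comp_apply, LinearMap.mulLeft_apply, LinearMap.mulRight_apply] at h ⊢
      rw [parityAut_wedge, map_neg, m_wedge, m_wedge, ← mul_assoc, W.ξ_ξ, neg_mul, mul_assoc, h,
        neg_mul, mul_assoc]
  exact LinearMap.congr_fun this f

theorem b_m (i : Fin 6) (f : K) :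
    W.b i * W.m f = W.m (contr ℂ i f) + W.m (parityAut f) * W.b i := by
  have : LinearMap.mulLeft ℂ (W.b i) ∘ₗ W.m =
      W.m ∘ₗ contr ℂ i + LinearMap.mulRight ℂ (W.b i) ∘ₗ W.m ∘ₗ parityAut := by
    refine K_ext_wedge (fun k => ?_) fun a x h => ?_
    · simp [parityAut_mono, m_mono_empty, b_t_pow, contr_mono_empty]
    · simp only [LinearMap.comp_apply, LinearMap.mulLeft_apply, LinearMap.mulRight_apply,
        LinearMap.add_apply] at h ⊢
      rw [parityAut_wedge, contr_wedge_apply, map_neg, m_wedge, m_wedge, ← mul_assoc, W.b_ξ,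
        sub_mul, mul_assoc, h, map_sub, m_wedge, mul_add, neg_mul, mul_assoc]
      split_ifs
      · rw [one_mul]; abel
      · rw [zero_mul, map_zero]; abel
  exact LinearMap.congr_fun this f

theorem P_t_pow (k : ℕ) : W.P * W.t ^ k = (k : ℂ) • W.t ^ (k - 1) + W.t ^ k * W.P := by
  induction k with
  | zero => simp
  | succ k ih =>
    rw [pow_succ, ← mul_assoc, ih, add_mul, mul_assoc, W.P_t, smul_mul_assoc, mul_add, mul_one,
      Nat.add_sub_cancel, Nat.cast_succ, add_smul, one_smul, ← mul_assoc]
    rcases k with _ | k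
    · simp [add_comm]
    · rw [Nat.add_sub_cancel, pow_succ]; abel

theorem P_m (f : K) : W.P * W.m f = W.m (down ℂ f) + W.m f * W.P := by
  have : LinearMap.mulLeft ℂ W.P ∘ₗ W.m = W.m ∘ₗ down ℂ + LinearMap.mulRight ℂ W.P ∘ₗ W.m := by
    refine K_ext_wedge (fun k => ?_) fun a x h => ?_
    · simp [down_mono, m_mono_empty, P_t_pow]
    · simp only [LinearMap.comp_apply, LinearMap.mulLeft_apply, LinearMap.mulRight_apply,
        LinearMap.add_apply] at h ⊢
      have e : down ℂ (wedge ℂ a x) = wedge ℂ a (down ℂ x) :=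
        (LinearMap.congr_fun (wedge_down a) x).symm
      rw [e, m_wedge, m_wedge, ← mul_assoc, ← W.ξ_P, mul_assoc, h, mul_add, mul_assoc]
  exact LinearMap.congr_fun this f

theorem m_up (f : K) : W.m (up ℂ f) = W.t * W.m f := by
  have : W.m ∘ₗ up ℂ = LinearMap.mulLeft ℂ W.t ∘ₗ W.m := by
    refine K_ext fun k I => ?_
    simp only [LinearMap.comp_apply, LinearMap.mulLeft_apply]
    rw [mono, up_sing]
    change W.m (mono _ _) = W.t * W.m (mono _ _)
    rw [m_mono, m_mono, pow_succ', mul_assoc]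
  exact LinearMap.congr_fun this f

end WeylClifford

/-- The Weyl–Clifford algebra acting on `ℂ[t] ⊗ Λ(6) ⊗ F`. -/
def fockRep (F : Type*) [AddCommGroup F] [Module ℂ F] : WeylClifford (Coord F) where
  t := up F
  P := down F
  ξ := wedge F
  b := contr F
  P_t := down_up
  ξ_ξ := wedge_wedge
  b_b := contr_contr
  b_ξ := contr_wedge
  ξ_t := wedge_up
  b_t := contr_up
  ξ_P := wedge_down
  b_P := contr_down

/-- `ℂ[t] ⊗ Λ(6)` itself. -/
def funRep : WeylClifford K := fockRep ℂ

namespace WeylClifford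

variable {N : Type*} [AddCommGroup N] [Module ℂ N] (W : WeylClifford N)

theorem q_m (i : Fin 6) (f : K) :
    W.q i * W.m f = W.m (funRep.q i f) + W.m (parityAut f) * W.q i := by
  have e : funRep.q i f = wedge ℂ i (down ℂ f) - contr ℂ i f := rfl
  rw [e, q, sub_mul, mul_assoc, P_m, mul_add, map_sub, m_wedge, b_m, ← mul_assoc, ξ_m W i f,
    mul_sub, mul_assoc]
  abel

end WeylClifford

/-! ### The product and the bracket -/

theorem funRep_ξs_mono (I J : Finset (Fin 6)) (k : ℕ) :
    funRep.ξs I (mono k J) = (sgn I J : ℂ) • mono k (I ∪ J) := by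
  induction I using Finset.induction_on_min with
  | empty => simp [WeylClifford.ξs]
  | insert a I ha ih =>
    have hI : a ∉ I := fun h => lt_irrefl _ (ha a h)
    rw [funRep.ξs_insert ha, Module.End.mul_apply, ih, map_smul]
    change _ • wedge ℂ a _ = _
    rw [mono, wedge_sing, smul_smul, Finset.insert_union, mono, ← Int.cast_mul]
    congr 2
    rw [sgn_insert_left hI]
    by_cases h : Disjoint I J
    · rw [sgn_union_right _ h, sgn_of_lt ha, one_mul, mul_comm]
    · rw [sgn_of_not_disjoint h]; simp

theorem funRep_t_pow_mono (k l : ℕ) (J : Finset (Fin 6)) :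
    (funRep.t ^ k) (mono l J) = mono (k + l) J := by
  induction k with
  | zero => simp
  | succ k ih =>
    rw [pow_succ', Module.End.mul_apply, ih]
    change up ℂ _ = _
    rw [mono, up_sing, mono, add_right_comm]

theorem mul_mono (k l : ℕ) (I J : Finset (Fin 6)) :
    mul (mono k I) (mono l J) = (sgn I J : ℂ) • mono (k + l) (I ∪ J) := by
  simp [mul, mono]

/-- The product of ℂ[t] ⊗ Λ(6) is `m` in its representation on itself, so rules for the product
become instances of rules valid in every Weyl–Clifford module. -/
theorem mul_eq : mul = funRep.m := by
  refine K_ext fun k I => K_ext fun l J => ?_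
  rw [mul_mono, funRep.m_mono, Module.End.mul_apply, funRep_ξs_mono, map_smul, funRep_t_pow_mono]

theorem dxi_eq (i : Fin 6) : dxi i = contr ℂ i := by
  refine K_ext fun k I => ?_
  by_cases h : i ∈ I
  · obtain ⟨I, hi, rfl⟩ : ∃ J', i ∉ J' ∧ I = insert i J' := ⟨I.erase i, by simp, by simp [h]⟩
    have e1 : dxi i (mono k (insert i I)) =
        ((-1 : ℂ) ^ ((insert i I).filter fun j => j < i).card) • mono k I := by
      simp [dxi, mono, hi]
    rw [e1, mono, mono, contr_sing_insert hi, sgn, if_pos (by simpa using hi)]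
    push_cast
    congr 2
    rw [Finset.filter_insert, if_neg (lt_irrefl i)]
    refine (Finset.card_bij (fun x _ => (i, x)) ?_ ?_ ?_)
    · intro x hx; simpa using hx
    · intro x _ y _ h; simpa using h
    · rintro ⟨a, b⟩ h
      simp only [Finset.mem_filter, Finset.mem_product, Finset.mem_singleton] at h
      obtain ⟨⟨rfl, h1⟩, h2⟩ := h
      exact ⟨b, by simp [h1, h2], rfl⟩
  · rw [mono, contr_sing_of_notMem h]
    simp [dxi, h]

theorem dt_eq : dt = down ℂ := by
  refine K_ext fun k I => ?_
  rw [down_mono]; simp [dt, mono]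

theorem mul_xi (i : Fin 6) : mul (mono 0 {i}) = wedge ℂ i := by
  have : mono 0 {i} = wedge ℂ i (mono 0 ∅) := by rw [wedge_mono_of_lt (by simp)]; rfl
  rw [mul_eq, this, funRep.m_wedge, funRep.m_mono_zero_empty, mul_one]; rfl

theorem euler_eq : euler = ∑ i, wedge ℂ i * contr ℂ i := by
  simp only [euler, mul_xi, dxi_eq]; rfl

/-- The product with covariant derivatives in the contact bracket. -/
theorem bracket_eq (f g : K) : bracket f g =
    (2 : ℂ) • mul f (down ℂ g) - (2 : ℂ) • mul (down ℂ f) g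
      + ∑ i, mul (funRep.D i (parityAut f)) (funRep.D i g) := by
  have hm : ∀ i (h x : K), mul h (wedge ℂ i x) = mul (wedge ℂ i (parityAut h)) x := fun i h x => by
    have := LinearMap.congr_fun (funRep.ξ_m i (parityAut h)) x
    rw [parityAut_parityAut] at this
    rw [mul_eq, funRep.m_wedge]
    exact this.symm
  have hD : ∀ i x, funRep.D i x = contr ℂ i x + wedge ℂ i (down ℂ x) := fun _ _ => rfl
  -- Expanding both D_i, the mixed terms are the Euler corrections of the contact bracket, and the
  -- term with two factors ξ_i vanishes.
  have hs : ∀ i, mul (funRep.D i (parityAut f)) (funRep.D i g) =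
      mul (contr ℂ i (parityAut f)) (contr ℂ i g) - mul (wedge ℂ i (contr ℂ i f)) (down ℂ g)
        + mul (down ℂ f) (wedge ℂ i (contr ℂ i g)) := fun i => by
    have hw : wedge ℂ i (wedge ℂ i (down ℂ g)) = 0 :=
      LinearMap.congr_fun (funRep.ξ_sq i) _
    have h1 : mul (wedge ℂ i (down ℂ (parityAut f))) (wedge ℂ i (down ℂ g)) = 0 := by
      rw [← parityAut_down, ← hm, hw, map_zero]
    rw [hD, hD, map_add, map_add, LinearMap.add_apply, LinearMap.add_apply, h1, hm i (contr ℂ i _),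
      parityAut_contr, parityAut_parityAut, hm i (down ℂ f), parityAut_down]
    simp only [map_neg, LinearMap.neg_apply]
    abel
  simp only [hs, Finset.sum_add_distrib, Finset.sum_sub_distrib]
  rw [bracket, dt_eq, euler_eq]
  simp only [dxi_eq, map_sub, map_smul, LinearMap.sub_apply, LinearMap.smul_apply,
    LinearMap.sum_apply, Module.End.mul_apply, map_sum]
  abel

theorem parityAut_mul (f g : K) : parityAut (mul f g) = mul (parityAut f) (parityAut g) := by
  have : ∀ f, parityAut ∘ₗ mul f = mul (parityAut f) ∘ₗ parityAut := fun f => by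
    induction f using K_induction with
    | zero => simp
    | add f g hf hg => rw [map_add, LinearMap.comp_add, hf, hg, map_add, map_add]; rfl
    | smul c f hf => rw [map_smul, LinearMap.comp_smul, hf, map_smul, map_smul]; rfl
    | mono k I =>
      refine K_ext fun l J => ?_
      simp only [LinearMap.comp_apply, parityAut_mono, map_smul, mul_mono, LinearMap.smul_apply]
      by_cases h : Disjoint I J
      · rw [Finset.card_union_of_disjoint h, pow_add, smul_smul, smul_smul, smul_smul]
        congr 1; ring
      · simp [sgn_of_not_disjoint h]
  exact LinearMap.congr_fun (this f) g

theorem parityAut_D (i : Fin 6) (f : K) :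
    parityAut (funRep.D i f) = -funRep.D i (parityAut f) := by
  have hD : ∀ i x, funRep.D i x = contr ℂ i x + wedge ℂ i (down ℂ x) := fun _ _ => rfl
  rw [hD, hD, map_add, parityAut_contr, parityAut_wedge, parityAut_down]; abel

theorem parityAut_q (i : Fin 6) (f : K) :
    parityAut (funRep.q i f) = -funRep.q i (parityAut f) := by
  have hD : ∀ i x, funRep.q i x = wedge ℂ i (down ℂ x) - contr ℂ i x := fun _ _ => rfl
  rw [hD, hD, map_sub, parityAut_contr, parityAut_wedge, parityAut_down]; abel

theorem parityAut_bracket (f g : K) :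
    parityAut (bracket f g) = bracket (parityAut f) (parityAut g) := by
  simp only [bracket_eq, map_add, map_sub, map_smul, map_sum, parityAut_mul, parityAut_down,
    parityAut_D, map_neg, neg_neg, LinearMap.neg_apply]

theorem q_mul (i : Fin 6) (f g : K) :
    funRep.q i (mul f g) = mul (funRep.q i f) g + mul (parityAut f) (funRep.q i g) := by
  rw [mul_eq]
  exact LinearMap.congr_fun (funRep.q_m i f) g

theorem q_D_apply (i j : Fin 6) (f : K) :
    funRep.q i (funRep.D j f) = -funRep.D j (funRep.q i f) :=
  LinearMap.congr_fun (funRep.q_D i j) f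

theorem q_down_apply (i : Fin 6) (f : K) : funRep.q i (down ℂ f) = down ℂ (funRep.q i f) :=
  LinearMap.congr_fun (funRep.q_P i) f

/-- The adjoint action of `ξ_i` is an odd derivation of the contact bracket. -/
theorem q_bracket (i : Fin 6) (f g : K) :
    funRep.q i (bracket f g) =
      bracket (funRep.q i f) g + bracket (parityAut f) (funRep.q i g) := by
  -- `q i` is an odd derivation of the product, commutes with ∂_t and anticommutes with every D_j,
  -- and `bracket_eq` uses nothing else.
  simp only [bracket_eq, map_add, map_sub, map_smul, map_sum, q_mul, q_D_apply, q_down_apply,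
    parityAut_down, parityAut_q, parityAut_D, map_neg, LinearMap.neg_apply, parityAut_parityAut,
    Finset.sum_add_distrib, Finset.sum_neg_distrib, neg_neg, smul_add]
  abel

theorem bracket_add_left (f f' g : K) : bracket (f + f') g = bracket f g + bracket f' g := by
  simp only [bracket_eq, map_add, LinearMap.add_apply, smul_add, Finset.sum_add_distrib]; abel

theorem bracket_smul_left (c : ℂ) (f g : K) : bracket (c • f) g = c • bracket f g := by
  simp only [bracket_eq, map_smul, LinearMap.smul_apply, smul_add, smul_sub, Finset.smul_sum,
    smul_comm c (2 : ℂ)]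

theorem bracket_add_right (f g g' : K) : bracket f (g + g') = bracket f g + bracket f g' := by
  simp only [bracket_eq, map_add, smul_add, Finset.sum_add_distrib]; abel

theorem bracket_smul_right (c : ℂ) (f g : K) : bracket f (c • g) = c • bracket f g := by
  simp only [bracket_eq, map_smul, smul_add, smul_sub, Finset.smul_sum, smul_comm c (2 : ℂ)]

theorem funRep_D_mono_empty (i : Fin 6) : funRep.D i (mono 0 ∅) = 0 := by
  change contr ℂ i _ + wedge ℂ i (down ℂ _) = 0
  rw [contr_mono_empty, down_mono]; simp

theorem mono_singleton (i : Fin 6) : mono 0 {i} = wedge ℂ i (mono 0 ∅) := by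
  rw [wedge_mono_of_lt (by simp)]; rfl

theorem funRep_D_xi (i j : Fin 6) :
    funRep.D i (mono 0 {j}) = if i = j then mono 0 ∅ else 0 := by
  change contr ℂ i _ + wedge ℂ i (down ℂ _) = _
  rw [down_mono, mono_singleton, contr_wedge_apply, contr_mono_empty]; simp

theorem mul_one_left (g : K) : mul (mono 0 ∅) g = g := by
  rw [mul_eq, funRep.m_mono_zero_empty]; rfl

theorem bracket_one (g : K) : bracket (mono 0 ∅) g = (2 : ℂ) • down ℂ g := by
  rw [bracket_eq, parityAut_mono]
  simp [funRep_D_mono_empty, mul_one_left, down_mono]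

theorem bracket_xi (i : Fin 6) (g : K) : bracket (mono 0 {i}) g = funRep.q i g := by
  rw [bracket_eq, parityAut_mono]
  simp only [map_smul, funRep_D_xi, down_mono]
  simp only [Finset.card_singleton, pow_one, neg_smul, one_smul, LinearMap.smul_apply,
    Finset.sum_neg_distrib, mul_xi, Nat.cast_zero, zero_smul, LinearMap.zero_apply,
    smul_zero, sub_zero]
  have : ∀ j, mul (if j = i then mono 0 ∅ else 0) (funRep.D j g) =
      if j = i then funRep.D j g else 0 := fun j => by
    split_ifs
    · rw [mul_one_left]
    · simp
  simp only [this, Finset.sum_ite_eq', Finset.mem_univ, if_true]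
  change _ + -(contr ℂ i _ + wedge ℂ i (down ℂ _)) = wedge ℂ i (down ℂ _) - contr ℂ i _
  rw [two_smul]; abel

theorem mul_comm_of_mono (k l : ℕ) (I J : Finset (Fin 6)) :
    mul (mono k I) (mono l J) = (-1 : ℂ) ^ (I.card * J.card) • mul (mono l J) (mono k I) := by
  rw [mul_mono, mul_mono, sgn_comm J I, add_comm k, Finset.union_comm, smul_smul]
  push_cast
  rw [mul_comm J.card]

/-! ### Parity and degree -/

theorem supported_induction {s : Set (ℕ × Finset (Fin 6))} {p : K → Prop} (zero : p 0)
    (add : ∀ f g, p f → p g → p (f + g)) (smul : ∀ (c : ℂ) f, p f → p (c • f))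
    (mono : ∀ k I, (k, I) ∈ s → p (mono k I)) {f : K} (hf : f ∈ Finsupp.supported ℂ ℂ s) : p f := by
  rw [Finsupp.supported_eq_span_single] at hf
  induction hf using Submodule.span_induction with
  | zero => exact zero
  | add f g _ _ hf hg => exact add f g hf hg
  | smul c f _ hf => exact smul c f hf
  | mem f hf =>
    obtain ⟨⟨k, I⟩, h, rfl⟩ := hf
    exact mono k I h

theorem parityAut_apply (f : K) (x : ℕ × Finset (Fin 6)) :
    parityAut f x = (-1) ^ x.2.card * f x := by
  induction f using K_induction with
  | zero => simp
  | add f g hf hg => rw [map_add, Finsupp.add_apply, hf, hg, Finsupp.add_apply, mul_add]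
  | smul c f hf => rw [map_smul, Finsupp.smul_apply, hf, Finsupp.smul_apply, smul_eq_mul,
      smul_eq_mul]; ring
  | mono k I =>
    rw [parityAut_mono, Finsupp.smul_apply, mono, Finsupp.single_apply, smul_eq_mul]
    split_ifs with h
    · rw [← h]
    · simp

theorem neg_one_pow_eq_iff (a b : ℕ) : (-1 : ℂ) ^ a = (-1) ^ b ↔ a % 2 = b % 2 := by
  rw [neg_one_pow_eq_pow_mod_two a, neg_one_pow_eq_pow_mod_two b]
  rcases Nat.mod_two_eq_zero_or_one a with h | h <;>
    rcases Nat.mod_two_eq_zero_or_one b with h' | h' <;> simp [h, h']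
  · norm_num
  · norm_num

theorem mem_ofParity_iff {f : K} {p : ℕ} : f ∈ ofParity p ↔ parityAut f = (-1 : ℂ) ^ p • f := by
  constructor
  · intro hf
    refine supported_induction (p := fun f => parityAut f = (-1 : ℂ) ^ p • f) (by simp)
      (fun f g hf hg => by rw [map_add, hf, hg, smul_add])
      (fun c f hf => by rw [map_smul, hf, smul_comm]) (fun k I h => ?_) hf
    rw [parityAut_mono, (neg_one_pow_eq_iff _ _).mpr h]
  · intro h
    rw [ofParity, Finsupp.mem_supported]
    intro x hx
    have h1 := DFunLike.congr_fun h x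
    rw [parityAut_apply, Finsupp.smul_apply, smul_eq_mul] at h1
    exact (neg_one_pow_eq_iff _ _).mp (mul_right_cancel₀ (Finsupp.mem_support_iff.mp hx) h1)

theorem mono_mem_ofParity (k : ℕ) (I : Finset (Fin 6)) : mono k I ∈ ofParity I.card :=
  mem_ofParity_iff.mpr (parityAut_mono k I)

theorem q_mem_ofParity (i : Fin 6) {f : K} {p : ℕ} (hf : f ∈ ofParity p) :
    funRep.q i f ∈ ofParity (p + 1) := by
  rw [mem_ofParity_iff] at hf ⊢
  rw [parityAut_q, hf, map_smul, pow_succ, mul_neg_one, neg_smul]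

theorem bracket_mem_ofParity {f g : K} {p q : ℕ} (hf : f ∈ ofParity p) (hg : g ∈ ofParity q) :
    bracket f g ∈ ofParity (p + q) := by
  rw [mem_ofParity_iff] at *
  rw [parityAut_bracket, hf, hg, bracket_smul_left, bracket_smul_right, smul_smul, pow_add]

theorem mul_comm_of_parity {f g : K} {p q : ℕ} (hf : f ∈ ofParity p) (hg : g ∈ ofParity q) :
    mul f g = (-1 : ℂ) ^ (p * q) • mul g f := by
  refine supported_induction (p := fun f => mul f g = (-1 : ℂ) ^ (p * q) • mul g f) (by simp)
    (fun f f' h h' => ?_) (fun c f h => ?_) (fun k I hI => ?_) hf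
  · rw [map_add, LinearMap.add_apply, h, h', map_add, smul_add]
  · rw [map_smul, LinearMap.smul_apply, h, map_smul, smul_comm]
  · refine supported_induction (p := fun g => mul _ g = (-1 : ℂ) ^ (p * q) • mul g _) (by simp)
      (fun f f' h h' => ?_) (fun c f h => ?_) (fun l J hJ => ?_) hg
    · rw [map_add, h, h', map_add, LinearMap.add_apply, smul_add]
    · rw [map_smul, h, map_smul, LinearMap.smul_apply, smul_comm]
    · rw [mul_comm_of_mono]
      congr 1
      rw [neg_one_pow_eq_iff]
      exact Nat.ModEq.mul (show _ ≡ _ [MOD 2] from hI) (show _ ≡ _ [MOD 2] from hJ)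

theorem D_mem_ofParity (i : Fin 6) {f : K} {p : ℕ} (hf : f ∈ ofParity p) :
    funRep.D i f ∈ ofParity (p + 1) := by
  rw [mem_ofParity_iff] at hf ⊢
  rw [parityAut_D, hf, map_smul, pow_succ, mul_neg_one, neg_smul]

theorem down_mem_ofParity {f : K} {p : ℕ} (hf : f ∈ ofParity p) : down ℂ f ∈ ofParity p := by
  rw [mem_ofParity_iff] at hf ⊢
  rw [parityAut_down, hf, map_smul]

theorem bracket_comm {f g : K} {p q : ℕ} (hf : f ∈ ofParity p) (hg : g ∈ ofParity q) :
    bracket f g = -((-1 : ℂ) ^ (p * q) • bracket g f) := by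
  rw [bracket_eq, bracket_eq, mem_ofParity_iff.mp hf, mem_ofParity_iff.mp hg,
    mul_comm_of_parity hf (down_mem_ofParity hg), mul_comm_of_parity (down_mem_ofParity hf) hg]
  simp only [map_smul, LinearMap.smul_apply,
    mul_comm_of_parity (D_mem_ofParity _ hf) (D_mem_ofParity _ hg), smul_add, smul_sub,
    ← Finset.smul_sum, smul_smul]
  have : (-1 : ℂ) ^ p * (-1) ^ ((p + 1) * (q + 1)) = -((-1) ^ (p * q) * (-1) ^ q) := by
    rw [add_mul, mul_add, one_mul, mul_one, pow_add, pow_add, pow_succ]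
    have h : (-1 : ℂ) ^ p * (-1) ^ p = 1 := by rw [← mul_pow]; simp
    linear_combination (-(-1 : ℂ) ^ (p * q) * (-1) ^ q) * h
  rw [this, mul_comm _ (2 : ℂ), neg_smul]
  abel

/-- The homogeneous elements of degree `d`. -/
def homog (d : ℤ) : Submodule ℂ K := Finsupp.supported ℂ ℂ {x | deg x = d}

theorem mono_mem_homog {k : ℕ} {I : Finset (Fin 6)} {d : ℤ} (h : deg (k, I) = d) :
    mono k I ∈ homog d := Finsupp.single_mem_supported ℂ 1 h

theorem smul_mono_mem_homog {c : ℂ} {k : ℕ} {I : Finset (Fin 6)} {d : ℤ}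
    (h : c ≠ 0 → deg (k, I) = d) : c • mono k I ∈ homog d := by
  by_cases hc : c = 0
  · rw [hc, zero_smul]; exact zero_mem _
  · exact Submodule.smul_mem _ _ (mono_mem_homog (h hc))

theorem map_mem_homog {A : K →ₗ[ℂ] K} {c : ℤ}
    (h : ∀ k I, A (mono k I) ∈ homog (deg (k, I) + c)) {f : K} {d : ℤ} (hf : f ∈ homog d) :
    A f ∈ homog (d + c) := by
  refine supported_induction (p := fun f => A f ∈ homog (d + c)) (by simp) (fun f g hf hg => ?_)
    (fun c f hf => ?_) (fun k I hI => ?_) hf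
  · rw [map_add]; exact add_mem hf hg
  · rw [map_smul]; exact Submodule.smul_mem _ _ hf
  · have hI : deg (k, I) = d := hI
    rw [← hI]; exact h k I

theorem down_mem_homog {f : K} {d : ℤ} (hf : f ∈ homog d) : down ℂ f ∈ homog (d + (-2)) := by
  refine map_mem_homog (fun k I => ?_) hf
  rw [down_mono]
  refine smul_mono_mem_homog fun h => ?_
  have : k ≠ 0 := by rintro rfl; simp at h
  simp only [deg]; omega

theorem wedge_mem_homog (i : Fin 6) {f : K} {d : ℤ} (hf : f ∈ homog d) :
    wedge ℂ i f ∈ homog (d + 1) := by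
  refine map_mem_homog (fun k I => ?_) hf
  rw [mono, wedge_sing]
  refine smul_mono_mem_homog fun h => ?_
  have : i ∉ I := fun hi => by simp [sgn_of_mem hi] at h
  simp only [deg, Finset.card_insert_of_notMem this]; push_cast; ring

theorem contr_mem_homog (i : Fin 6) {f : K} {d : ℤ} (hf : f ∈ homog d) :
    contr ℂ i f ∈ homog (d + (-1)) := by
  refine map_mem_homog (fun k I => ?_) hf
  by_cases h : i ∈ I
  · obtain ⟨I, hi, rfl⟩ : ∃ J', i ∉ J' ∧ I = insert i J' := ⟨I.erase i, by simp, by simp [h]⟩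
    rw [mono, contr_sing_insert hi]
    refine smul_mono_mem_homog fun _ => ?_
    simp only [deg, Finset.card_insert_of_notMem hi]; push_cast; ring
  · rw [mono, contr_sing_of_notMem h]; exact zero_mem _

theorem D_mem_homog (i : Fin 6) {f : K} {d : ℤ} (hf : f ∈ homog d) :
    funRep.D i f ∈ homog (d + (-1)) := by
  have := wedge_mem_homog i (down_mem_homog hf)
  rw [show d + -2 + 1 = d + -1 by ring] at this
  exact add_mem (contr_mem_homog i hf) this

theorem mul_mem_homog {f g : K} {a b : ℤ} (hf : f ∈ homog a) (hg : g ∈ homog b) :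
    mul f g ∈ homog (a + b + 2) := by
  refine supported_induction (p := fun f => mul f g ∈ homog (a + b + 2)) (by simp)
    (fun f f' h h' => ?_) (fun c f h => ?_) (fun k I hI => ?_) hf
  · rw [map_add, LinearMap.add_apply]; exact add_mem h h'
  · rw [map_smul, LinearMap.smul_apply]; exact Submodule.smul_mem _ _ h
  · have e : a + b + 2 = b + (a + 2) := by ring
    have hI : deg (k, I) = a := hI
    rw [e, ← hI]
    refine map_mem_homog (fun l J => ?_) hg
    rw [mul_mono]
    refine smul_mono_mem_homog fun h => ?_
    have : Disjoint I J := by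
      by_contra hd; simp [sgn_of_not_disjoint hd] at h
    simp only [deg, Finset.card_union_of_disjoint this]; push_cast; ring

theorem parityAut_mem_homog {f : K} {d : ℤ} (hf : f ∈ homog d) : parityAut f ∈ homog d := by
  rw [← add_zero d]
  refine map_mem_homog (fun k I => ?_) hf
  rw [parityAut_mono]
  exact smul_mono_mem_homog fun _ => by simp

theorem bracket_mem_homog {f g : K} {a b : ℤ} (hf : f ∈ homog a) (hg : g ∈ homog b) :
    bracket f g ∈ homog (a + b) := by
  have h1 := mul_mem_homog hf (down_mem_homog hg)
  have h2 := mul_mem_homog (down_mem_homog hf) hg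
  rw [show a + (b + -2) + 2 = a + b by ring] at h1
  rw [show a + -2 + b + 2 = a + b by ring] at h2
  rw [bracket_eq]
  refine add_mem (sub_mem (Submodule.smul_mem _ _ h1) (Submodule.smul_mem _ _ h2))
    (Submodule.sum_mem _ fun i _ => ?_)
  have h3 := mul_mem_homog (D_mem_homog i (parityAut_mem_homog hf)) (D_mem_homog i hg)
  rwa [show a + -1 + (b + -1) + 2 = a + b by ring] at h3

/-! ### Tensor modules over `K(1,6)₊` -/

namespace WeylClifford

variable {N : Type*} [AddCommGroup N] [Module ℂ N] (W : WeylClifford N)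

/-- The representation with the roles of multiplications and derivatives exchanged. -/
def dual : WeylClifford N where
  t := W.P
  P := -W.t
  ξ i := -W.b i
  b i := -W.ξ i
  P_t := by rw [mul_neg, W.P_t, neg_mul]; abel
  ξ_ξ i j := by rw [neg_mul_neg, neg_mul_neg, W.b_b]
  b_b i j := by rw [neg_mul_neg, neg_mul_neg, W.ξ_ξ]
  b_ξ i j := by
    rw [neg_mul_neg, neg_mul_neg, W.b_ξ]
    simp [eq_comm (a := j)]
  ξ_t i := by rw [neg_mul, mul_neg, W.b_P]
  b_t i := by rw [neg_mul, mul_neg, W.ξ_P]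
  ξ_P i := by rw [neg_mul_neg, neg_mul_neg, W.b_t]
  b_P i := by rw [neg_mul_neg, neg_mul_neg, W.ξ_t]

/-- `X` commutes with the Weyl–Clifford algebra. -/
structure Central (X : Module.End ℂ N) : Prop where
  t : W.t * X = X * W.t
  P : W.P * X = X * W.P
  ξ : ∀ i, W.ξ i * X = X * W.ξ i
  b : ∀ i, W.b i * X = X * W.b i

variable {W}

theorem Central.dual {X : Module.End ℂ N} (h : W.Central X) : W.dual.Central X where
  t := h.P
  P := by change -W.t * X = X * -W.t; rw [neg_mul, h.t, mul_neg]
  ξ i := by change -W.b i * X = X * -W.b i; rw [neg_mul, h.b, mul_neg]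
  b i := by change -W.ξ i * X = X * -W.ξ i; rw [neg_mul, h.ξ, mul_neg]

theorem Central.q {X : Module.End ℂ N} (h : W.Central X) (i : Fin 6) :
    W.q i * X = X * W.q i := by
  rw [WeylClifford.q, sub_mul, mul_assoc, h.P, ← mul_assoc, h.ξ, h.b, mul_sub, mul_assoc]

variable (W)

/-- The action of `K(1,6)₊` on tensor fields: a contact vector field together with the terms
through which the degree zero part acts on the fibre, `t` by `C` and `ξ_i ξ_j` by `R j i`. -/
def act (C : Module.End ℂ N) (R : Fin 6 → Fin 6 → Module.End ℂ N) : K →ₗ[ℂ] Module.End ℂ N :=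
  (2 : ℂ) • LinearMap.mulRight ℂ W.P ∘ₗ W.m
    + ∑ i, LinearMap.mulRight ℂ (W.D i) ∘ₗ W.m ∘ₗ funRep.D i ∘ₗ parityAut
    + LinearMap.mulRight ℂ C ∘ₗ W.m ∘ₗ down ℂ
    + (1 / 2 : ℂ) • ∑ r, ∑ s, LinearMap.mulRight ℂ (R r s) ∘ₗ W.m ∘ₗ funRep.D r ∘ₗ funRep.D s

variable {C : Module.End ℂ N} {R : Fin 6 → Fin 6 → Module.End ℂ N}

theorem act_eq (f : K) : W.act C R f = (2 : ℂ) • (W.m f * W.P)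
    + ∑ i, W.m (funRep.D i (parityAut f)) * W.D i + W.m (down ℂ f) * C
    + (1 / 2 : ℂ) • ∑ r, ∑ s, W.m (funRep.D r (funRep.D s f)) * R r s := by
  simp [act, LinearMap.sum_apply]

/-- The operators to the right of the symbols in `act` commute or anticommute with `q i`, so `q i`
only differentiates the symbols. Centrality of C and R suffices: they need not represent anything.
-/
theorem q_act (hC : W.Central C) (hR : ∀ r s, W.Central (R r s)) (i : Fin 6) (f : K) :
    W.q i * W.act C R f =
      W.act C R (funRep.q i f) + W.act C R (parityAut f) * W.q i := by
  have h : ∀ g X, W.q i * X = X * W.q i →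
      W.q i * (W.m g * X) = W.m (funRep.q i g) * X
        + W.m (parityAut g) * X * W.q i := fun g X hX => by
    rw [← mul_assoc, q_m, add_mul, mul_assoc _ _ X, hX, mul_assoc]
  have hD : ∀ j, W.q i * (W.m (funRep.D j (parityAut f)) * W.D j) =
      W.m (funRep.D j (parityAut (funRep.q i f))) * W.D j
      + W.m (funRep.D j (parityAut (parityAut f))) * W.D j * W.q i :=
    fun j => by
      rw [← mul_assoc, q_m, add_mul, mul_assoc _ _ (W.D j),
        q_D, q_D_apply, parityAut_D, parityAut_q, map_neg, map_neg, map_neg,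
        neg_mul_neg, ← mul_assoc, map_neg]
  simp only [act_eq, mul_add, add_mul, mul_smul_comm, smul_mul_assoc, Finset.mul_sum,
    Finset.sum_mul, h _ _ (W.q_P i), h _ _ (hC.q i), h _ _ ((hR _ _).q i), hD, smul_add,
    Finset.sum_add_distrib, q_down_apply, q_D_apply, parityAut_down, parityAut_D, map_neg, neg_neg]
  abel

theorem P_act (hC : W.Central C) (hR : ∀ r s, W.Central (R r s)) (f : K) :
    W.P * W.act C R f = W.act C R (down ℂ f) + W.act C R f * W.P := by
  have h : ∀ g X, W.P * X = X * W.P →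
      W.P * (W.m g * X) = W.m (down ℂ g) * X + W.m g * X * W.P := fun g X hX => by
    rw [← mul_assoc, P_m, add_mul, mul_assoc _ _ X, hX, mul_assoc]
  have hD : ∀ i g, down ℂ (funRep.D i g) = funRep.D i (down ℂ g) := fun i g =>
    (LinearMap.congr_fun (funRep.D_P i) g).symm
  simp only [act_eq, mul_add, add_mul, mul_smul_comm, smul_mul_assoc, Finset.mul_sum,
    Finset.sum_mul, h _ _ rfl, h _ _ hC.P, h _ _ (hR _ _).P, h _ _ (W.D_P _).symm, smul_add,
    Finset.sum_add_distrib, parityAut_down, hD]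
  abel

theorem act_one : W.act C R (mono 0 ∅) = (2 : ℂ) • W.P := by
  simp [act_eq, parityAut_mono, funRep_D_mono_empty, down_mono, m_mono_zero_empty]

/-- Second covariant derivatives of ξ_i vanish, so no fibre term remains, and 2 ξ_i P − D_i = q_i.
-/
theorem act_xi (i : Fin 6) : W.act C R (mono 0 {i}) = W.q i := by
  have h1 : ∀ j, W.m (funRep.D j (parityAut (mono 0 {i}))) * W.D j =
      if j = i then -W.D j else 0 := fun j => by
    rw [parityAut_mono, map_smul, funRep_D_xi]
    split_ifs <;> simp [m_mono_zero_empty]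
  have h2 : ∀ r s, W.m (funRep.D r (funRep.D s (mono 0 {i}))) = 0 := fun r s => by
    rw [funRep_D_xi]
    split_ifs <;> simp [funRep_D_mono_empty]
  have h3 : W.m (mono 0 {i}) = W.ξ i := by
    rw [mono_singleton, m_wedge, m_mono_zero_empty, mul_one]
  rw [act_eq]
  simp only [h1, h2, h3, zero_mul, Finset.sum_const_zero, smul_zero, down_mono, Nat.cast_zero,
    zero_smul, map_zero, Finset.sum_ite_eq', Finset.mem_univ, if_true, add_zero]
  rw [WeylClifford.q, WeylClifford.D, two_smul]; abel

/-- `f ↦ W.act f` preserves the brackets on all of `N` once it does so on a generating set for the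
operators `q i`. -/
theorem act_bracket_of_generated (hC : W.Central C) (hR : ∀ r s, W.Central (R r s))
    (hgen : ∀ S : Submodule ℂ N, (∀ i, ∀ x ∈ S, W.q i x ∈ S) →
      (∀ x, (∀ p q f g, f ∈ ofParity p → g ∈ ofParity q →
        W.act C R f (W.act C R g x) - (-1 : ℂ) ^ (p * q) • W.act C R g (W.act C R f x) =
          W.act C R (bracket f g) x) → x ∈ S) → S = ⊤)
    {p q : ℕ} {f g : K} (hf : f ∈ ofParity p) (hg : g ∈ ofParity q) :
    W.act C R f * W.act C R g - (-1 : ℂ) ^ (p * q) • (W.act C R g * W.act C R f) =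
      W.act C R (bracket f g) := by
  -- All f and g are quantified together because passing from x to `q i x` replaces f or g by its
  -- derivative under `q i`.
  let S : Submodule ℂ N :=
    { carrier := {x | ∀ p q f g, f ∈ ofParity p → g ∈ ofParity q →
        W.act C R f (W.act C R g x) - (-1 : ℂ) ^ (p * q) • W.act C R g (W.act C R f x) =
          W.act C R (bracket f g) x}
      zero_mem' := by simp
      add_mem' := by
        intro x y hx hy p q f g hf hg
        simp only [map_add, ← hx p q f g hf hg, ← hy p q f g hf hg, smul_add]; abel
      smul_mem' := by
        intro c x hx p q f g hf hg
        simp only [map_smul, ← hx p q f g hf hg, smul_sub, smul_comm c] }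
  have hS : S = ⊤ := by
    refine hgen S (fun i x hx p q f g hf hg => ?_) fun x hx => hx
    -- Moving `q i` to the left reduces the relation for (f, g) at `q i x` to the relations at x for
    -- (f, g), (q_i f, g) and (f, q_i g). `q_bracket` matches the right-hand sides: this is the
    -- Jacobi identity.
    have hq : ∀ {p f}, f ∈ ofParity p → ∀ y, W.act C R f (W.q i y) =
        (-1 : ℂ) ^ p • (W.q i (W.act C R f y) - W.act C R (funRep.q i f) y) := by
      intro p f hf y
      have h1 := LinearMap.congr_fun (W.q_act hC hR i f) y
      rw [mem_ofParity_iff.mp hf, map_smul] at h1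
      simp only [Module.End.mul_apply, LinearMap.add_apply, LinearMap.smul_apply] at h1
      rw [h1, add_sub_cancel_left, smul_smul, ← mul_pow]
      simp
    have e1 := hx p q f g hf hg
    have e2 := hx (p + 1) q _ g (q_mem_ofParity i hf) hg
    have e3 := hx p (q + 1) f _ hf (q_mem_ofParity i hg)
    have e4 := congrArg (fun z => W.act C R z x) (q_bracket i f g)
    simp only [mem_ofParity_iff.mp hf, bracket_smul_left, map_add, map_smul, LinearMap.add_apply,
      LinearMap.smul_apply] at e4
    rw [hq hg, hq hf, hq (bracket_mem_ofParity hf hg), e4, ← e1, ← e2, ← e3]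
    simp only [map_smul, map_sub, hq hg, hq hf, smul_sub, smul_smul]
    have hpp : (-1 : ℂ) ^ p * (-1) ^ p = 1 := by rw [← mul_pow]; simp
    have hqq : (-1 : ℂ) ^ q * (-1) ^ q = 1 := by rw [← mul_pow]; simp
    have s1 : (-1 : ℂ) ^ ((p + 1) * q) = (-1) ^ (p * q) * (-1) ^ q := by
      rw [add_mul, one_mul, pow_add]
    have s2 : (-1 : ℂ) ^ (p * (q + 1)) = (-1) ^ (p * q) * (-1) ^ p := by
      rw [mul_add, mul_one, pow_add]
    rw [s1, s2, pow_add]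
    generalize (-1 : ℂ) ^ p = a at *
    generalize (-1 : ℂ) ^ q = b at *
    generalize (-1 : ℂ) ^ (p * q) = c at *
    match_scalars
    all_goals first
      | ring1
      | linear_combination b * hpp
      | linear_combination (-(a * c * b)) * hpp
      | linear_combination (-(a * c)) * hqq
  refine LinearMap.ext fun x => ?_
  have : x ∈ S := hS ▸ Submodule.mem_top
  exact this p q f g hf hg

end WeylClifford

namespace WeylClifford

variable {N : Type*} [AddCommGroup N] [Module ℂ N] (W : WeylClifford N)
  {C : Module.End ℂ N} {R : Fin 6 → Fin 6 → Module.End ℂ N}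

theorem q_q_self (i : Fin 6) : W.q i * W.q i = -W.P := by
  have h := W.q_q i i
  rw [if_pos rfl, two_mul, eq_sub_iff_add_eq, eq_neg_iff_add_eq_zero] at h
  have h2 : (2 : ℂ) • (W.q i * W.q i + W.P) = 0 := by rw [← h, two_smul]; abel
  rwa [smul_eq_zero, or_iff_right (by norm_num), ← eq_neg_iff_add_eq_zero] at h2

end WeylClifford

theorem deg_neg_cases {k : ℕ} {I : Finset (Fin 6)} (h : deg (k, I) < 0) :
    k = 0 ∧ (I = ∅ ∨ ∃ i, I = {i}) := by
  simp only [deg] at h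
  refine ⟨by omega, ?_⟩
  have : I.card = 0 ∨ I.card = 1 := by omega
  rwa [Finset.card_eq_zero, Finset.card_eq_one] at this

namespace WeylClifford

variable {N : Type*} [AddCommGroup N] [Module ℂ N] (W : WeylClifford N)
  {C : Module.End ℂ N} {R : Fin 6 → Fin 6 → Module.End ℂ N}

theorem act_bracket_of_neg (hC : W.Central C) (hR : ∀ r s, W.Central (R r s)) {k : ℕ}
    {I : Finset (Fin 6)} (h : deg (k, I) < 0) {g : K} {q : ℕ} (hg : g ∈ ofParity q) :
    W.act C R (mono k I) * W.act C R g
      - (-1 : ℂ) ^ (I.card * q) • (W.act C R g * W.act C R (mono k I)) =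
      W.act C R (bracket (mono k I) g) := by
  obtain ⟨rfl, rfl | ⟨i, rfl⟩⟩ := deg_neg_cases h
  · rw [act_one, bracket_one, map_smul, Finset.card_empty, zero_mul, pow_zero, one_smul,
      smul_mul_assoc, W.P_act hC hR, mul_smul_comm, ← smul_sub, add_sub_cancel_right]
  · rw [act_xi, bracket_xi, W.q_act hC hR, Finset.card_singleton, one_mul,
      mem_ofParity_iff.mp hg, map_smul, smul_mul_assoc, add_sub_cancel_right]

end WeylClifford

/-! ### The induced module as a tensor module on ℂ[Θ] ⊗ Λ(6) ⊗ F -/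

section Induced

variable {F : Type*} [AddCommGroup F] [Module ℂ F]

variable (F) in
/-- The Weyl–Clifford algebra on `ℂ[Θ] ⊗ Λ(6) ⊗ F`, where `Θ = -∂_t` and where `t` and the `ξ_i`
annihilate the vacuum. -/
def indRep : WeylClifford (Coord F) := (fockRep F).dual

theorem indRep_t_apply (w : Coord F) : (indRep F).t w = down F w := rfl

theorem indRep_P_apply (w : Coord F) : (indRep F).P w = -up F w := rfl

theorem indRep_ξ_apply (i : Fin 6) (w : Coord F) : (indRep F).ξ i w = -contr F i w := rfl

theorem indRep_b_apply (i : Fin 6) (w : Coord F) : (indRep F).b i w = -wedge F i w := rfl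

theorem indRep_q_apply (i : Fin 6) (w : Coord F) :
    (indRep F).q i w = contr F i (up F w) + wedge F i w := by
  rw [WeylClifford.q, LinearMap.sub_apply, Module.End.mul_apply, indRep_P_apply, indRep_ξ_apply,
    indRep_b_apply, map_neg, neg_neg, sub_neg_eq_add]

theorem indRep_D_apply (i : Fin 6) (w : Coord F) :
    (indRep F).D i w = contr F i (up F w) - wedge F i w := by
  rw [WeylClifford.D, LinearMap.add_apply, Module.End.mul_apply, indRep_P_apply, indRep_ξ_apply,
    indRep_b_apply, map_neg, neg_neg]; abel

/-- An endomorphism of `F` acting on the coefficients. -/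
def fib (A : Module.End ℂ F) : Module.End ℂ (Coord F) := Finsupp.mapRange.linearMap A

theorem fib_apply (A : Module.End ℂ F) (w : Coord F) (x : ℕ × Finset (Fin 6)) :
    fib A w x = A (w x) := by simp [fib]

theorem fib_sing (A : Module.End ℂ F) (k : ℕ) (I : Finset (Fin 6)) (v : F) :
    fib A (sing k I v) = sing k I (A v) := by simp [fib]

theorem central_fib (A : Module.End ℂ F) : (indRep F).Central (fib A) := by
  refine WeylClifford.Central.dual ⟨?_, ?_, fun i => ?_, fun i => ?_⟩
  · exact coord_ext fun k I v => by
      change up F (fib A _) = fib A (up F _)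
      simp [up_sing, fib_sing]
  · exact coord_ext fun k I v => by
      change down F (fib A _) = fib A (down F _)
      simp [down_sing, fib_sing]
  · exact coord_ext fun k I v => by
      change wedge F i (fib A _) = fib A (wedge F i _)
      simp [wedge_sing, fib_sing]
  · refine LinearMap.ext fun w => Finsupp.ext fun ⟨k, I⟩ => ?_
    change contr F i (fib A w) (k, I) = fib A (contr F i w) (k, I)
    simp only [contr_apply, fib_apply]
    split_ifs <;> simp

/-- The module is generated from `F` by the `η_i`. -/
theorem eq_top_of_q_mem {S : Submodule ℂ (Coord F)} (hq : ∀ i, ∀ x ∈ S, (indRep F).q i x ∈ S)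
    (h0 : ∀ v, sing 0 ∅ v ∈ S) : S = ⊤ := by
  have h1 : ∀ I v, sing 0 I v ∈ S := fun I v => by
    induction I using Finset.induction_on_min with
    | empty => exact h0 v
    | insert a I ha ih =>
      have hI : a ∉ I := fun h => lt_irrefl _ (ha a h)
      have := hq a _ ih
      rwa [indRep_q_apply, up_sing, contr_sing_of_notMem hI, wedge_sing, sgn_of_lt ha, zero_add,
        Int.cast_one, one_smul] at this
  have h2 : ∀ k I v, sing k I v ∈ S := fun k I v => by
    induction k with
    | zero => exact h1 I v
    | succ k ih =>
      -- The square of any `q i` is multiplication by Θ; the index 0 is an arbitrary choice.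
      have := hq 0 _ (hq 0 _ ih)
      have e := LinearMap.congr_fun ((indRep F).q_q_self 0) (sing k I v)
      rw [Module.End.mul_apply, LinearMap.neg_apply, indRep_P_apply, neg_neg, up_sing] at e
      rwa [e] at this
  rw [eq_top_iff]
  intro w _
  induction w using Finsupp.induction_linear with
  | zero => exact zero_mem _
  | add f g hf hg => exact add_mem (hf trivial) (hg trivial)
  | single x v => exact h2 x.1 x.2 v

/-- The coefficients through which `so(6)` acts on `F`. -/
def rot (π : K →ₗ[ℂ] Module.End ℂ F) (r s : Fin 6) : Module.End ℂ F :=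
  (sg s r : ℂ) • π (mono 0 {s, r})

theorem rot_swap (π : K →ₗ[ℂ] Module.End ℂ F) (r s : Fin 6) : rot π r s = -rot π s r := by
  rw [rot, rot, Finset.pair_comm, sg_swap]; simp

theorem rot_self (π : K →ₗ[ℂ] Module.End ℂ F) (r : Fin 6) : rot π r r = 0 := by
  simp [rot, sg_self]

/-- The action of `K(1,6)₊` on the module induced from the representation `π` of the degree zero
part on `F`. -/
def indAct (π : K →ₗ[ℂ] Module.End ℂ F) : K →ₗ[ℂ] Module.End ℂ (Coord F) :=
  -- The shift by 4 = 6 − 2 cancels what the differential part of t gives on the vacuum: −2 from 2 t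
  -- P and 1 from each of the six ξ_i D_i. With it, t acts on the vacuum by `π (mono 1 ∅)`.
  (indRep F).act (fib (π (mono 1 ∅) - (4 : ℂ) • 1)) fun r s => fib (rot π r s)

/-- Both t and the ξ_i annihilate the vacuum, so only the constant term of the symbol survives. -/
theorem m_vac (f : K) (v : F) : (indRep F).m f (sing 0 ∅ v) = f (0, ∅) • sing 0 ∅ v := by
  have : (LinearMap.applyₗ (sing 0 ∅ v)) ∘ₗ (indRep F).m =
      (LinearMap.toSpanSingleton ℂ (Coord F) (sing 0 ∅ v)) ∘ₗ Finsupp.lapply (0, ∅) := by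
    refine K_ext_wedge (fun k => ?_) fun a x h => ?_
    · simp only [LinearMap.comp_apply, LinearMap.applyₗ_apply_apply, WeylClifford.m_mono_empty,
        LinearMap.toSpanSingleton_apply, Finsupp.lapply_apply]
      rcases k with _ | k
      · simp [mono]
      · rw [pow_succ, Module.End.mul_apply, indRep_t_apply, down_sing]; simp [mono]
    · simp only [LinearMap.comp_apply, LinearMap.applyₗ_apply_apply,
        LinearMap.toSpanSingleton_apply, Finsupp.lapply_apply, WeylClifford.m_wedge,
        Module.End.mul_apply] at h ⊢
      rw [h, wedge_apply, map_smul, indRep_ξ_apply, contr_sing_of_notMem (by simp)]; simp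
  exact LinearMap.congr_fun this f

theorem funRep_D_apply_empty (i : Fin 6) (f : K) : funRep.D i f (0, ∅) = f (0, {i}) := by
  change contr ℂ i f (0, ∅) + wedge ℂ i (down ℂ f) (0, ∅) = _
  simp [contr_apply, wedge_apply]

theorem funRep_D_apply_singleton (i j : Fin 6) (f : K) :
    funRep.D i f (0, {j}) = sg i j * f (0, {i, j}) + if i = j then f (1, ∅) else 0 := by
  change contr ℂ i f (0, {j}) + wedge ℂ i (down ℂ f) (0, {j}) = _
  by_cases h : i = j
  · subst h; simp [contr_apply, wedge_apply, down_apply, sg_self]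
  · simp [contr_apply, wedge_apply, h]

/-- Commuting b_i to the left of the symbol leaves the constant term of a contraction; the other
term is killed because f has no constant term. -/
theorem m_b_vac (i : Fin 6) (f : K) (v : F) (hf : f (0, ∅) = 0) :
    (indRep F).m f ((indRep F).b i (sing 0 ∅ v)) = f (0, {i}) • sing 0 ∅ v := by
  have h := LinearMap.congr_fun ((indRep F).b_m i (parityAut f)) (sing 0 ∅ v)
  rw [parityAut_parityAut] at h
  simp only [Module.End.mul_apply, LinearMap.add_apply, m_vac, parityAut_apply, contr_apply] at h
  simp only [hf, mul_zero, zero_smul, map_zero] at h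
  have h' := eq_neg_of_add_eq_zero_right h.symm
  rw [h']; simp

/-- On the vacuum, the elements of nonnegative degree act through `F`. -/
theorem indAct_vac (π : K →ₗ[ℂ] Module.End ℂ F) {f : K} (h0 : f (0, ∅) = 0)
    (h1 : ∀ i, f (0, {i}) = 0) (v : F) : indAct π f (sing 0 ∅ v) =
      f (1, ∅) • sing 0 ∅ (π (mono 1 ∅) v)
        + (1 / 2 : ℂ) • ∑ r, ∑ s, (sg s r * f (0, {s, r})) • sing 0 ∅ (rot π r s v) := by
  have hP : (indRep F).m f ((indRep F).P (sing 0 ∅ v)) = -(f (1, ∅) • sing 0 ∅ v) := by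
    have h := LinearMap.congr_fun ((indRep F).P_m f) (sing 0 ∅ v)
    simp only [Module.End.mul_apply, LinearMap.add_apply, m_vac, down_apply, h0, zero_smul,
      map_zero] at h
    rw [eq_neg_of_add_eq_zero_right h.symm]; simp
  have hD : ∀ i, (indRep F).m (funRep.D i (parityAut f)) ((indRep F).D i (sing 0 ∅ v)) =
      f (1, ∅) • sing 0 ∅ v := fun i => by
    have e : (indRep F).D i (sing 0 ∅ v) = (indRep F).b i (sing 0 ∅ v) := by
      rw [indRep_D_apply, up_sing, contr_sing_of_notMem (by simp), indRep_b_apply, zero_sub]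
    rw [e, m_b_vac _ _ _ (by rw [funRep_D_apply_empty, parityAut_apply, h1, mul_zero]),
      funRep_D_apply_singleton, sg_self, if_pos rfl]
    simp [parityAut_apply]
  have hR : ∀ r s, (indRep F).m (funRep.D r (funRep.D s f)) (fib (rot π r s) (sing 0 ∅ v)) =
      (sg s r * f (0, {s, r})) • sing 0 ∅ (rot π r s v) := fun r s => by
    rw [fib_sing, m_vac, funRep_D_apply_empty, funRep_D_apply_singleton]
    by_cases h : s = r
    · subst h; simp [rot_self]
    · simp [h]
  rw [indAct, WeylClifford.act_eq]
  simp only [LinearMap.add_apply, LinearMap.smul_apply, LinearMap.sum_apply, Module.End.mul_apply,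
    hP, hD, hR]
  rw [fib_sing, m_vac, down_apply]
  simp only [LinearMap.sub_apply, LinearMap.smul_apply, Module.End.one_apply, Finset.sum_const,
    Finset.card_univ, Fintype.card_fin, sing, Finsupp.single_sub, Finsupp.smul_single]
  congr 1
  simp only [← Finsupp.single_neg, ← Finsupp.single_sub, ← Finsupp.single_add,
    Finsupp.smul_single]
  congr 1
  simp only [Nat.cast_zero, zero_add, one_smul, smul_sub, smul_smul, ← Nat.cast_smul_eq_nsmul ℂ]
  push_cast
  module

/-- `π` is a representation of `K(1,6)₊` in nonnegative degrees, factoring through degree zero. -/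
structure IsDegreeZeroRep (π : K →ₗ[ℂ] Module.End ℂ F) : Prop where
  zero : ∀ k I, deg (k, I) ≠ 0 → π (mono k I) = 0
  bracket : ∀ k I l J, 0 ≤ deg (k, I) → 0 ≤ deg (l, J) →
    π (bracket (mono k I) (mono l J)) =
      π (mono k I) * π (mono l J) - (-1 : ℂ) ^ (I.card * J.card) • (π (mono l J) * π (mono k I))

variable {π : K →ₗ[ℂ] Module.End ℂ F}

/-- Only the coefficients of t and of the ξ_a ξ_b enter `indAct_vac`, and these are exactly the
monomials of degree zero. In positive degree both sides vanish. -/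
theorem indAct_vac_mono (hπ : IsDegreeZeroRep π) {k : ℕ} {I : Finset (Fin 6)}
    (h : 0 ≤ deg (k, I)) (v : F) :
    indAct π (mono k I) (sing 0 ∅ v) = sing 0 ∅ (π (mono k I) v) := by
  have hk : ¬(k = 0 ∧ I.card < 2) := fun hk => by simp only [deg] at h; omega
  have h0 : mono k I (0, ∅) = 0 := by
    rw [mono, Finsupp.single_apply, if_neg]
    rintro ⟨⟩; simp at hk
  have h1 : ∀ i, mono k I (0, {i}) = 0 := fun i => by
    rw [mono, Finsupp.single_apply, if_neg]
    rintro ⟨⟩; simp at hk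
  rw [indAct_vac π h0 h1]
  by_cases e1 : k = 1 ∧ I = ∅
  · obtain ⟨rfl, rfl⟩ := e1
    simp [mono]
  have e1' : mono k I (1, ∅) = 0 := by
    rw [mono, Finsupp.single_apply, if_neg]
    rintro ⟨⟩; simp at e1
  by_cases e2 : k = 0 ∧ I.card = 2
  · obtain ⟨rfl, e2⟩ := e2
    obtain ⟨a, b, hab, rfl⟩ := Finset.card_eq_two.mp e2
    -- The pair {a, b} occurs for both orders of (r, s), which compensates the factor 1/2 in `act`.
    have : ∀ r s, (sg s r * mono 0 {a, b} (0, {s, r})) • (sing 0 ∅ (rot π r s v) : Coord F) =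
        (if s = a then if r = b then sing 0 ∅ (π (mono 0 {a, b}) v) else 0 else 0)
        + if s = b then if r = a then sing 0 ∅ (π (mono 0 {a, b}) v) else 0 else 0 :=
          fun r s => by
      by_cases hrs : s = r
      · subst hrs
        rw [rot_self]
        by_cases ha : s = a <;> by_cases hb : s = b <;> simp_all
      have hS : (sg s r : ℂ) * sg s r = 1 := by exact_mod_cast sg_mul_self hrs
      by_cases hx : ({a, b} : Finset (Fin 6)) = {s, r}
      · have hx' : s = a ∧ r = b ∨ s = b ∧ r = a := by
          have h1 : s ∈ ({a, b} : Finset (Fin 6)) := by simp [hx]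
          have h2 : r ∈ ({a, b} : Finset (Fin 6)) := by simp [hx]
          simp only [Finset.mem_insert, Finset.mem_singleton] at h1 h2
          rcases h1 with rfl | rfl <;> rcases h2 with rfl | rfl <;> simp_all
        rw [rot, ← hx, mono, Finsupp.single_eq_same, mul_one, LinearMap.smul_apply]
        simp only [sing, Finsupp.smul_single, smul_smul, hS, one_smul]
        rcases hx' with ⟨rfl, rfl⟩ | ⟨rfl, rfl⟩ <;> simp [hab, hab.symm]
      · have : ¬(s = a ∧ r = b) := by rintro ⟨rfl, rfl⟩; exact hx rfl
        have h' : ¬(s = b ∧ r = a) := by rintro ⟨rfl, rfl⟩; exact hx (Finset.pair_comm _ _)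
        rw [mono, Finsupp.single_apply, if_neg (by simpa using hx), ← ite_and, ← ite_and, if_neg this,
          if_neg h']
        simp
    simp only [this, Finset.sum_add_distrib, Finset.sum_ite_eq', Finset.mem_univ, if_true, e1',
      zero_smul, zero_add]
    rw [← two_smul ℂ, smul_smul]
    norm_num
  · have hne : deg (k, I) ≠ 0 := by
      intro hd
      simp only [deg] at hd
      have : (k = 1 ∧ I.card = 0) ∨ (k = 0 ∧ I.card = 2) := by omega
      rcases this with ⟨rfl, h'⟩ | h'
      · exact e1 ⟨rfl, Finset.card_eq_zero.mp h'⟩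
      · exact e2 h'
    have : ∀ r s, (sg s r * mono k I (0, {s, r})) • (sing 0 ∅ (rot π r s v) : Coord F) = 0 :=
      fun r s => by
        by_cases hrs : s = r
        · subst hrs; simp [sg_self]
        · rw [mono, Finsupp.single_apply, if_neg]
          · simp
          · rintro ⟨⟩
            exact e2 ⟨rfl, Finset.card_pair hrs⟩
    rw [hπ.zero k I hne, e1']
    simp [this]

theorem indAct_vac_of_nonneg (hπ : IsDegreeZeroRep π) {f : K}
    (h : f ∈ Finsupp.supported ℂ ℂ {x | 0 ≤ deg x}) (v : F) :
    indAct π f (sing 0 ∅ v) = sing 0 ∅ (π f v) := by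
  refine supported_induction (p := fun f => indAct π f (sing 0 ∅ v) = sing 0 ∅ (π f v)) (by simp)
    (fun f g hf hg => ?_) (fun c f hf => ?_) (fun k I hI => indAct_vac_mono hπ hI v) h
  · rw [map_add, LinearMap.add_apply, hf, hg, map_add, LinearMap.add_apply, ← Finsupp.single_add]
  · rw [map_smul, LinearMap.smul_apply, hf, map_smul, LinearMap.smul_apply, Finsupp.smul_single]

theorem indAct_q (i : Fin 6) (f : K) : (indRep F).q i * indAct π f =
    indAct π (funRep.q i f) + indAct π (parityAut f) * (indRep F).q i :=
  WeylClifford.q_act _ (central_fib _) (fun _ _ => central_fib _) i f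

theorem indAct_one : indAct π (mono 0 ∅) = (2 : ℂ) • (indRep F).P :=
  WeylClifford.act_one _

theorem indAct_xi (i : Fin 6) : indAct π (mono 0 {i}) = (indRep F).q i :=
  WeylClifford.act_xi _ i

theorem indAct_bracket_of_neg {k : ℕ} {I : Finset (Fin 6)} (h : deg (k, I) < 0) (l : ℕ)
    (J : Finset (Fin 6)) (x : Coord F) :
    indAct π (mono k I) (indAct π (mono l J) x)
        - (-1 : ℂ) ^ (I.card * J.card) • indAct π (mono l J) (indAct π (mono k I) x) =
      indAct π (bracket (mono k I) (mono l J)) x := by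
  have := (indRep F).act_bracket_of_neg (central_fib (π (mono 1 ∅) - (4 : ℂ) • 1))
      (fun r s => central_fib (rot π r s)) h (mono_mem_ofParity l J)
  rw [indAct, ← this]
  rfl

/-- If one factor has negative degree the relation holds on every vector. Otherwise both factors and
their bracket act on the vacuum through F, and the relation is the one for π. -/
theorem indAct_bracket_vac_mono (hπ : IsDegreeZeroRep π) (v : F) (k l : ℕ)
    (I J : Finset (Fin 6)) :
    indAct π (mono k I) (indAct π (mono l J) (sing 0 ∅ v))
        - (-1 : ℂ) ^ (I.card * J.card) • indAct π (mono l J) (indAct π (mono k I) (sing 0 ∅ v)) =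
      indAct π (bracket (mono k I) (mono l J)) (sing 0 ∅ v) := by
  by_cases h1 : deg (k, I) < 0
  · exact indAct_bracket_of_neg h1 _ _ _
  by_cases h2 : deg (l, J) < 0
  · rw [bracket_comm (mono_mem_ofParity k I) (mono_mem_ofParity l J), map_neg, map_smul,
      LinearMap.neg_apply, LinearMap.smul_apply, ← indAct_bracket_of_neg h2, smul_sub, smul_smul,
      mul_comm J.card, ← mul_pow, neg_one_mul, neg_neg, one_pow, one_smul, neg_sub]
  · rw [not_lt] at h1 h2
    have hb : bracket (mono k I) (mono l J) ∈ Finsupp.supported ℂ ℂ {x | 0 ≤ deg x} := by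
      refine Finsupp.supported_mono ?_ (bracket_mem_homog (mono_mem_homog (k := k) (I := I) rfl)
        (mono_mem_homog (k := l) (I := J) rfl))
      intro x (hx : deg x = _)
      change 0 ≤ deg x
      rw [hx]; exact add_nonneg h1 h2
    rw [indAct_vac_of_nonneg hπ hb, hπ.bracket k I l J h1 h2, indAct_vac_mono hπ h1,
      indAct_vac_mono hπ h2, indAct_vac_mono hπ h1, indAct_vac_mono hπ h2, LinearMap.sub_apply,
      LinearMap.smul_apply, Module.End.mul_apply, Module.End.mul_apply, sing, sing, sing,
      Finsupp.single_sub, Finsupp.smul_single]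

/-- A bilinear identity for elements of given parities may be checked on monomials. -/
theorem parity_induction₂ {N : Type*} [AddCommGroup N] [Module ℂ N] {B : K → K → N}
    (add_left : ∀ f f' g, B (f + f') g = B f g + B f' g)
    (smul_left : ∀ (c : ℂ) f g, B (c • f) g = c • B f g)
    (add_right : ∀ f g g', B f (g + g') = B f g + B f g')
    (smul_right : ∀ (c : ℂ) f g, B f (c • g) = c • B f g) {p q : ℕ}
    (h : ∀ k l I J, I.card % 2 = p % 2 → J.card % 2 = q % 2 → B (mono k I) (mono l J) = 0)
    {f g : K} (hf : f ∈ ofParity p) (hg : g ∈ ofParity q) : B f g = 0 := by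
  refine supported_induction (p := fun f => B f g = 0) ?_ (fun f f' h h' => ?_)
    (fun c f h => ?_) (fun k I hI => ?_) hf
  · simpa using smul_left 0 0 g
  · rw [add_left, h, h', add_zero]
  · rw [smul_left, h, smul_zero]
  refine supported_induction (p := fun g => B (mono k I) g = 0) ?_ (fun f f' h h' => ?_)
    (fun c f h => ?_) (fun l J hJ => ?_) hg
  · simpa using smul_right 0 (mono k I) 0
  · rw [add_right, h, h', add_zero]
  · rw [smul_right, h, smul_zero]
  · exact h k l I J hI hJ

theorem indAct_bracket_vac (hπ : IsDegreeZeroRep π) (v : F) {p q : ℕ} {f g : K}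
    (hf : f ∈ ofParity p) (hg : g ∈ ofParity q) :
    indAct π f (indAct π g (sing 0 ∅ v)) - (-1 : ℂ) ^ (p * q) • indAct π g (indAct π f (sing 0 ∅ v))
      = indAct π (bracket f g) (sing 0 ∅ v) := by
  rw [← sub_eq_zero]
  refine parity_induction₂ (B := fun f g => indAct π f (indAct π g (sing 0 ∅ v))
    - (-1 : ℂ) ^ (p * q) • indAct π g (indAct π f (sing 0 ∅ v))
      - indAct π (bracket f g) (sing 0 ∅ v)) (fun f f' g => ?_) (fun c f g => ?_)
      (fun f g g' => ?_) (fun c f g => ?_) (fun k l I J hI hJ => ?_) hf hg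
  · simp only [bracket_add_left, map_add, LinearMap.add_apply, smul_add]; abel
  · simp only [bracket_smul_left, map_smul, LinearMap.smul_apply, smul_sub, smul_comm c]
  · simp only [bracket_add_right, map_add, LinearMap.add_apply, smul_add]; abel
  · simp only [bracket_smul_right, map_smul, LinearMap.smul_apply, smul_sub, smul_comm c]
  · have hs : (-1 : ℂ) ^ (p * q) = (-1) ^ (I.card * J.card) := by
      rw [neg_one_pow_eq_iff]
      exact (Nat.ModEq.mul (show _ ≡ _ [MOD 2] from hI) (show _ ≡ _ [MOD 2] from hJ)).symm
    rw [hs, indAct_bracket_vac_mono hπ, sub_self]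

/-- `indAct π` is a representation of `K(1,6)₊`. -/
theorem indAct_bracket (hπ : IsDegreeZeroRep π) {p q : ℕ} {f g : K}
    (hf : f ∈ ofParity p) (hg : g ∈ ofParity q) :
    indAct π f * indAct π g - (-1 : ℂ) ^ (p * q) • (indAct π g * indAct π f) =
      indAct π (bracket f g) :=
  WeylClifford.act_bracket_of_generated _ (central_fib _) (fun _ _ => central_fib _)
    (fun _ hS h => eq_top_of_q_mem hS fun v => h _ fun _ _ _ _ hf hg =>
      indAct_bracket_vac hπ v hf hg) hf hg

end Induced

/-! ### The structure of `g` -/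

theorem dt_pow_mono (n k : ℕ) (I : Finset (Fin 6)) :
    (dt ^ n) (mono k I) = (k.descFactorial n : ℂ) • mono (k - n) I := by
  induction n with
  | zero => simp
  | succ n ih =>
    rw [pow_succ', Module.End.mul_apply, ih, map_smul, dt_eq, down_mono, smul_smul,
      Nat.descFactorial_succ, Nat.sub_sub]
    push_cast; rw [mul_comm]

theorem integ_pow_mono (n k : ℕ) (I : Finset (Fin 6)) :
    (integ ^ n) (mono k I) = ((k.factorial : ℂ) / (k + n).factorial) • mono (k + n) I := by
  induction n with
  | zero => simp [Nat.factorial_ne_zero]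
  | succ n ih =>
    have e : integ (mono (k + n) I) = (((k + n : ℕ) : ℂ) + 1)⁻¹ • mono (k + n + 1) I := by
      simp [integ, mono]
    rw [pow_succ', Module.End.mul_apply, ih, map_smul, e, smul_smul, ← add_assoc,
      Nat.factorial_succ (k + n)]
    congr 1
    push_cast
    rw [mul_comm (_ + 1 : ℂ), div_mul_eq_div_div]; rfl

/-- The coefficient of the operator `A` on `t^k ξ_L`, `|L| = l`, up to the sign of the dual. -/
def coefA (k l : ℕ) : ℂ :=
  if 3 ≤ k + l then (-1) ^ (l * (l + 1) / 2) * (k.factorial / (k + l - 3).factorial) else 0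

theorem coefA_of_lt {k l : ℕ} (h : k + l < 3) : coefA k l = 0 := if_neg (by omega)

theorem dtPow_mono (k l : ℕ) (I : Finset (Fin 6)) : dtPow l (mono k I) =
    (if 3 ≤ k + l then (k.factorial / (k + l - 3).factorial : ℂ) else 0) • mono (k + l - 3) I := by
  rw [dtPow]
  split_ifs with h1 h2 h2
  · rw [dt_pow_mono, show k - (3 - l) = k + l - 3 by omega]
    congr 1
    rw [eq_div_iff (by exact_mod_cast Nat.factorial_ne_zero _), mul_comm]
    have := Nat.factorial_mul_descFactorial (n := k) (k := 3 - l) (by omega)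
    rw [show k - (3 - l) = k + l - 3 by omega] at this
    exact_mod_cast this
  · rw [dt_pow_mono, Nat.descFactorial_eq_zero_iff_lt.mpr (by omega)]; simp
  · rw [integ_pow_mono, show k + (l - 3) = k + l - 3 by omega]
  · omega

theorem opA_mono (k : ℕ) (L : Finset (Fin 6)) :
    opA (mono k L) = (coefA k L.card * sgn L Lᶜ) • mono (k + L.card - 3) Lᶜ := by
  have e1 : star (mono k L) = (sgn L Lᶜ : ℂ) • mono k Lᶜ := by simp [star, mono]
  have e2 : opA (mono k L) =
      ((-1 : ℂ) ^ (L.card * (L.card + 1) / 2)) • dtPow L.card (star (mono k L)) := by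
    simp [opA, mono]
  rw [e2, e1, map_smul, dtPow_mono, smul_smul, smul_smul, coefA]
  congr 1
  split_ifs <;> ring

theorem neg_one_pow_triangle (l : ℕ) : (-1 : ℂ) ^ ((l + 1) * (l + 1 + 1) / 2) =
    (-1) ^ (l + 1) * (-1) ^ (l * (l + 1) / 2) := by
  rw [← pow_add, show (l + 1) * (l + 1 + 1) = l * (l + 1) + (l + 1) * 2 by ring,
    Nat.add_mul_div_right _ _ (by norm_num), add_comm]

/-- This recursion and `coefA_pred` say that ∂_t undoes one integration in A. They serve the cases i
∈ L and i ∉ L of `opA_q_opA`. -/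
theorem coefA_succ_mul (k l : ℕ) :
    coefA k (l + 1) * ((k + (l + 1) - 3 : ℕ) : ℂ) = (-1) ^ (l + 1) * coefA k l := by
  by_cases h : 3 ≤ k + l
  · rw [coefA, coefA, if_pos (by omega), if_pos h, neg_one_pow_triangle]
    obtain ⟨n, hn⟩ : ∃ n, k + l = n + 3 := ⟨k + l - 3, by omega⟩
    rw [show k + (l + 1) - 3 = n + 1 by omega, show k + l - 3 = n by omega, Nat.factorial_succ]
    have : (n.factorial : ℂ) ≠ 0 := by exact_mod_cast Nat.factorial_ne_zero _
    have : (n + 1 : ℂ) ≠ 0 := by exact_mod_cast Nat.succ_ne_zero n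
    push_cast
    field_simp
  -- The factor k + (l + 1) − 3 is 0 here, which is needed for k + l = 2, where `coefA k (l + 1)` is
  -- not zero.
  · rw [coefA_of_lt (k := k) (l := l) (by omega), show k + (l + 1) - 3 = 0 by omega]; simp

theorem coefA_pred (k l : ℕ) :
    ((k : ℂ) + 1) * coefA k (l + 1) = (-1) ^ (l + 1) * coefA (k + 1) l := by
  rw [coefA, coefA, show k + (l + 1) = k + 1 + l by ring, neg_one_pow_triangle, Nat.factorial_succ]
  split_ifs
  · push_cast; ring
  · simp

/-- The operators `ξ_i ∂_t - ∂_i` and `A` commute up to the kernel of `A`. -/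
theorem opA_q_opA (i : Fin 6) (f : K) :
    opA (funRep.q i (opA f) - opA (funRep.q i f)) = 0 := by
  have hq : ∀ x, funRep.q i x = wedge ℂ i (down ℂ x) - contr ℂ i x := fun _ => rfl
  have q_mem : ∀ k {I}, i ∉ I →
      funRep.q i (mono k (insert i I)) = -((sgn {i} I : ℂ) • mono k I) := fun k I hI => by
    rw [hq, down_mono, map_smul, mono, mono, wedge_sing_of_mem (by simp), smul_zero, zero_sub,
      contr_sing_insert hI, mono]
  have q_notMem : ∀ k {I}, i ∉ I → funRep.q i (mono k I) =
      ((k : ℂ) * sgn {i} I) • mono (k - 1) (insert i I) := fun k I hI => by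
    rw [hq, down_mono, map_smul, mono, mono, wedge_sing, contr_sing_of_notMem hI, sub_zero,
      smul_smul, mono]
  have : opA ∘ₗ (funRep.q i ∘ₗ opA - opA ∘ₗ funRep.q i) = 0 := by
    refine K_ext fun k L => ?_
    simp only [LinearMap.comp_apply, LinearMap.sub_apply, LinearMap.zero_apply]
    by_cases hi : i ∈ L
    · obtain ⟨L, h, rfl⟩ : ∃ J', i ∉ J' ∧ L = insert i J' := ⟨L.erase i, by simp, by simp [hi]⟩
      obtain ⟨R, hR, hiR⟩ : ∃ R, R = (insert i L)ᶜ ∧ i ∉ R := ⟨_, rfl, by simp⟩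
      have hLc : Lᶜ = insert i R := by
        rw [hR]; ext x; by_cases hx : x = i <;> simp [hx, h]
      have hdisj : i ∉ L := h
      rw [opA_mono, ← hR, map_smul, q_notMem _ hiR, q_mem _ h, map_neg, map_smul, opA_mono, hLc,
        sub_neg_eq_add, smul_smul, smul_smul, Finset.card_insert_of_notMem h,
        show k + (L.card + 1) - 3 - 1 = k + L.card - 3 by omega, ← add_smul]
      convert opA.map_zero
      rw [smul_eq_zero]
      left
      rw [sgn_insert_left h, sgn_insert_right _ hiR, sgn_comm_singleton]
      have h1 := coefA_succ_mul k L.card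
      have h2 : (sgn {i} R : ℂ) * sgn {i} R = 1 := sgn_singleton_sq hiR
      push_cast
      linear_combination (sgn {i} R * sgn L R * sgn {i} R : ℂ) * h1 +
        (-1) ^ (L.card + 1) * coefA k L.card * sgn L R * h2 +
         coefA k L.card * sgn L R * (-1) ^ L.card * (sgn_singleton_sq h)
    · obtain ⟨R, hR, hiR⟩ : ∃ R, R = (insert i L)ᶜ ∧ i ∉ R := ⟨_, rfl, by simp⟩
      have hLc : Lᶜ = insert i R := by
        rw [hR]; ext x; by_cases hx : x = i <;> simp [hx, hi]
      rw [opA_mono, hLc, map_smul, q_mem _ hiR, q_notMem _ hi, map_smul, opA_mono, ← hR, smul_neg,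
        smul_smul, smul_smul, Finset.card_insert_of_notMem hi]
      -- For k = 0 the operators need not commute, as integration does not undo ∂_t on constants.
      -- For |L| ≥ 3 the discrepancy is a multiple of t^(|L|−3) ξ_R with |R| = 5 − |L|; exponent and
      -- length add up to 2, below the threshold 3, so A kills it.
      rcases k with _ | k
      · have hc : R.card + L.card = 5 := by
          have := Finset.card_compl (insert i L)
          rw [← hR, Finset.card_insert_of_notMem hi, Fintype.card_fin] at this
          have := Finset.card_le_univ (insert i L)
          rw [Finset.card_insert_of_notMem hi, Fintype.card_fin] at this
          omega
        rw [Nat.cast_zero, zero_mul, zero_mul, zero_smul, sub_zero, map_neg, map_smul, opA_mono]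
        by_cases hl : 3 ≤ L.card
        · rw [coefA_of_lt (k := 0 + L.card - 3) (by omega)]; simp
        · rw [coefA_of_lt (k := 0) (by omega)]; simp
      · rw [show k + 1 - 1 + (L.card + 1) - 3 = k + 1 + L.card - 3 by omega, ← neg_smul, ← sub_smul]
        convert opA.map_zero
        rw [smul_eq_zero]
        left
        rw [sgn_insert_left hi, sgn_insert_right _ hiR, sgn_comm_singleton, Nat.add_sub_cancel]
        have h1 := coefA_pred k L.card
        push_cast
        linear_combination (-(sgn {i} L * sgn L R * sgn {i} R : ℂ)) * h1
  exact LinearMap.congr_fun this f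

theorem sub_opA_mem_g (f : K) : f - Complex.I • opA f ∈ g := ⟨f, rfl⟩

theorem mem_g_of_opA_eq_zero {f : K} (h : opA f = 0) : f ∈ g := by
  have := sub_opA_mem_g f
  rwa [h, smul_zero, sub_zero] at this

theorem exists_of_mem_g {x : K} (hx : x ∈ g) : ∃ f, x = f - Complex.I • opA f :=
  let ⟨f, hf⟩ := hx
  ⟨f, hf.symm⟩

/-- `g` is stable under the adjoint action of `ξ_i`. -/
theorem q_mem_g (i : Fin 6) {x : K} (hx : x ∈ g) : funRep.q i x ∈ g := by
  obtain ⟨f, rfl⟩ := exists_of_mem_g hx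
  have h1 := sub_opA_mem_g (funRep.q i f)
  have h2 := mem_g_of_opA_eq_zero (opA_q_opA i f)
  -- The first term is in the image of Id − iA by construction. The second is in the kernel of A,
  -- hence fixed by Id − iA.
  have : funRep.q i (f - Complex.I • opA f) = (funRep.q i f - Complex.I • opA (funRep.q i f))
        - Complex.I • (funRep.q i (opA f) - opA (funRep.q i f)) := by
    rw [map_sub, map_smul, smul_sub]
    abel
  rw [this]
  exact sub_mem h1 (Submodule.smul_mem _ _ h2)

/-- The element `(Id - iA) (t^k ξ_L)` of `g`. -/
def gElt (k : ℕ) (L : Finset (Fin 6)) : K := mono k L - Complex.I • opA (mono k L)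

theorem gElt_mem (k : ℕ) (L : Finset (Fin 6)) : gElt k L ∈ g := sub_opA_mem_g _

theorem gElt_of_lt {k : ℕ} {L : Finset (Fin 6)} (h : k + L.card < 3) : gElt k L = mono k L := by
  rw [gElt, opA_mono, coefA_of_lt h]; simp

theorem card_compl_add (L : Finset (Fin 6)) : Lᶜ.card + L.card = 6 := by
  rw [Finset.card_compl_add_card, Fintype.card_fin]

theorem opA_mem_homog {f : K} {d : ℤ} (hf : f ∈ homog d) : opA f ∈ homog d := by
  rw [← add_zero d]
  refine map_mem_homog (fun k L => ?_) hf
  rw [opA_mono]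
  refine smul_mono_mem_homog fun h => ?_
  have : 3 ≤ k + L.card := by
    by_contra hlt
    rw [coefA_of_lt (by omega)] at h; simp at h
  have := card_compl_add L
  simp only [deg]; omega

theorem gElt_mem_homog (k : ℕ) (L : Finset (Fin 6)) : gElt k L ∈ homog (deg (k, L)) :=
  sub_mem (mono_mem_homog rfl) (Submodule.smul_mem _ _ (opA_mem_homog (mono_mem_homog rfl)))

theorem gElt_mem_ofParity (k : ℕ) (L : Finset (Fin 6)) : gElt k L ∈ ofParity L.card := by
  refine sub_mem (mono_mem_ofParity k L) (Submodule.smul_mem _ _ ?_)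
  rw [opA_mono]
  refine Submodule.smul_mem _ _ (Finsupp.single_mem_supported ℂ 1 ?_)
  have := card_compl_add L
  change Lᶜ.card % 2 = L.card % 2
  omega

open Classical in
/-- The projection to the span of the monomials with degrees in `S`. -/
def degProj (S : Set ℤ) : K →ₗ[ℂ] K :=
  Finsupp.linearCombination ℂ fun x => if deg x ∈ S then mono x.1 x.2 else 0

open Classical in
theorem degProj_mono (S : Set ℤ) (k : ℕ) (I : Finset (Fin 6)) :
    degProj S (mono k I) = if deg (k, I) ∈ S then mono k I else 0 := by
  simp [degProj, mono]

theorem degProj_of_mem {S : Set ℤ} {f : K} (h : f ∈ Finsupp.supported ℂ ℂ {x | deg x ∈ S}) :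
    degProj S f = f := by
  refine supported_induction (p := fun f => degProj S f = f) (by simp)
    (fun f g hf hg => by rw [map_add, hf, hg]) (fun c f hf => by rw [map_smul, hf])
    (fun k I hI => ?_) h
  have hI : deg (k, I) ∈ S := hI
  rw [degProj_mono, if_pos hI]

theorem degProj_of_notMem {S : Set ℤ} {d : ℤ} (hd : d ∉ S) {f : K} (h : f ∈ homog d) :
    degProj S f = 0 := by
  refine supported_induction (p := fun f => degProj S f = 0) (by simp)
    (fun f g hf hg => by rw [map_add, hf, hg, add_zero])
    (fun c f hf => by rw [map_smul, hf, smul_zero]) (fun k I hI => ?_) h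
  have hI : deg (k, I) = d := hI
  rw [degProj_mono, if_neg (hI ▸ hd)]

/-- A preserves the degree, so degree projections commute with Id − iA. Hence `g` is graded and
spanned by the `gElt k L`, degree by degree. -/
theorem degProj_opA (S : Set ℤ) (f : K) : degProj S (opA f) = opA (degProj S f) := by
  have : degProj S ∘ₗ opA = opA ∘ₗ degProj S := K_ext fun k L => by
    have h := opA_mem_homog (mono_mem_homog (k := k) (I := L) rfl)
    rw [LinearMap.comp_apply, LinearMap.comp_apply, degProj_mono]
    split_ifs with hS
    · refine degProj_of_mem (Finsupp.supported_mono ?_ h)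
      intro x (hx : deg x = _)
      change deg x ∈ S
      rwa [hx]
    · rw [degProj_of_notMem hS h, map_zero]
  exact LinearMap.congr_fun this f

/-- The elements of `g` with degrees in `S` are spanned by the `gElt k L` with degrees in `S`. -/
theorem g_induction {S : Set ℤ} {p : K → Prop} (zero : p 0)
    (add : ∀ f g, p f → p g → p (f + g)) (smul : ∀ (c : ℂ) f, p f → p (c • f))
    (mem : ∀ k I, deg (k, I) ∈ S → p (gElt k I)) {x : K} (hx : x ∈ g)
    (hS : x ∈ Finsupp.supported ℂ ℂ {x | deg x ∈ S}) : p x := by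
  obtain ⟨f, rfl⟩ := exists_of_mem_g hx
  have e := degProj_of_mem hS
  rw [map_sub, map_smul, degProj_opA] at e
  rw [← e]
  clear e hS hx
  induction f using K_induction with
  | zero => simpa using zero
  | add f f' h h' =>
    have := add _ _ h h'
    rw [map_add, map_add, smul_add]
    convert this using 1
    abel
  | smul c f h =>
    have := smul c _ h
    rw [map_smul, map_smul, smul_comm]
    rwa [smul_sub] at this
  | mono k I =>
    rw [degProj_mono]
    split_ifs with h
    · exact mem k I h
    · simpa using zero

theorem gNonneg_induction {p : K → Prop} (zero : p 0)
    (add : ∀ f g, p f → p g → p (f + g)) (smul : ∀ (c : ℂ) f, p f → p (c • f))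
    (mem : ∀ k I, 0 ≤ deg (k, I) → p (gElt k I)) {x : K} (hx : x ∈ gNonneg) : p x :=
  g_induction (S := Set.Ici 0) zero add smul mem hx.1 hx.2

theorem homog_le_supported {d : ℤ} {S : Set ℤ} (hd : d ∈ S) :
    homog d ≤ Finsupp.supported ℂ ℂ {x | deg x ∈ S} :=
  Finsupp.supported_mono fun x (hx : deg x = d) => show deg x ∈ S by rwa [hx]

theorem gElt_mem_gNonneg {k : ℕ} {L : Finset (Fin 6)} (h : 0 ≤ deg (k, L)) :
    gElt k L ∈ gNonneg :=
  ⟨gElt_mem k L, homog_le_supported (S := Set.Ici 0) h (gElt_mem_homog k L)⟩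

theorem gElt_mem_gPos {k : ℕ} {L : Finset (Fin 6)} (h : 0 < deg (k, L)) : gElt k L ∈ gPos :=
  ⟨gElt_mem k L, homog_le_supported (S := Set.Ioi 0) h (gElt_mem_homog k L)⟩

theorem card_lt_of_deg_zero {k : ℕ} {L : Finset (Fin 6)} (h : deg (k, L) = 0) :
    k + L.card < 3 := by
  simp only [deg] at h; omega

theorem mono_mem_gNonneg {k : ℕ} {L : Finset (Fin 6)} (h : deg (k, L) = 0) :
    mono k L ∈ gNonneg := by
  rw [← gElt_of_lt (card_lt_of_deg_zero h)]
  exact gElt_mem_gNonneg h.ge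

/-- Degree zero is spanned by t and the ξ_a ξ_b, which A kills, so there `g` is all of K(1,6)₊. -/
theorem mem_gNonneg_of_homog {f : K} (h : f ∈ homog 0) : f ∈ gNonneg := by
  refine supported_induction (p := fun f => f ∈ gNonneg) (zero_mem _) (fun f g => add_mem)
    (fun c f => Submodule.smul_mem _ c) (fun k I hI => mono_mem_gNonneg hI) h

/-! ### The action of `g_{≥ 0}` on `F` -/

/-- The operator `ad t` is the degree. -/
theorem bracket_t (k : ℕ) (I : Finset (Fin 6)) :
    bracket (mono 1 ∅) (mono k I) = (deg (k, I) : ℂ) • mono k I := by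
  have h1 : ∀ i, funRep.D i (mono 1 ∅) = mono 0 {i} := fun i => by
    change contr ℂ i _ + wedge ℂ i (down ℂ _) = _
    rw [contr_mono_empty, down_mono, Nat.cast_one, one_smul, mono_singleton, zero_add]
  have h2 : ∀ i, wedge ℂ i (funRep.D i (mono k I)) = if i ∈ I then mono k I else 0 := fun i => by
    change wedge ℂ i (contr ℂ i _ + wedge ℂ i (down ℂ _)) = _
    have : wedge ℂ i (wedge ℂ i (down ℂ (mono k I))) = 0 := LinearMap.congr_fun (funRep.ξ_sq i) _
    rw [map_add, this, add_zero]
    split_ifs with h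
    · obtain ⟨J, hJ, rfl⟩ : ∃ J', i ∉ J' ∧ I = insert i J' := ⟨I.erase i, by simp, by simp [h]⟩
      rw [mono, contr_sing_insert hJ, map_smul, wedge_sing, smul_smul, sgn_singleton_sq hJ,
        one_smul]
    · rw [mono, contr_sing_of_notMem h, map_zero]
  have h3 : mul (mono 1 ∅) (down ℂ (mono k I)) = (k : ℂ) • mono k I := by
    rw [down_mono, map_smul, mul_mono, sgn_empty_left, Int.cast_one, one_smul, Finset.empty_union]
    rcases k with _ | k
    · simp
    · rw [Nat.add_sub_cancel, add_comm]
  rw [bracket_eq, parityAut_mono, h3]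
  simp only [Finset.card_empty, pow_zero, one_smul, h1, mul_xi, h2, down_mono, Nat.cast_one,
    Nat.sub_self, mul_one_left]
  rw [Finset.sum_ite_mem, Finset.univ_inter, Finset.sum_const, ← Nat.cast_smul_eq_nsmul ℂ, deg]
  push_cast
  module

theorem bracket_t_homog {d : ℤ} {f : K} (h : f ∈ homog d) :
    bracket (mono 1 ∅) f = (d : ℂ) • f := by
  refine supported_induction (p := fun f => bracket (mono 1 ∅) f = (d : ℂ) • f)
    (by simpa using bracket_smul_right 0 (mono 1 ∅) 0)
    (fun f g hf hg => by rw [bracket_add_right, hf, hg, smul_add])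
    (fun c f hf => by rw [bracket_smul_right, hf, smul_comm]) (fun k I hI => ?_) h
  have hI : deg (k, I) = d := hI
  rw [bracket_t, hI]

section Fibre

variable {F : Type*} [AddCommGroup F] [Module ℂ F] {ρ : gNonneg →ₗ[ℂ] Module.End ℂ F}

theorem deg_t : deg (1, ∅) = 0 := by simp [deg]

/-- The grading element acting on `F`. -/
def gradingOp (ρ : gNonneg →ₗ[ℂ] Module.End ℂ F) : Module.End ℂ F :=
  ρ ⟨mono 1 ∅, mono_mem_gNonneg deg_t⟩

/-- As ad t is the degree, an element of degree d shifts the eigenvalues of t on F by d. -/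
theorem gradingOp_apply (hρ : IsRep ρ) {k : ℕ} {I : Finset (Fin 6)} (h : 0 ≤ deg (k, I)) {μ : ℂ}
    {v : F} (hv : v ∈ Module.End.eigenspace (gradingOp ρ) μ) :
    ρ ⟨gElt k I, gElt_mem_gNonneg h⟩ v ∈
      Module.End.eigenspace (gradingOp ρ) (μ + deg (k, I)) := by
  have h1 := hρ 0 I.card ⟨mono 1 ∅, mono_mem_gNonneg deg_t⟩ ⟨gElt k I, gElt_mem_gNonneg h⟩
    ((deg (k, I) : ℂ) • ⟨gElt k I, gElt_mem_gNonneg h⟩) (mono_mem_ofParity 1 ∅)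
    (gElt_mem_ofParity k I) (bracket_t_homog (gElt_mem_homog k I)).symm
  rw [zero_mul, pow_zero, one_smul, map_smul] at h1
  have h2 := LinearMap.congr_fun h1 v
  rw [Module.End.mem_eigenspace_iff] at hv ⊢
  rw [LinearMap.smul_apply, LinearMap.sub_apply, Module.End.mul_apply, Module.End.mul_apply] at h2
  change _ = gradingOp ρ _ - ρ _ (gradingOp ρ v) at h2
  rw [hv, map_smul] at h2
  rw [add_smul, h2]; abel

/-- In a finite-dimensional irreducible `g_{≥ 0}`-module, `g_{> 0}` acts by zero. -/
theorem rho_eq_zero_of_pos [FiniteDimensional ℂ F] (hρ : IsRep ρ) (hirr : IsIrred ρ)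
    {k : ℕ} {I : Finset (Fin 6)} (h : 0 < deg (k, I)) :
    ρ ⟨gElt k I, gElt_mem_gNonneg h.le⟩ = 0 := by
  have := hirr.1
  obtain ⟨μ₀, hμ₀⟩ := Module.End.exists_eigenvalue (gradingOp ρ)
  -- With the real part of μ maximal, no μ + d with d > 0 is an eigenvalue. The eigenspace of μ is
  -- then stable under `gNonneg`, so it is all of F, and positive degrees map it to 0.
  obtain ⟨μ, hμ, hmax⟩ := Set.exists_max_image {μ | (gradingOp ρ).HasEigenvalue μ} Complex.re
    (gradingOp ρ).finite_hasEigenvalue ⟨μ₀, hμ₀⟩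
  have hbot : ∀ d : ℤ, 0 < d → Module.End.eigenspace (gradingOp ρ) (μ + d) = ⊥ := fun d hd => by
    by_contra hne
    have := hmax (μ + d) hne
    rw [Complex.add_re, Complex.intCast_re] at this
    have : (0 : ℝ) < d := by exact_mod_cast hd
    linarith
  have htop : Module.End.eigenspace (gradingOp ρ) μ = ⊤ := by
    refine (hirr.2 _ fun x v hv => ?_).resolve_left hμ
    obtain ⟨x, hx⟩ := x
    -- The membership proof goes inside the predicate so that an induction over elements of `K`
    -- applies to ρ, which lives on a subtype. The same device recurs below.
    suffices ∃ hx : x ∈ gNonneg, ρ ⟨x, hx⟩ v ∈ Module.End.eigenspace (gradingOp ρ) μ from this.2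
    refine gNonneg_induction (p := fun x => ∃ hx : x ∈ gNonneg, ρ ⟨x, hx⟩ v ∈
      Module.End.eigenspace (gradingOp ρ) μ) ⟨zero_mem _, ?_⟩ ?_ ?_ (fun k I hd => ?_) hx
    · have : (⟨0, zero_mem _⟩ : gNonneg) = 0 := rfl
      rw [this, map_zero]; exact zero_mem _
    · rintro f g ⟨hf, hf'⟩ ⟨hg, hg'⟩
      refine ⟨add_mem hf hg, ?_⟩
      have : (⟨f + g, add_mem hf hg⟩ : gNonneg) = ⟨f, hf⟩ + ⟨g, hg⟩ := rfl
      rw [this, map_add]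
      exact add_mem hf' hg'
    · rintro c f ⟨hf, hf'⟩
      refine ⟨Submodule.smul_mem _ c hf, ?_⟩
      have : (⟨c • f, Submodule.smul_mem _ c hf⟩ : gNonneg) = c • ⟨f, hf⟩ := rfl
      rw [this, map_smul]
      exact Submodule.smul_mem _ c hf'
    · refine ⟨gElt_mem_gNonneg hd, ?_⟩
      have := gradingOp_apply hρ hd hv
      rcases hd.eq_or_lt with h0 | hpos
      · rwa [← h0, Int.cast_zero, add_zero] at this
      · rw [hbot _ hpos, Submodule.mem_bot] at this
        rw [this]; exact zero_mem _
  ext v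
  have hv : v ∈ Module.End.eigenspace (gradingOp ρ) μ := htop ▸ Submodule.mem_top
  have := gradingOp_apply hρ h.le hv
  rwa [hbot _ h, Submodule.mem_bot] at this

open Classical in
/-- The projection to degree zero, which lies in `g`. -/
def projZero : K →ₗ[ℂ] gNonneg :=
  Finsupp.linearCombination ℂ fun x =>
    if h : deg x = 0 then ⟨mono x.1 x.2, mono_mem_gNonneg h⟩ else 0

theorem projZero_mono_of_eq {k : ℕ} {I : Finset (Fin 6)} (h : deg (k, I) = 0) :
    projZero (mono k I) = ⟨mono k I, mono_mem_gNonneg h⟩ := by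
  simp [projZero, mono, h]

theorem projZero_mono_of_ne {k : ℕ} {I : Finset (Fin 6)} (h : deg (k, I) ≠ 0) :
    projZero (mono k I) = 0 := by
  simp [projZero, mono, h]

theorem projZero_of_homog {f : K} (h : f ∈ homog 0) :
    projZero f = ⟨f, mem_gNonneg_of_homog h⟩ := by
  refine Subtype.ext ?_
  refine supported_induction (p := fun f => (projZero f : K) = f) (by simp)
    (fun f g hf hg => by rw [map_add, Submodule.coe_add, hf, hg])
    (fun c f hf => by rw [map_smul, Submodule.coe_smul, hf]) (fun k I hI => ?_) h
  rw [projZero_mono_of_eq hI]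

theorem projZero_of_homog_ne {f : K} {d : ℤ} (hd : d ≠ 0) (h : f ∈ homog d) :
    projZero f = 0 := by
  refine supported_induction (p := fun f => projZero f = 0) (by simp)
    (fun f g hf hg => by rw [map_add, hf, hg, add_zero])
    (fun c f hf => by rw [map_smul, hf, smul_zero]) (fun k I hI => ?_) h
  have hI : deg (k, I) = d := hI
  exact projZero_mono_of_ne (hI ▸ hd)

/-- Since `g` contains the whole degree zero part of K(1,6)₊, F extends to all nonnegative degrees
of K(1,6)₊, with positive degrees acting by zero. -/
theorem isDegreeZeroRep (hρ : IsRep ρ) : IsDegreeZeroRep (ρ ∘ₗ projZero) where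
  zero k I h := by rw [LinearMap.comp_apply, projZero_mono_of_ne h, map_zero]
  bracket k I l J h h' := by
    simp only [LinearMap.comp_apply]
    have hb := bracket_mem_homog (mono_mem_homog (k := k) (I := I) rfl)
      (mono_mem_homog (k := l) (I := J) rfl)
    by_cases h0 : deg (k, I) = 0
    · by_cases h1 : deg (l, J) = 0
      · rw [h0, h1, add_zero] at hb
        rw [projZero_of_homog hb, projZero_mono_of_eq h0, projZero_mono_of_eq h1]
        exact hρ _ _ _ _ _ (mono_mem_ofParity k I) (mono_mem_ofParity l J) rfl
      · rw [projZero_of_homog_ne (by omega) hb, projZero_mono_of_ne h1]; simp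
    · rw [projZero_of_homog_ne (by omega) hb, projZero_mono_of_ne h0]; simp

/-- The extension factors through degree zero, so it restricts to ρ only because ρ kills positive
degrees. This is where finite dimension and irreducibility enter. -/
theorem indAct_gNonneg [FiniteDimensional ℂ F] (hρ : IsRep ρ) (hirr : IsIrred ρ) (x : gNonneg)
    (v : F) : indAct (ρ ∘ₗ projZero) x (sing 0 ∅ v) = sing 0 ∅ (ρ x v) := by
  obtain ⟨x, hx⟩ := x
  rw [indAct_vac_of_nonneg (isDegreeZeroRep hρ) hx.2]
  suffices ∃ hx : x ∈ gNonneg, (ρ ∘ₗ projZero) x = ρ ⟨x, hx⟩ by rw [this.2]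
  refine gNonneg_induction (p := fun x => ∃ hx : x ∈ gNonneg, (ρ ∘ₗ projZero) x = ρ ⟨x, hx⟩)
    ⟨zero_mem _, ?_⟩ ?_ ?_ (fun k I hd => ?_) hx
  · have : (⟨0, zero_mem _⟩ : gNonneg) = 0 := rfl
    rw [this, map_zero, map_zero]
  · rintro f g ⟨hf, hf'⟩ ⟨hg, hg'⟩
    refine ⟨add_mem hf hg, ?_⟩
    have : (⟨f + g, add_mem hf hg⟩ : gNonneg) = ⟨f, hf⟩ + ⟨g, hg⟩ := rfl
    rw [this, map_add, map_add, hf', hg']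
  · rintro c f ⟨hf, hf'⟩
    refine ⟨Submodule.smul_mem _ c hf, ?_⟩
    have : (⟨c • f, Submodule.smul_mem _ c hf⟩ : gNonneg) = c • ⟨f, hf⟩ := rfl
    rw [this, map_smul, map_smul, hf']
  · refine ⟨gElt_mem_gNonneg hd, ?_⟩
    rcases hd.eq_or_lt with h0 | hpos
    · rw [LinearMap.comp_apply, projZero_of_homog (h0.symm ▸ gElt_mem_homog k I)]
    · rw [rho_eq_zero_of_pos hρ hirr hpos, LinearMap.comp_apply,
        projZero_of_homog_ne hpos.ne' (gElt_mem_homog k I), map_zero]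

end Fibre

/-! ### The enveloping algebra -/

theorem ι_mul_ι {p q : ℕ} {x y z : g} (hx : (x : K) ∈ ofParity p) (hy : (y : K) ∈ ofParity q)
    (hz : (z : K) = bracket x y) : ι x * ι y = (-1 : ℂ) ^ (p * q) • (ι y * ι x) + ι z := by
  have h : mkU _ = mkU _ :=
    (RingCon.eq (c := ringConGen URel)).mpr (RingConGen.Rel.of _ _ (URel.rel p q x y z hx hy hz))
  rw [map_mul, map_add, map_smul, map_mul] at h
  exact h

theorem one_mem_g : mono 0 ∅ ∈ g := mono_zero_mem _ (by simp)

theorem xi_mem_g (i : Fin 6) : mono 0 {i} ∈ g := mono_zero_mem _ (by simp)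

/-- Together with `q_mem_g` this moves η_i past any element of `g` without leaving `g`. The
construction uses no further stability of `g` under the bracket. -/
theorem η_mul_ι (i : Fin 6) {p : ℕ} {x : K} (hx : x ∈ g) (hp : x ∈ ofParity p) :
    η i * ι ⟨x, hx⟩ = (-1 : ℂ) ^ p • (ι ⟨x, hx⟩ * η i) + ι ⟨funRep.q i x, q_mem_g i hx⟩ := by
  have := ι_mul_ι (p := 1) (q := p) (x := ⟨mono 0 {i}, xi_mem_g i⟩) (y := ⟨x, hx⟩)
    (z := ⟨funRep.q i x, q_mem_g i hx⟩) (mono_mem_ofParity 0 {i}) hp (bracket_xi i x).symm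
  rw [one_mul] at this
  exact this

theorem ι_one : ι ⟨mono 0 ∅, one_mem_g⟩ = (-2 : ℂ) • Θ := by
  rw [Θ, smul_smul]; norm_num

theorem funRep_q_xi (i j : Fin 6) :
    funRep.q i (mono 0 {j}) = if i = j then -mono 0 ∅ else 0 := by
  change wedge ℂ i (down ℂ _) - contr ℂ i _ = _
  rw [down_mono, mono_singleton, contr_wedge_apply, contr_mono_empty]
  split_ifs <;> simp

theorem η_mul_η_of_ne {i j : Fin 6} (h : i ≠ j) : η i * η j = -(η j * η i) := by
  have := η_mul_ι i (xi_mem_g j) (mono_mem_ofParity 0 {j})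
  have hz : (⟨funRep.q i (mono 0 {j}), q_mem_g i (xi_mem_g j)⟩ : g) = 0 :=
    Subtype.ext ((funRep_q_xi i j).trans (if_neg h))
  rw [hz, map_zero, Finset.card_singleton, pow_one, neg_one_smul, add_zero] at this
  exact this

theorem η_mul_self (i : Fin 6) : η i * η i = Θ := by
  have := η_mul_ι i (xi_mem_g i) (mono_mem_ofParity 0 {i})
  have hz : (⟨funRep.q i (mono 0 {i}), q_mem_g i (xi_mem_g i)⟩ : g) =
      (-1 : ℂ) • ⟨mono 0 ∅, one_mem_g⟩ :=
    Subtype.ext (((funRep_q_xi i i).trans (if_pos rfl)).trans (neg_one_smul ℂ (mono 0 ∅)).symm)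
  rw [hz, map_smul, Finset.card_singleton, pow_one, neg_one_smul, ι_one, smul_smul, neg_one_mul,
    neg_neg] at this
  change η i * η i = -(η i * η i) + _ at this
  have h2 : (2 : ℂ) • (η i * η i) = (2 : ℂ) • Θ := by
    rw [two_smul]; nth_rewrite 2 [this]; abel
  exact smul_right_injective _ (two_ne_zero' ℂ) h2

theorem η_mul_Θ (i : Fin 6) : η i * Θ = Θ * η i := by
  rw [← η_mul_self i, mul_assoc]

theorem η_mul_Θ_pow (i : Fin 6) (k : ℕ) : η i * Θ ^ k = Θ ^ k * η i :=
  ((show Commute (η i) Θ from η_mul_Θ i).pow_right k).eq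

theorem ηs_insert {a : Fin 6} {I : Finset (Fin 6)} (h : ∀ b ∈ I, a < b) :
    ηs (insert a I) = η a * ηs I := by
  have ha : a ∉ I := fun h' => lt_irrefl _ (h a h')
  rw [ηs, ηs, Finset.sort_insert (· ≤ ·) (fun b hb => (h b hb).le) ha, List.map_cons,
    List.prod_cons]

/-! ### The Poincaré–Birkhoff–Witt basis of Ind(F) -/

section Verma

variable {F : Type*} [AddCommGroup F] [Module ℂ F] {ρ : gNonneg →ₗ[ℂ] Module.End ℂ F}

/-- The class of `u ⊗ v` in `Ind(F)`. -/
def indMk (ρ : gNonneg →ₗ[ℂ] Module.End ℂ F) (u : U) (v : F) : Ind ρ :=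
  (indRel ρ).mkQ (u ⊗ₜ[ℂ] v)

theorem smul_indMk (u u' : U) (v : F) : u • indMk ρ u' v = indMk ρ (u * u') v := by
  rw [indMk, ← map_smul]; rfl

theorem pbw_sing (k : ℕ) (I : Finset (Fin 6)) (v : F) :
    pbw ρ (sing k I v) = indMk ρ (Θ ^ k * ηs I) v := by
  simp [pbw, indMk]

theorem pbw_up (w : Coord F) : pbw ρ (up F w) = Θ • pbw ρ w := by
  induction w using Finsupp.induction_linear with
  | zero => simp
  | add f g hf hg => rw [map_add, map_add, hf, hg, map_add, smul_add]
  | single x v =>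
    obtain ⟨k, I⟩ := x
    rw [up_sing, pbw_sing, pbw_sing, smul_indMk, ← mul_assoc, pow_succ']

theorem pbw_sing_insert {a : Fin 6} {I : Finset (Fin 6)} (h : ∀ b ∈ I, a < b) (k : ℕ) (v : F) :
    pbw ρ (sing k (insert a I) v) = η a • pbw ρ (sing k I v) := by
  rw [pbw_sing, pbw_sing, smul_indMk, ηs_insert h, ← mul_assoc, ← mul_assoc, η_mul_Θ_pow]

theorem indRep_q_sing_of_lt {a : Fin 6} {I : Finset (Fin 6)} (h : ∀ b ∈ I, a < b) (k : ℕ) (v : F) :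
    (indRep F).q a (sing k I v) = sing k (insert a I) v := by
  have ha : a ∉ I := fun h' => lt_irrefl _ (h a h')
  rw [indRep_q_apply, up_sing, contr_sing_of_notMem ha, wedge_sing, sgn_of_lt h, zero_add,
    Int.cast_one, one_smul]

theorem indRep_q_q_self (i : Fin 6) (w : Coord F) : (indRep F).q i ((indRep F).q i w) = up F w := by
  have e := LinearMap.congr_fun ((indRep F).q_q_self i) w
  rwa [Module.End.mul_apply, LinearMap.neg_apply, indRep_P_apply, neg_neg] at e

theorem indRep_q_q_of_ne {i j : Fin 6} (h : i ≠ j) (w : Coord F) :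
    (indRep F).q i ((indRep F).q j w) = -(indRep F).q j ((indRep F).q i w) := by
  have e := LinearMap.congr_fun ((indRep F).q_q i j) w
  rw [if_neg h, zero_mul, sub_zero] at e
  exact e

/-- `η_i` acts on `Ind(F)` by `q i`. -/
theorem pbw_q (i : Fin 6) (w : Coord F) : pbw ρ ((indRep F).q i w) = η i • pbw ρ w := by
  induction w using Finsupp.induction_linear with
  | zero => simp
  | add f g hf hg => rw [map_add, map_add, hf, hg, map_add, smul_add]
  | single x v =>
    obtain ⟨k, I⟩ := x
    induction I using Finset.induction_on_min generalizing i with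
    | empty =>
      rw [indRep_q_sing_of_lt (by simp), pbw_sing_insert (by simp)]
    | insert a I ha ih =>
      rcases lt_trichotomy i a with h | h | h
      · have : ∀ b ∈ insert a I, i < b := by
          intro b hb
          rcases Finset.mem_insert.mp hb with rfl | hb
          exacts [h, h.trans (ha b hb)]
        rw [indRep_q_sing_of_lt this, pbw_sing_insert this]
      · subst h
        change pbw ρ ((indRep F).q i (sing k (insert i I) v)) =
          η i • pbw ρ (sing k (insert i I) v)
        rw [← indRep_q_sing_of_lt ha, indRep_q_q_self, pbw_up, indRep_q_sing_of_lt ha,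
          pbw_sing_insert ha, smul_smul, η_mul_self]
      -- All indices occurring in η_i η_I exceed a, so η_a is prepended without sign. Then η_i η_a =
      -- −η_a η_i reduces the case to the smaller set.
      · have key : pbw ρ ((indRep F).q a ((indRep F).q i (sing k I v))) =
            η a • pbw ρ ((indRep F).q i (sing k I v)) := by
          have hlt : ∀ l {J} (_ : ∀ b ∈ J, a < b), pbw ρ ((indRep F).q a (sing l J v)) =
              η a • pbw ρ (sing l J v) := fun l J hJ => by
            rw [indRep_q_sing_of_lt hJ, pbw_sing_insert hJ]
          rw [indRep_q_apply i, up_sing]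
          by_cases hi : i ∈ I
          · obtain ⟨J, hJ, rfl⟩ : ∃ J', i ∉ J' ∧ I = insert i J' :=
              ⟨I.erase i, by simp, by simp [hi]⟩
            rw [wedge_sing_of_mem hi, contr_sing_insert hJ, add_zero, map_smul, map_smul, map_smul,
              hlt _ fun b hb => ha b (by simp [hb]), smul_comm]
          · have : ∀ b ∈ insert i I, a < b := by
              intro b hb
              rcases Finset.mem_insert.mp hb with rfl | hb
              exacts [h, ha b hb]
            rw [wedge_sing, contr_sing_of_notMem hi, zero_add, map_smul, map_smul, map_smul,
              hlt _ this, smul_comm]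
        have ih' : pbw ρ ((indRep F).q i (sing k I v)) = η i • pbw ρ (sing k I v) := ih i
        change pbw ρ ((indRep F).q i (sing k (insert a I) v)) =
          η i • pbw ρ (sing k (insert a I) v)
        rw [← indRep_q_sing_of_lt ha, indRep_q_q_of_ne h.ne', map_neg, key, ih',
          indRep_q_sing_of_lt ha, pbw_sing_insert ha, smul_smul, smul_smul, η_mul_η_of_ne h.ne',
          neg_smul]

theorem indMk_rho (x : gNonneg) (v : F) : indMk ρ (ι ⟨x, x.2.1⟩) v = indMk ρ 1 (ρ x v) := by
  rw [indMk, indMk, Submodule.mkQ_apply, Submodule.mkQ_apply, Submodule.Quotient.eq]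
  exact Submodule.subset_span ⟨x, v, rfl⟩

theorem pbw_vac (v : F) : pbw ρ (sing 0 ∅ v) = indMk ρ 1 v := by
  rw [pbw_sing]; simp [ηs]

theorem indAct_apply_q (π : K →ₗ[ℂ] Module.End ℂ F) (i : Fin 6) {p : ℕ} {f : K}
    (hf : f ∈ ofParity p) (w : Coord F) : indAct π f ((indRep F).q i w) =
      (-1 : ℂ) ^ p • ((indRep F).q i (indAct π f w) - indAct π (funRep.q i f) w) := by
  have h1 := LinearMap.congr_fun (indAct_q (π := π) i f) w
  rw [mem_ofParity_iff.mp hf, map_smul] at h1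
  simp only [Module.End.mul_apply, LinearMap.add_apply, LinearMap.smul_apply] at h1
  rw [h1, add_sub_cancel_left, smul_smul, ← mul_pow]
  simp

/-- The representation of `U(g)` in the coordinates given by `pbw`. -/
def uAct (hρ : IsRep ρ) : U →ₐ[ℂ] Module.End ℂ (Coord F) :=
  RingCon.liftₐ (ringConGen URel)
    (TensorAlgebra.lift ℂ (indAct (ρ ∘ₗ projZero) ∘ₗ g.subtype)) <| by
      rw [RingCon.ringConGen_le]
      rintro _ _ ⟨p, q, x, y, z, hx, hy, hz⟩
      have := indAct_bracket (isDegreeZeroRep hρ) hx hy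
      rw [← hz, sub_eq_iff_eq_add] at this
      change TensorAlgebra.lift ℂ _ _ = TensorAlgebra.lift ℂ _ _
      rw [map_add, map_smul, map_mul, map_mul, TensorAlgebra.lift_ι_apply,
        TensorAlgebra.lift_ι_apply, TensorAlgebra.lift_ι_apply]
      simp only [LinearMap.comp_apply, Submodule.subtype_apply]
      rw [this, add_comm]

theorem uAct_mkU (hρ : IsRep ρ) (a : TensorAlgebra ℂ g) : uAct hρ (mkU a) =
    TensorAlgebra.lift ℂ (indAct (ρ ∘ₗ projZero) ∘ₗ g.subtype) a := rfl

theorem uAct_ι (hρ : IsRep ρ) (x : g) : uAct hρ (ι x) = indAct (ρ ∘ₗ projZero) x := by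
  change uAct hρ (mkU (TensorAlgebra.ι ℂ x)) = _
  rw [uAct_mkU, TensorAlgebra.lift_ι_apply]; rfl

theorem uAct_η (hρ : IsRep ρ) (i : Fin 6) : uAct hρ (η i) = (indRep F).q i := by
  rw [η, uAct_ι, indAct_xi]

theorem uAct_Θ (hρ : IsRep ρ) (w : Coord F) : uAct hρ Θ w = up F w := by
  rw [Θ, map_smul, uAct_ι, indAct_one, smul_smul, LinearMap.smul_apply, indRep_P_apply]
  norm_num

theorem uAct_monomial (hρ : IsRep ρ) (k : ℕ) (I : Finset (Fin 6)) (v : F) :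
    uAct hρ (Θ ^ k * ηs I) (sing 0 ∅ v) = sing k I v := by
  have h0 : uAct hρ (ηs I) (sing 0 ∅ v) = sing 0 I v := by
    induction I using Finset.induction_on_min with
    | empty => simp [ηs]
    | insert a I ha ih =>
      rw [ηs_insert ha, map_mul, Module.End.mul_apply, ih, uAct_η, indRep_q_sing_of_lt ha]
  rw [map_mul, Module.End.mul_apply, h0]
  induction k with
  | zero => simp
  | succ k ih => rw [pow_succ', map_mul, Module.End.mul_apply, ih, uAct_Θ, up_sing]

/-- The map `u ⊗ v ↦ u.v` to the coordinate module. -/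
def tensorAct (hρ : IsRep ρ) : U ⊗[ℂ] F →ₗ[ℂ] Coord F :=
  TensorProduct.lift
    ((LinearMap.lcomp ℂ (Coord F) (Finsupp.lsingle (0, ∅) : F →ₗ[ℂ] Coord F)) ∘ₗ
      (uAct hρ).toLinearMap)

theorem tensorAct_tmul (hρ : IsRep ρ) (u : U) (v : F) :
    tensorAct hρ (u ⊗ₜ v) = uAct hρ u (sing 0 ∅ v) := rfl

theorem tensorAct_smul (hρ : IsRep ρ) (u : U) (z : U ⊗[ℂ] F) :
    tensorAct hρ (u • z) = uAct hρ u (tensorAct hρ z) := by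
  induction z using TensorProduct.induction_on with
  | zero => simp
  | add x y hx hy => rw [smul_add, map_add, map_add, map_add, hx, hy]
  | tmul u' v =>
    rw [TensorProduct.smul_tmul', tensorAct_tmul, tensorAct_tmul, smul_eq_mul, map_mul,
      Module.End.mul_apply]

variable [FiniteDimensional ℂ F]

/-- In negative degree the generators act as −2Θ and η_i on both sides. In nonnegative degree the
defining relations of Ind(F) match `indAct_gNonneg`. -/
theorem pbw_indAct_vac (hρ : IsRep ρ) (hirr : IsIrred ρ) (x : g) (v : F) :
    pbw ρ (indAct (ρ ∘ₗ projZero) x (sing 0 ∅ v)) = ι x • pbw ρ (sing 0 ∅ v) := by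
  obtain ⟨x, hx⟩ := x
  suffices ∃ hx : x ∈ g, pbw ρ (indAct (ρ ∘ₗ projZero) x (sing 0 ∅ v)) =
    ι ⟨x, hx⟩ • pbw ρ (sing 0 ∅ v) from this.2
  refine g_induction (S := Set.univ) (p := fun x => ∃ hx : x ∈ g,
    pbw ρ (indAct (ρ ∘ₗ projZero) x (sing 0 ∅ v)) = ι ⟨x, hx⟩ • pbw ρ (sing 0 ∅ v))
    ⟨zero_mem _, ?_⟩ ?_ ?_ (fun k I _ => ?_) hx (fun _ _ => trivial)
  · have : (⟨0, zero_mem _⟩ : g) = 0 := rfl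
    rw [this, map_zero, map_zero, zero_smul]; exact map_zero _
  · rintro f g ⟨hf, hf'⟩ ⟨hg, hg'⟩
    refine ⟨add_mem hf hg, ?_⟩
    have : (⟨f + g, add_mem hf hg⟩ : CK6.g) = ⟨f, hf⟩ + ⟨g, hg⟩ := rfl
    rw [this, map_add, map_add, add_smul, ← hf', ← hg', LinearMap.add_apply, map_add]
  · rintro c f ⟨hf, hf'⟩
    refine ⟨Submodule.smul_mem _ c hf, ?_⟩
    have : (⟨c • f, Submodule.smul_mem _ c hf⟩ : CK6.g) = c • ⟨f, hf⟩ := rfl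
    rw [this, map_smul, map_smul, smul_assoc, ← hf', LinearMap.smul_apply, map_smul]
  · refine ⟨gElt_mem k I, ?_⟩
    by_cases hd : deg (k, I) < 0
    · obtain ⟨rfl, rfl | ⟨i, rfl⟩⟩ := deg_neg_cases hd
      · have e : gElt 0 ∅ = mono 0 ∅ := gElt_of_lt (by simp)
        have e' : ι ⟨gElt 0 ∅, gElt_mem 0 ∅⟩ = (-2 : ℂ) • Θ := by
          rw [← ι_one]; congr
        rw [e', e, indAct_one, LinearMap.smul_apply, indRep_P_apply, map_smul, map_neg, pbw_up,
          smul_assoc, smul_neg, neg_smul]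
      · have e : gElt 0 {i} = mono 0 {i} := gElt_of_lt (by simp)
        have e' : ι ⟨gElt 0 {i}, gElt_mem 0 {i}⟩ = η i := by
          rw [η]; congr
        rw [e', e, indAct_xi, pbw_q]
    · rw [not_lt] at hd
      have h1 := indAct_gNonneg hρ hirr ⟨gElt k I, gElt_mem_gNonneg hd⟩ v
      have h2 := indMk_rho (ρ := ρ) ⟨gElt k I, gElt_mem_gNonneg hd⟩ v
      rw [h1, pbw_vac, pbw_vac, smul_indMk, mul_one, ← h2]

/-- The action of `g` on `Ind(F)` in the coordinates given by `pbw`. -/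
theorem pbw_indAct (hρ : IsRep ρ) (hirr : IsIrred ρ) (x : g) (w : Coord F) :
    pbw ρ (indAct (ρ ∘ₗ projZero) x w) = ι x • pbw ρ w := by
  let S : Submodule ℂ (Coord F) :=
    { carrier := {w | ∀ x : g, pbw ρ (indAct (ρ ∘ₗ projZero) x w) = ι x • pbw ρ w}
      zero_mem' := by intro x; simp
      add_mem' := by intro w w' h h' x; rw [map_add, map_add, h, h', map_add, smul_add]
      smul_mem' := by
        intro c w h x
        rw [map_smul, map_smul, h, map_smul, smul_comm] }
  have hS : S = ⊤ := by
    refine eq_top_of_q_mem (fun i w hw x => ?_) fun v x => pbw_indAct_vac hρ hirr x v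
    obtain ⟨x, hx⟩ := x
    suffices ∃ hx : x ∈ g, pbw ρ (indAct (ρ ∘ₗ projZero) x ((indRep F).q i w)) =
      ι ⟨x, hx⟩ • pbw ρ ((indRep F).q i w) from this.2
    refine g_induction (S := Set.univ) (p := fun x => ∃ hx : x ∈ g,
      pbw ρ (indAct (ρ ∘ₗ projZero) x ((indRep F).q i w)) =
        ι ⟨x, hx⟩ • pbw ρ ((indRep F).q i w))
      ⟨zero_mem _, ?_⟩ ?_ ?_ (fun k I _ => ?_) hx (fun _ _ => trivial)
    · have : (⟨0, zero_mem _⟩ : g) = 0 := rfl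
      rw [this, map_zero, map_zero, zero_smul]; exact map_zero _
    · rintro f g ⟨hf, hf'⟩ ⟨hg, hg'⟩
      refine ⟨add_mem hf hg, ?_⟩
      have : (⟨f + g, add_mem hf hg⟩ : CK6.g) = ⟨f, hf⟩ + ⟨g, hg⟩ := rfl
      rw [this, map_add, map_add, add_smul, ← hf', ← hg', LinearMap.add_apply, map_add]
    · rintro c f ⟨hf, hf'⟩
      refine ⟨Submodule.smul_mem _ c hf, ?_⟩
      have : (⟨c • f, Submodule.smul_mem _ c hf⟩ : CK6.g) = c • ⟨f, hf⟩ := rfl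
      rw [this, map_smul, map_smul, smul_assoc, ← hf', LinearMap.smul_apply, map_smul]
    · refine ⟨gElt_mem k I, ?_⟩
      have h1 := hw ⟨gElt k I, gElt_mem k I⟩
      -- Moving x past η_i produces the bracket of ξ_i with x, so the hypothesis is needed at this
      -- element as well; it lies in `g`.
      have h2 := hw ⟨_, q_mem_g i (gElt_mem k I)⟩
      have h3 := η_mul_ι i (gElt_mem k I) (gElt_mem_ofParity k I)
      rw [indAct_apply_q _ i (gElt_mem_ofParity k I), map_smul, map_sub, pbw_q, pbw_q, h1, h2,
        smul_smul, smul_smul, h3, add_smul, add_sub_cancel_right, smul_assoc, smul_smul, ← mul_pow]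
      simp
  have : w ∈ S := hS ▸ Submodule.mem_top
  exact this x

theorem tensorAct_indRel (hρ : IsRep ρ) (hirr : IsIrred ρ) {z : U ⊗[ℂ] F} (hz : z ∈ indRel ρ) :
    tensorAct hρ z = 0 := by
  induction hz using Submodule.span_induction with
  | zero => exact map_zero _
  | add x y _ _ hx hy => rw [map_add, hx, hy, add_zero]
  | smul u z _ hz => rw [tensorAct_smul, hz, map_zero]
  | mem z hz =>
    obtain ⟨x, v, rfl⟩ := hz
    rw [map_sub, tensorAct_tmul, tensorAct_tmul, uAct_ι, map_one, Module.End.one_apply,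
      sub_eq_zero]
    exact indAct_gNonneg hρ hirr x v

/-- `tensorAct` kills the relations, so it descends to Ind(F). There it inverts `pbw` on the left,
because Θ^k η_I applied to the vacuum is the corresponding basis vector. -/
theorem pbw_injective (hρ : IsRep ρ) (hirr : IsIrred ρ) : Function.Injective (pbw ρ) := by
  let L : Coord F →ₗ[ℂ] U ⊗[ℂ] F :=
    Finsupp.lsum ℂ fun x => TensorProduct.mk ℂ U F (Θ ^ x.1 * ηs x.2)
  have hL : ∀ w, pbw ρ w = (indRel ρ).mkQ (L w) := fun w => by
    induction w using Finsupp.induction_linear with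
    | zero => rw [map_zero, map_zero, map_zero]
    | add f g hf hg => rw [map_add, map_add, map_add, hf, hg]
    | single x v =>
      have := pbw_sing (ρ := ρ) x.1 x.2 v
      simpa [L, indMk] using this
  have hT : ∀ w, tensorAct hρ (L w) = w := fun w => by
    induction w using Finsupp.induction_linear with
    | zero => rw [map_zero, map_zero]
    | add f g hf hg => rw [map_add, map_add, hf, hg]
    | single x v =>
      have : L (Finsupp.single x v) = (Θ ^ x.1 * ηs x.2) ⊗ₜ[ℂ] v := by simp [L]
      rw [this, tensorAct_tmul, uAct_monomial]
  rw [injective_iff_map_eq_zero]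
  intro w hw
  rw [hL, Submodule.mkQ_apply, Submodule.Quotient.mk_eq_zero] at hw
  rw [← hT w, tensorAct_indRel hρ hirr hw]

/-- Equivariance makes the image of `pbw` a U(g)-submodule; it contains 1 ⊗ F, which generates
Ind(F). -/
theorem pbw_uAct (hρ : IsRep ρ) (hirr : IsIrred ρ) (u : U) (w : Coord F) :
    pbw ρ (uAct hρ u w) = u • pbw ρ w := by
  obtain ⟨a, rfl⟩ : ∃ a, mkU a = u := RingCon.mkₐ_surjective (α := ℂ) _ u
  induction a using TensorAlgebra.induction generalizing w with
  | algebraMap r =>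
    rw [AlgHom.commutes, AlgHom.commutes, Module.algebraMap_end_apply, map_smul, algebraMap_smul]
  | ι x =>
    change pbw ρ (uAct hρ (ι x) w) = ι x • _
    rw [uAct_ι, pbw_indAct hρ hirr]
  | mul a b ha hb => rw [map_mul, map_mul, Module.End.mul_apply, ha, hb, smul_smul]
  | add a b ha hb => rw [map_add, map_add, LinearMap.add_apply, map_add, ha, hb, add_smul]

theorem pbw_surjective (hρ : IsRep ρ) (hirr : IsIrred ρ) : Function.Surjective (pbw ρ) := by
  intro m
  obtain ⟨z, rfl⟩ := (indRel ρ).mkQ_surjective m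
  induction z using TensorProduct.induction_on with
  | zero => exact ⟨0, by rw [map_zero, map_zero]⟩
  | add x y hx hy =>
    obtain ⟨a, ha⟩ := hx
    obtain ⟨b, hb⟩ := hy
    exact ⟨a + b, by rw [map_add, map_add, ha, hb]⟩
  | tmul u v =>
    refine ⟨uAct hρ u (sing 0 ∅ v), ?_⟩
    rw [pbw_uAct hρ hirr, pbw_vac, smul_indMk, mul_one, indMk]

theorem indAct_eq_zero_of_isSingular (hρ : IsRep ρ) (hirr : IsIrred ρ) {w : Coord F}
    (hw : IsSingular ρ (pbw ρ w)) {x : K} (hx : x ∈ gPos) :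
    indAct (ρ ∘ₗ projZero) x w = 0 := by
  have := hw ⟨x, hx⟩
  refine pbw_injective hρ hirr ?_
  rw [map_zero, ← this]
  exact pbw_indAct hρ hirr ⟨x, hx.1⟩ w

end Verma

/-! ### Singular vectors -/

theorem funRep_D_up (i : Fin 6) (f : K) :
    funRep.D i (up ℂ f) = up ℂ (funRep.D i f) + wedge ℂ i f := by
  have h1 : contr ℂ i (up ℂ f) = up ℂ (contr ℂ i f) := LinearMap.congr_fun (contr_up i) f
  have h2 : down ℂ (up ℂ f) = up ℂ (down ℂ f) + f := LinearMap.congr_fun down_up f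
  have h3 : wedge ℂ i (up ℂ (down ℂ f)) = up ℂ (wedge ℂ i (down ℂ f)) :=
    LinearMap.congr_fun (wedge_up i) (down ℂ f)
  change contr ℂ i _ + wedge ℂ i (down ℂ _) = up ℂ (contr ℂ i _ + wedge ℂ i (down ℂ _)) + _
  rw [h1, h2, map_add, h3, map_add, add_assoc]

theorem wedge_up_apply (i : Fin 6) (f : K) : wedge ℂ i (up ℂ f) = up ℂ (wedge ℂ i f) :=
  LinearMap.congr_fun (wedge_up i) f

theorem parityAut_up (f : K) : parityAut (up ℂ f) = up ℂ (parityAut f) := by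
  have : parityAut ∘ₗ up ℂ = up ℂ ∘ₗ parityAut := K_ext fun k I => by
    have h : up ℂ (mono k I) = mono (k + 1) I := up_sing _ _ _
    simp only [LinearMap.comp_apply, parityAut_mono, map_smul, h]
  exact LinearMap.congr_fun this f

theorem funRep_D_wedge (i j : Fin 6) (f : K) :
    funRep.D i (wedge ℂ j f) = (if i = j then f else 0) - wedge ℂ j (funRep.D i f) := by
  have h1 : down ℂ (wedge ℂ j f) = wedge ℂ j (down ℂ f) :=
    (LinearMap.congr_fun (wedge_down j) f).symm
  have h2 : wedge ℂ i (wedge ℂ j (down ℂ f)) = -wedge ℂ j (wedge ℂ i (down ℂ f)) :=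
    LinearMap.congr_fun (wedge_wedge i j) (down ℂ f)
  change contr ℂ i _ + wedge ℂ i (down ℂ _) = _ - wedge ℂ j (contr ℂ i _ + wedge ℂ i (down ℂ _))
  rw [contr_wedge_apply, h1, h2, map_add]; abel

namespace WeylClifford

variable {N : Type*} [AddCommGroup N] [Module ℂ N] (W : WeylClifford N)
  {C : Module.End ℂ N} {R : Fin 6 → Fin 6 → Module.End ℂ N}

/-- The Euler operator `∑ ξ_i ∂_i`. -/
def E : Module.End ℂ N := ∑ i, W.ξ i * W.b i

/-- The deviation of `W.act` from being linear over `t`. -/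
def actDeriv (C : Module.End ℂ N) (R : Fin 6 → Fin 6 → Module.End ℂ N) (f : K) :
    Module.End ℂ N :=
  ∑ i, W.m (wedge ℂ i (parityAut f)) * W.D i + W.m f * C
    + (1 / 2 : ℂ) • ∑ r, ∑ s, W.m (wedge ℂ r (funRep.D s f) + funRep.D r (wedge ℂ s f)) * R r s

/-- Each D_i passing a factor t leaves a ξ_i behind. At most two D's fall on the symbol, so `act` is
quadratic in the number of factors t: `actDeriv` is its first difference and `actDeriv_up` gives the
constant second one. -/
theorem act_up (f : K) : W.act C R (up ℂ f) = W.t * W.act C R f + W.actDeriv C R f := by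
  have h2 : down ℂ (up ℂ f) = up ℂ (down ℂ f) + f := LinearMap.congr_fun down_up f
  simp only [act_eq, actDeriv, parityAut_up, funRep_D_up, h2, map_add, m_up, add_mul, mul_add,
    Finset.sum_add_distrib, mul_smul_comm, Finset.mul_sum, smul_add, mul_assoc]
  abel

theorem actDeriv_up (f : K) : W.actDeriv C R (up ℂ f) = W.t * W.actDeriv C R f
    + ∑ r, ∑ s, W.m (wedge ℂ r (wedge ℂ s f)) * R r s := by
  -- The two summands ξ_r D_s and D_r ξ_s each contribute one copy of ξ_r ξ_s, which absorbs the
  -- factor 1/2.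
  have h : ∀ X : Module.End ℂ N, X = (1 / 2 : ℂ) • X + (1 / 2 : ℂ) • X := fun X => by
    rw [← add_smul]; norm_num
  rw [h (∑ r, ∑ s, W.m (wedge ℂ r (wedge ℂ s f)) * R r s)]
  simp only [actDeriv, parityAut_up, funRep_D_up, wedge_up_apply, map_add, m_up, add_mul, mul_add,
    Finset.sum_add_distrib, mul_smul_comm, Finset.mul_sum, smul_add, mul_assoc]
  abel

/-- The action of `t ξ_i`. -/
theorem act_t_xi (hR : ∀ r s, R r s = -R s r) (i : Fin 6) :
    W.act C R (mono 1 {i}) = W.t * W.q i + W.ξ i * W.E + W.ξ i * C + ∑ r, W.ξ r * R r i := by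
  have hR0 : ∀ r, R r r = 0 := fun r => by
    have := hR r r
    rwa [eq_neg_iff_add_eq_zero, ← two_smul ℂ, smul_eq_zero, or_iff_right (by norm_num)] at this
  have h1 : mono 1 {i} = up ℂ (mono 0 {i}) := (up_sing _ _ _).symm
  have hm1 : W.m (mono 0 {i}) = W.ξ i := by
    rw [mono_singleton, m_wedge, m_mono_zero_empty, mul_one]
  have h2 : ∀ j, W.m (wedge ℂ j (parityAut (mono 0 {i}))) * W.D j = W.ξ i * (W.ξ j * W.b j) :=
    fun j => by
      rw [parityAut_mono, Finset.card_singleton, pow_one, neg_one_smul, map_neg, map_neg, m_wedge,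
        hm1, W.ξ_ξ j i, neg_neg, D, mul_add, mul_assoc, mul_assoc, ← mul_assoc (W.ξ j) (W.ξ j),
        ξ_sq, zero_mul, mul_zero, add_zero]
  have h3 : ∀ r s, W.m (wedge ℂ r (funRep.D s (mono 0 {i})) + funRep.D r (wedge ℂ s (mono 0 {i})))
      * R r s = (if s = i then W.ξ r * R r s else 0) - if r = i then W.ξ s * R r s else 0 :=
    fun r s => by
      have hw : ∀ j, W.m (wedge ℂ j (mono 0 ∅)) = W.ξ j := fun j => by
        rw [m_wedge, m_mono_zero_empty, mul_one]
      rw [funRep_D_wedge, funRep_D_xi, funRep_D_xi]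
      by_cases hrs : r = s
      · subst hrs; simp [hR0]
      · rw [if_neg hrs]
        split_ifs <;> simp [hw, add_mul, sub_eq_add_neg]
  rw [h1, act_up, act_xi, actDeriv]
  simp only [h2, h3, hm1, Finset.sum_sub_distrib, Finset.sum_ite_eq', Finset.mem_univ, if_true]
  have h4 : ∑ r, ∑ s, (if r = i then W.ξ s * R r s else 0) = -∑ r, W.ξ r * R r i := by
    rw [Finset.sum_comm, ← Finset.sum_neg_distrib]
    simp only [Finset.sum_ite_eq', Finset.mem_univ, if_true]
    exact Finset.sum_congr rfl fun r _ => by rw [hR i r, mul_neg]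
  rw [h4, sub_neg_eq_add, ← two_smul ℂ, smul_smul, ← Finset.mul_sum, E]
  norm_num
  abel

/-- The quadratic operator `∑ ξ_r ξ_s R r s` is determined by the vanishing of the `t ξ_i`. -/
theorem sum_ξ_ξ_apply (hR : ∀ r s, R r s = -R s r) {w : N}
    (h : ∀ i, W.act C R (mono 1 {i}) w = 0) :
    (∑ r, ∑ s, W.ξ r * W.ξ s * R r s) w = -W.t (W.E w) := by
  -- Multiplying by ξ_i kills the terms ξ_i E and ξ_i C and leaves only −b_i of q_i. The sum over i
  -- then has −tE as its differential part.
  have h1 : ∀ i, W.ξ i * W.act C R (mono 1 {i}) =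
      -(W.t * (W.ξ i * W.b i)) - ∑ r, W.ξ r * W.ξ i * R r i := fun i => by
    rw [W.act_t_xi hR, mul_add, mul_add, mul_add, ← mul_assoc, ξ_t, q, mul_assoc, mul_sub,
      ← mul_assoc (W.ξ i), ξ_sq, zero_mul, zero_sub, ← mul_assoc (W.ξ i), ξ_sq, zero_mul,
      ← mul_assoc (W.ξ i), ξ_sq, zero_mul, Finset.mul_sum, mul_neg, add_zero, add_zero,
      sub_eq_add_neg, ← Finset.sum_neg_distrib]
    congr 1
    exact Finset.sum_congr rfl fun r _ => by rw [← mul_assoc, W.ξ_ξ i r, neg_mul]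
  have h2 : (∑ i, W.ξ i * W.act C R (mono 1 {i})) w = 0 := by
    rw [LinearMap.sum_apply]
    exact Finset.sum_eq_zero fun i _ => by rw [Module.End.mul_apply, h, map_zero]
  simp only [h1, Finset.sum_sub_distrib, Finset.sum_neg_distrib, ← Finset.mul_sum] at h2
  rw [Finset.sum_comm] at h2
  rw [LinearMap.sub_apply, LinearMap.neg_apply, sub_eq_zero] at h2
  rw [← h2]; rfl

/-- If `f`, `t f` and `t² f` act by zero, the coefficient of second order in `t` vanishes. -/
theorem m_t_E_apply (hR : ∀ r s, R r s = -R s r) {w : N}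
    (h : ∀ i, W.act C R (mono 1 {i}) w = 0) {f : K} (h0 : W.act C R f w = 0)
    (h1 : W.act C R (up ℂ f) w = 0) (h2 : W.act C R (up ℂ (up ℂ f)) w = 0) :
    W.m f (W.t (W.E w)) = 0 := by
  have e1 : W.actDeriv C R f w = 0 := by
    rwa [act_up, LinearMap.add_apply, Module.End.mul_apply, h0, map_zero, zero_add] at h1
  rw [act_up, LinearMap.add_apply, Module.End.mul_apply, h1, map_zero, zero_add, actDeriv_up,
    LinearMap.add_apply, Module.End.mul_apply, e1, map_zero, zero_add] at h2
  -- The pair ξ_r ξ_s is even, so it commutes past the symbol f.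
  have h3 : ∑ r, ∑ s, W.m (wedge ℂ r (wedge ℂ s f)) * R r s =
      W.m f * ∑ r, ∑ s, W.ξ r * W.ξ s * R r s := by
    rw [Finset.mul_sum]
    refine Finset.sum_congr rfl fun r _ => ?_
    rw [Finset.mul_sum]
    refine Finset.sum_congr rfl fun s _ => ?_
    rw [m_wedge, m_wedge, ξ_m, ← mul_assoc, ξ_m, parityAut_parityAut]
    simp only [mul_assoc]
  rw [h3, Module.End.mul_apply, W.sum_ξ_ξ_apply hR h, map_neg, neg_eq_zero] at h2
  exact h2

end WeylClifford

/-! ### Three-forms with constant coefficients -/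

theorem sum_wedge_contr (k : ℕ) (I : Finset (Fin 6)) :
    ∑ i, wedge ℂ i (contr ℂ i (mono k I)) = (I.card : ℂ) • mono k I := by
  have h : ∀ i, wedge ℂ i (contr ℂ i (mono k I)) = if i ∈ I then mono k I else 0 := fun i => by
    split_ifs with h
    · obtain ⟨J, hJ, rfl⟩ : ∃ J', i ∉ J' ∧ I = insert i J' := ⟨I.erase i, by simp, by simp [h]⟩
      rw [mono, contr_sing_insert hJ, map_smul, wedge_sing, smul_smul, sgn_singleton_sq hJ,
        one_smul]
    · rw [mono, contr_sing_of_notMem h, map_zero]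
  simp only [h]
  rw [Finset.sum_ite_mem, Finset.univ_inter, Finset.sum_const, ← Nat.cast_smul_eq_nsmul ℂ]

/-- The forms of degree `n` with constant coefficients. -/
def constForm (n : ℕ) : Submodule ℂ K := Finsupp.supported ℂ ℂ {x | x.1 = 0 ∧ x.2.card = n}

theorem constForm_induction {n : ℕ} {p : K → Prop} (zero : p 0)
    (add : ∀ f g, p f → p g → p (f + g)) (smul : ∀ (c : ℂ) f, p f → p (c • f))
    (mem : ∀ I : Finset (Fin 6), I.card = n → p (mono 0 I)) {f : K} (hf : f ∈ constForm n) : p f :=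
  supported_induction zero add smul (fun k I h => by obtain ⟨rfl, h⟩ := h; exact mem I h) hf

theorem mono_mem_constForm (I : Finset (Fin 6)) : mono 0 I ∈ constForm I.card :=
  Finsupp.single_mem_supported ℂ 1 ⟨rfl, rfl⟩

theorem contr_mem_constForm (i : Fin 6) {n : ℕ} {f : K} (hf : f ∈ constForm (n + 1)) :
    contr ℂ i f ∈ constForm n := by
  refine constForm_induction (p := fun f => contr ℂ i f ∈ constForm n) (by simp)
    (fun f g hf hg => by rw [map_add]; exact add_mem hf hg)
    (fun c f hf => by rw [map_smul]; exact Submodule.smul_mem _ _ hf) (fun I hI => ?_) hf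
  by_cases h : i ∈ I
  · obtain ⟨J, hJ, rfl⟩ : ∃ J', i ∉ J' ∧ I = insert i J' := ⟨I.erase i, by simp, by simp [h]⟩
    rw [Finset.card_insert_of_notMem hJ, Nat.add_right_cancel_iff] at hI
    rw [mono, contr_sing_insert hJ]
    exact Submodule.smul_mem _ _ (hI ▸ mono_mem_constForm J)
  · rw [mono, contr_sing_of_notMem h]; exact zero_mem _

theorem down_constForm {n : ℕ} {f : K} (hf : f ∈ constForm n) : down ℂ f = 0 := by
  refine constForm_induction (p := fun f => down ℂ f = 0) (by simp)
    (fun f g hf hg => by rw [map_add, hf, hg, add_zero])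
    (fun c f hf => by rw [map_smul, hf, smul_zero]) (fun I hI => ?_) hf
  rw [down_mono]; simp

theorem sum_wedge_contr_constForm {n : ℕ} {f : K} (hf : f ∈ constForm n) :
    ∑ i, wedge ℂ i (contr ℂ i f) = (n : ℂ) • f := by
  refine constForm_induction (p := fun f => ∑ i, wedge ℂ i (contr ℂ i f) = (n : ℂ) • f) (by simp)
    (fun f g hf hg => by simp only [map_add, Finset.sum_add_distrib, hf, hg, smul_add])
    (fun c f hf => by simp only [map_smul, ← Finset.smul_sum, hf, smul_comm c])
    (fun I hI => ?_) hf
  rw [sum_wedge_contr, hI]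

theorem parityAut_constForm {n : ℕ} {f : K} (hf : f ∈ constForm n) :
    parityAut f = (-1 : ℂ) ^ n • f :=
  mem_ofParity_iff.mp (Finsupp.supported_mono (fun x h => by
    change x.2.card % 2 = n % 2
    rw [h.2]) hf)

namespace WeylClifford

variable {N : Type*} [AddCommGroup N] [Module ℂ N] (W : WeylClifford N)
  {C : Module.End ℂ N} {R : Fin 6 → Fin 6 → Module.End ℂ N}

/-- The action of a `3`-form with constant coefficients. -/
theorem act_constForm_three {f : K} (hf : f ∈ constForm 3) :
    W.act C R f = -(W.m f * W.P) - ∑ i, W.m (contr ℂ i f) * W.b i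
      + (1 / 2 : ℂ) • ∑ r, ∑ s, W.m (contr ℂ r (contr ℂ s f)) * R r s := by
  have hD : ∀ {n g}, g ∈ constForm n → ∀ i, funRep.D i g = contr ℂ i g := fun hg i => by
    change contr ℂ i _ + wedge ℂ i (down ℂ _) = _
    rw [down_constForm hg, map_zero, add_zero]
  have hD2 : ∀ r s, funRep.D r (funRep.D s f) = contr ℂ r (contr ℂ s f) := fun r s => by
    rw [hD hf, hD (contr_mem_constForm s hf)]
  have hp : parityAut f = -f := by rw [parityAut_constForm hf]; norm_num
  -- Euler's identity in degree 3: it turns 2 f P into (2 − 3) f P once the D_i are expanded.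
  have hE : ∑ i, W.m (contr ℂ i f) * W.ξ i = (3 : ℂ) • W.m f := by
    have : ∀ i, W.m (contr ℂ i f) * W.ξ i = W.m (wedge ℂ i (contr ℂ i f)) := fun i => by
      rw [m_wedge, ξ_m, parityAut_contr, hp, map_neg, map_neg, map_neg, neg_mul, neg_mul, neg_neg]
    simp only [this, ← map_sum]
    rw [sum_wedge_contr_constForm hf, map_smul]; norm_num
  have hs : ∑ i, W.m (funRep.D i (parityAut f)) * W.D i =
      -∑ i, W.m (contr ℂ i f) * W.b i - (3 : ℂ) • (W.m f * W.P) := by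
    have hDW : ∀ i, W.D i = W.b i + W.ξ i * W.P := fun _ => rfl
    simp only [hp, map_neg, hD hf, hDW, mul_add, ← mul_assoc, neg_mul, Finset.sum_add_distrib,
      Finset.sum_neg_distrib]
    rw [← Finset.sum_mul, hE, smul_mul_assoc]; abel
  rw [act_eq, hs, down_constForm hf]
  simp only [hD2, map_zero, zero_mul]
  module

end WeylClifford

/-! ### Vanishing of the coefficients of a singular vector -/

section Vanishing

variable {F : Type*} [AddCommGroup F] [Module ℂ F]

/-- In the induced module ξ_L acts by contractions, so its output at S is the input at S ∪ L up to a
scalar. That scalar depends on neither the vector nor k. -/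
theorem indRep_m_mono_apply (L S : Finset (Fin 6)) : ∃ ε : ℂ, (Disjoint S L → ε ≠ 0) ∧
    (¬Disjoint S L → ε = 0) ∧
    ∀ (u : Coord F) (k : ℕ), (indRep F).m (mono 0 L) u (k, S) = ε • u (k, S ∪ L) := by
  induction L using Finset.induction_on_min generalizing S with
  | empty => exact ⟨1, by simp, by simp, by simp [WeylClifford.m_mono_zero_empty]⟩
  | insert a L ha ih =>
    have haL : a ∉ L := fun h => lt_irrefl _ (ha a h)
    obtain ⟨ε, h1, h2, h3⟩ := ih (insert a S)
    have e : ∀ (u : Coord F) (k : ℕ), (indRep F).m (mono 0 (insert a L)) u (k, S) =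
        if a ∈ S then 0 else (-(sgn {a} S * ε) : ℂ) • u (k, S ∪ insert a L) := fun u k => by
      rw [← wedge_mono_of_lt ha, WeylClifford.m_wedge, Module.End.mul_apply, indRep_ξ_apply,
        Finsupp.neg_apply, contr_apply]
      split_ifs
      · simp
      · rw [h3, smul_smul, neg_smul, Finset.insert_union, Finset.union_insert]
    by_cases h : a ∈ S
    · exact ⟨0, fun hd => by simp [h] at hd, fun _ => rfl, fun u k => by rw [e, if_pos h, zero_smul]⟩
    · refine ⟨-(sgn {a} S * ε), fun hd => ?_, fun hd => ?_, fun u k => by rw [e, if_neg h]⟩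
      · rw [Finset.disjoint_insert_right] at hd
        refine neg_ne_zero.mpr (mul_ne_zero (sgn_ne_zero (by simpa using h)) (h1 ?_))
        rw [Finset.disjoint_insert_left]
        exact ⟨haL, hd.2⟩
      · rw [h2, mul_zero, neg_zero]
        rw [Finset.disjoint_insert_left]
        rw [Finset.disjoint_insert_right] at hd
        tauto

theorem indRep_m_constForm_apply {n : ℕ} {f : K} (hf : f ∈ constForm n) {u : Coord F} {k : ℕ}
    {S : Finset (Fin 6)} (hu : ∀ J : Finset (Fin 6), J.card = S.card + n → u (k, J) = 0) :
    (indRep F).m f u (k, S) = 0 := by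
  refine constForm_induction (p := fun f => (indRep F).m f u (k, S) = 0) (by simp)
    (fun f g hf hg => by rw [map_add, LinearMap.add_apply, Finsupp.add_apply, hf, hg, add_zero])
    (fun c f hf => by rw [map_smul, LinearMap.smul_apply, Finsupp.smul_apply, hf, smul_zero])
    (fun I hI => ?_) hf
  obtain ⟨ε, -, h2, h3⟩ := indRep_m_mono_apply (F := F) I S
  rw [h3]
  by_cases h : Disjoint S I
  · rw [hu _ (by rw [Finset.card_union_of_disjoint h, hI]), smul_zero]
  · rw [h2 h, zero_smul]

theorem gElt_three {L : Finset (Fin 6)} (hL : L.card = 3) (k : ℕ) :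
    gElt k L = mono k L - (Complex.I * sgn L Lᶜ) • mono k Lᶜ := by
  have : coefA k 3 = 1 := by
    rw [coefA, if_pos (by omega), Nat.add_sub_cancel, div_self]
    · norm_num
    · exact_mod_cast Nat.factorial_ne_zero k
  rw [gElt, opA_mono, hL, this, one_mul, Nat.add_sub_cancel, smul_smul]

/-- In length three A contains no power of d/dt, so it is t-linear. This supplies the elements f,
tf, t²f of `g` for `m_t_E_apply`. -/
theorem up_gElt_three {L : Finset (Fin 6)} (hL : L.card = 3) (k : ℕ) :
    up ℂ (gElt k L) = gElt (k + 1) L := by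
  have h : ∀ I, up ℂ (mono k I) = mono (k + 1) I := fun I => up_sing _ _ _
  rw [gElt_three hL, gElt_three hL, map_sub, map_smul, h, h]

theorem gElt_three_mem_constForm {L : Finset (Fin 6)} (hL : L.card = 3) :
    gElt 0 L ∈ constForm 3 := by
  have h := card_compl_add L
  rw [gElt_three hL]
  refine sub_mem (hL ▸ mono_mem_constForm L) (Submodule.smul_mem _ _ ?_)
  have : Lᶜ.card = 3 := by omega
  exact this ▸ mono_mem_constForm Lᶜ

/-- The self-dual `3`-form attached to `L` acts on coefficients outside `L` by its leading term. -/
theorem indRep_m_gElt_apply {L S : Finset (Fin 6)} (hL : L.card = 3) (hS : S.Nonempty)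
    (hd : Disjoint S L) : ∃ ε : ℂ, ε ≠ 0 ∧ ∀ (u : Coord F) (k : ℕ),
      (indRep F).m (gElt 0 L) u (k, S) = ε • u (k, S ∪ L) := by
  obtain ⟨ε, h1, -, h3⟩ := indRep_m_mono_apply (F := F) L S
  obtain ⟨ε', -, h2', h3'⟩ := indRep_m_mono_apply (F := F) Lᶜ S
  refine ⟨ε, h1 hd, fun u k => ?_⟩
  -- A nonempty S disjoint from L meets Lᶜ, so the dual monomial contributes nothing.
  have : ε' = 0 := h2' fun h => by
    have : S ≤ Lᶜ := by rwa [← disjoint_compl_right_iff, compl_compl]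
    exact hS.ne_empty (Finset.disjoint_self_iff_empty _ |>.mp (h.mono_right this))
  rw [gElt_three hL, map_sub, map_smul, LinearMap.sub_apply, LinearMap.smul_apply,
    Finsupp.sub_apply, Finsupp.smul_apply, h3, h3', this, zero_smul, smul_zero, sub_zero]

/-- Here ξ_i b_i contracts after wedging, so it projects to the monomials without index i. The
eigenvalue vanishes only for the full set, which therefore needs an argument of its own. -/
theorem indRep_E_apply (w : Coord F) (k : ℕ) (I : Finset (Fin 6)) :
    (indRep F).E w (k, I) = (Iᶜ.card : ℂ) • w (k, I) := by
  have h : ∀ i, ((indRep F).ξ i * (indRep F).b i) w (k, I) = if i ∈ Iᶜ then w (k, I) else 0 :=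
    fun i => by
      rw [Module.End.mul_apply, indRep_ξ_apply, indRep_b_apply, map_neg, neg_neg, contr_apply,
        wedge_apply]
      by_cases hi : i ∈ I
      · simp [hi]
      · rw [if_neg hi, if_pos (Finset.mem_insert_self _ _), Finset.erase_insert hi, smul_smul,
          sgn_singleton_sq hi, one_smul, if_pos (by simpa using hi)]
  rw [WeylClifford.E, LinearMap.sum_apply, Finsupp.finsetSum_apply]
  simp only [h]
  rw [Finset.sum_ite_mem, Finset.univ_inter, Finset.sum_const, ← Nat.cast_smul_eq_nsmul ℂ]

variable {π : K →ₗ[ℂ] Module.End ℂ F} {w : Coord F}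

theorem fib_rot_swap (r s : Fin 6) : fib (rot π r s) = -fib (rot π s r) := by
  rw [rot_swap]
  refine LinearMap.ext fun w => Finsupp.ext fun x => ?_
  rw [LinearMap.neg_apply, Finsupp.neg_apply, fib_apply, fib_apply, LinearMap.neg_apply]

theorem indAct_t_xi (hw : ∀ x ∈ gPos, indAct π x w = 0) (i : Fin 6) :
    indAct π (mono 1 {i}) w = 0 := by
  rw [← gElt_of_lt (by simp)]
  exact hw _ (gElt_mem_gPos (by simp [deg]))

/-- For L ⊆ J with |L| = 3, the coefficient of f · tE w at J \ L is a nonzero multiple of (k + 1)(6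
− |J|) w(k + 1, J). The bound |J| ≥ 4 makes J \ L nonempty and |J| ≤ 5 makes 6 − |J| nonzero. -/
theorem coeff_eq_zero_of_card_four_five (hw : ∀ x ∈ gPos, indAct π x w = 0) (k : ℕ)
    {J : Finset (Fin 6)} (h4 : 4 ≤ J.card) (h5 : J.card ≤ 5) : w (k + 1, J) = 0 := by
  obtain ⟨L, hLJ, hL⟩ := Finset.exists_subset_card_eq (show 3 ≤ J.card by omega)
  have h : ∀ k, indAct π (gElt k L) w = 0 := fun k =>
    hw _ (gElt_mem_gPos (by simp only [deg, hL]; omega))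
  have h1 := (indRep F).m_t_E_apply fib_rot_swap (indAct_t_xi hw) (h 0)
    (by rw [up_gElt_three hL]; exact h 1)
    (by rw [up_gElt_three hL, up_gElt_three hL]; exact h 2)
  have hS : (J \ L).Nonempty := by
    rw [← Finset.card_pos, Finset.card_sdiff_of_subset hLJ]; omega
  obtain ⟨ε, hε, h2⟩ := indRep_m_gElt_apply (F := F) hL hS Finset.sdiff_disjoint
  have h3 := DFunLike.congr_fun h1 (k, J \ L)
  rw [h2, Finset.sdiff_union_of_subset hLJ, Finsupp.zero_apply, smul_eq_zero, or_iff_right hε,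
    indRep_t_apply, down_apply, indRep_E_apply, smul_eq_zero,
    or_iff_right (by exact_mod_cast Nat.succ_ne_zero k), smul_eq_zero] at h3
  have := card_compl_add J
  exact h3.resolve_left (by norm_cast; omega)

/-- In the equation of tξ_i, with i ∉ J, the coefficient at J ∪ {i} receives nothing from terms
starting with the contraction ξ_i. What remains is ±(k + 1) w(k + 1, J) and the action of so(6) on
coefficients with two more η's and one Θ less. -/
theorem coeff_eq_zero_of_card_le_three (hw : ∀ x ∈ gPos, indAct π x w = 0) {k : ℕ}
    {J : Finset (Fin 6)} (hJ : J.card ≤ 5)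
    (h : ∀ J' : Finset (Fin 6), J'.card = J.card + 2 → w (k, J') = 0) : w (k + 1, J) = 0 := by
  obtain ⟨i, hi⟩ : ∃ i, i ∉ J := by
    by_contra! hall
    have : J = Finset.univ := Finset.eq_univ_iff_forall.mpr hall
    rw [this] at hJ; simp at hJ
  have h1 := indAct_t_xi hw i
  rw [indAct, WeylClifford.act_t_xi _ fib_rot_swap] at h1
  have h2 := DFunLike.congr_fun h1 (k, insert i J)
  have hξ : ∀ (x : Coord F) l, (indRep F).ξ i x (l, insert i J) = 0 := fun x l => by
    rw [indRep_ξ_apply, Finsupp.neg_apply, contr_apply, if_pos (Finset.mem_insert_self _ _),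
      neg_zero]
  have hs : (∑ r, (indRep F).ξ r * fib (rot π r i)) w (k, insert i J) = 0 := by
    rw [LinearMap.sum_apply, Finsupp.finsetSum_apply]
    refine Finset.sum_eq_zero fun r _ => ?_
    rw [Module.End.mul_apply, indRep_ξ_apply, Finsupp.neg_apply, contr_apply]
    split_ifs with hr
    · exact neg_zero
    · rw [fib_apply, h _ (by
        rw [Finset.card_insert_of_notMem hr, Finset.card_insert_of_notMem hi]), map_zero, smul_zero,
        neg_zero]
  simp only [LinearMap.add_apply, Finsupp.add_apply, Module.End.mul_apply, hξ, hs, add_zero,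
    Finsupp.zero_apply] at h2
  rw [indRep_t_apply, down_apply, WeylClifford.q, LinearMap.sub_apply, Finsupp.sub_apply,
    Module.End.mul_apply, hξ, zero_sub, indRep_b_apply, Finsupp.neg_apply, neg_neg, wedge_apply,
    if_pos (Finset.mem_insert_self _ _), Finset.erase_insert hi, smul_eq_zero,
    or_iff_right (by exact_mod_cast Nat.succ_ne_zero k), smul_eq_zero,
    or_iff_right (sgn_ne_zero (by simpa using hi))] at h2
  exact h2

/-- In the equation of a self-dual three-form, the coefficient at (k + 1, Lᶜ) meets the full set
through f P, as P raises the power of Θ. The other terms involve only w(k + 1, J) with |J| = 4,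
already zero. -/
theorem coeff_univ_eq_zero (hw : ∀ x ∈ gPos, indAct π x w = 0) (k : ℕ) :
    w (k, Finset.univ) = 0 := by
  obtain ⟨L, -, hL⟩ := Finset.exists_subset_card_eq
    (show 3 ≤ (Finset.univ : Finset (Fin 6)).card by simp)
  have hLc : Lᶜ.card = 3 := by have := card_compl_add L; omega
  have hf := gElt_three_mem_constForm hL
  have h1 : indAct π (gElt 0 L) w = 0 := hw _ (gElt_mem_gPos (by simp [deg, hL]))
  rw [indAct, WeylClifford.act_constForm_three _ hf] at h1
  have h2 := DFunLike.congr_fun h1 (k + 1, Lᶜ)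
  have hs1 : (∑ i, (indRep F).m (contr ℂ i (gElt 0 L)) * (indRep F).b i) w (k + 1, Lᶜ) = 0 := by
    rw [LinearMap.sum_apply, Finsupp.finsetSum_apply]
    refine Finset.sum_eq_zero fun i _ => indRep_m_constForm_apply (contr_mem_constForm i hf) ?_
    intro J hJ
    rw [indRep_b_apply, Finsupp.neg_apply, wedge_apply]
    split_ifs with hi
    · rw [coeff_eq_zero_of_card_four_five hw _ (by rw [Finset.card_erase_of_mem hi]; omega)
        (by rw [Finset.card_erase_of_mem hi]; omega), smul_zero, neg_zero]
    · exact neg_zero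
  have hs2 : (∑ r, ∑ s, (indRep F).m (contr ℂ r (contr ℂ s (gElt 0 L))) * fib (rot π r s)) w
      (k + 1, Lᶜ) = 0 := by
    rw [LinearMap.sum_apply, Finsupp.finsetSum_apply]
    refine Finset.sum_eq_zero fun r _ => ?_
    rw [LinearMap.sum_apply, Finsupp.finsetSum_apply]
    refine Finset.sum_eq_zero fun s _ =>
      indRep_m_constForm_apply (contr_mem_constForm r (contr_mem_constForm s hf)) ?_
    intro J hJ
    rw [fib_apply, coeff_eq_zero_of_card_four_five hw _ (by omega) (by omega), map_zero]
  obtain ⟨ε, hε, h3⟩ := indRep_m_gElt_apply (F := F) hL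
    (Finset.card_pos.mp (by omega : 0 < Lᶜ.card)) disjoint_compl_left
  rw [LinearMap.add_apply, LinearMap.sub_apply, LinearMap.smul_apply, LinearMap.neg_apply,
    Finsupp.add_apply, Finsupp.sub_apply, Finsupp.smul_apply, hs1, hs2, smul_zero, add_zero,
    sub_zero, Module.End.mul_apply, indRep_P_apply, map_neg, neg_neg, h3, up_apply_succ,
    Finset.union_comm, Finset.union_compl, Finsupp.zero_apply, smul_eq_zero, or_iff_right hε] at h2
  exact h2

/-- A vector killed by `g_{> 0}` has no components of degree `-6` or less. -/
theorem coeff_eq_zero_of_singular (hw : ∀ x ∈ gPos, indAct π x w = 0) {k : ℕ}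
    {I : Finset (Fin 6)} (h : 6 ≤ 2 * k + I.card) : w (k, I) = 0 := by
  have hI := card_compl_add I
  -- Sizes 2 and 3 reduce to sizes 4 and 5 at the cost of one Θ, and sizes 0 and 1 reduce to 2 and 3
  -- likewise. As sizes 4 and 5 need Θ at least once, the starting powers are 2 and 3.
  have h3 : ∀ k (J : Finset (Fin 6)), 2 ≤ J.card → J.card ≤ 3 → w (k + 2, J) = 0 :=
    fun k J h2 h3 => coeff_eq_zero_of_card_le_three hw (by omega) fun J' hJ' =>
      coeff_eq_zero_of_card_four_five hw k (by omega) (by omega)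
  have h1 : ∀ k (J : Finset (Fin 6)), J.card ≤ 1 → w (k + 3, J) = 0 := fun k J h1 =>
    coeff_eq_zero_of_card_le_three hw (by omega) fun J' hJ' => h3 k J' (by omega) (by omega)
  by_cases h6 : I.card = 6
  · have : I = Finset.univ := (Finset.card_eq_iff_eq_univ I).mp (by rw [h6, Fintype.card_fin])
    rw [this]; exact coeff_univ_eq_zero hw k
  by_cases h4 : 4 ≤ I.card
  · obtain ⟨k, rfl⟩ : ∃ l, k = l + 1 := ⟨k - 1, by omega⟩
    exact coeff_eq_zero_of_card_four_five hw k h4 (by omega)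
  by_cases h2 : 2 ≤ I.card
  · obtain ⟨k, rfl⟩ : ∃ l, k = l + 2 := ⟨k - 2, by omega⟩
    exact h3 k I h2 (by omega)
  · obtain ⟨k, rfl⟩ : ∃ l, k = l + 3 := ⟨k - 3, by omega⟩
    exact h1 k I (by omega)

/-! ### The Hodge dual -/

theorem T_apply (w : Coord F) (k : ℕ) (I : Finset (Fin 6)) :
    T w (k, I) = (sgn I Iᶜ : ℂ) • w (k, Iᶜ) := by
  induction w using Finsupp.induction_linear with
  | zero => simp
  | add f g hf hg => rw [map_add, Finsupp.add_apply, hf, hg, Finsupp.add_apply, smul_add]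
  | single x v =>
    obtain ⟨l, J⟩ := x
    have : T (Finsupp.single (l, J) v) = (sgn Jᶜ J : ℂ) • Finsupp.single (l, Jᶜ) v := by simp [T]
    rw [this]
    by_cases h : J = Iᶜ
    · subst h
      by_cases hl : l = k <;> simp [hl]
    · have h' : Jᶜ ≠ I := fun e => h (by rw [← e, compl_compl])
      simp [h, h']

end Vanishing

theorem sum_single_apply {F : Type*} [AddCommGroup F] (n a : ℕ) (f : Finset (Fin 6) → F)
    (k : ℕ) (J : Finset (Fin 6)) :
    (∑ I with n ≤ I.card, Finsupp.single (a, I) (f I) : Coord F) (k, J) =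
      if a = k ∧ n ≤ J.card then f J else 0 := by
  rw [Finsupp.finsetSum_apply, Finset.sum_filter]
  simp only [Finsupp.single_apply, Prod.mk.injEq]
  rw [Finset.sum_eq_single J]
  · by_cases h1 : a = k <;> by_cases h2 : n ≤ J.card <;> simp [h1, h2]
  · intro I _ h; simp [h]
  · simp

end CK6

end

theorem lemma4p1 {F : Type*} [AddCommGroup F] [Module ℂ F] [FiniteDimensional ℂ F]
    (ρ : CK6.gNonneg →ₗ[ℂ] Module.End ℂ F) (hρ : CK6.IsRep ρ) (hirr : CK6.IsIrred ρ) :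
    Function.Bijective (CK6.pbw ρ) ∧
    ∀ w : CK6.Coord F, CK6.IsSingular ρ (CK6.pbw ρ w) →
      (∀ k I, 2 < k → w (k, I) = 0) ∧
      ∃ v₂ v₁ v₀ : Finset (Fin 6) → F,
        CK6.T w =
          ∑ I with 5 ≤ I.card, Finsupp.single (2, I) (v₂ I) +
          ∑ I with 3 ≤ I.card, Finsupp.single (1, I) (v₁ I) +
          ∑ I with 1 ≤ I.card, Finsupp.single (0, I) (v₀ I) := by
  refine ⟨⟨CK6.pbw_injective hρ hirr, CK6.pbw_surjective hρ hirr⟩, fun w hw => ?_⟩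
  have h0 : ∀ {k I}, 6 ≤ 2 * k + I.card → w (k, I) = 0 := fun h =>
    CK6.coeff_eq_zero_of_singular
      (fun x hx => CK6.indAct_eq_zero_of_isSingular hρ hirr hw hx) h
  -- The witnesses are the coefficients of `T w` itself. As |Iᶜ| = 6 − |I|, the vanishing range 2k +
  -- |Iᶜ| ≥ 6 means |I| ≤ 2k, which gives the thresholds 1, 3, 5 and excludes k ≥ 3.
  refine ⟨fun k I hk => h0 (by omega), fun I => CK6.T w (2, I), fun I => CK6.T w (1, I),
    fun I => CK6.T w (0, I), Finsupp.ext fun ⟨k, I⟩ => ?_⟩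
  have hT : 6 ≤ 2 * k + Iᶜ.card → CK6.T w (k, I) = 0 := fun h => by
    rw [CK6.T_apply, h0 h, smul_zero]
  have hI := CK6.card_compl_add I
  rw [Finsupp.add_apply, Finsupp.add_apply, CK6.sum_single_apply, CK6.sum_single_apply,
    CK6.sum_single_apply]
  rcases k with _ | _ | _ | k
  · by_cases h : 1 ≤ I.card
    · simp [h]
    · simp [h, hT (by omega)]
  · by_cases h : 3 ≤ I.card
    · simp [h]
    · simp [h, hT (by omega)]
  · by_cases h : 5 ≤ I.card
    · simp [h]
    · simp [h, hT (by omega)]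
  · simp [hT (by omega)]
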